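/- **The calculus $\mathsf{POR}^\lambda$.** Types are generated from the base type $s$ (binary strings) by $\sigma\Rightarrow\tau$. Terms are simply typed $\lambda$-terms over the constants $\mathsf 0,\mathsf 1,\epsilon:s$; $\circ,\mathsf{Trunc},\mathsf{Times}:s\Rightarrow s\Rightarrow s$; $\mathsf{Tail},\mathsf{Flipcoin}:s\Rightarrow s$; $\mathsf{Cond}:s\Rightarrow s\Rightarrow s\Rightarrow s\Rightarrow s$; and $\mathsf{Rec}:s\Rightarrow(s\Rightarrow s\Rightarrow s)\Rightarrow(s\Rightarrow s\Rightarrow s)\Rightarrow(s\Rightarrow s)\Rightarrow s\Rightarrow s$. We write $xy$ for $x\circ y$. With $\mathsf b\in\{\mathsf 0,\mathsf 1\}$, its equational axioms (between terms of type $s$) are $$\epsilon x=x\epsilon=x,\quad x(y\mathsf b)=(xy)\mathsf b,\quad \mathsf{Tail}(\epsilon)=\epsilon,\quad \mathsf{Tail}(x\mathsf b)=x,$$ $$\mathsf{Trunc}(x,\epsilon)=\mathsf{Trunc}(\epsilon,x)=\epsilon,\quad \mathsf{Trunc}(x\mathsf b,y\mathsf 0)=\mathsf{Trunc}(x\mathsf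 b,y\mathsf 1)=\mathsf{Trunc}(x,y)\mathsf b,$$ $$\mathsf{Cond}(\epsilon,y,z,w)=y,\quad \mathsf{Cond}(x\mathsf 0,y,z,w)=z,\quad \mathsf{Cond}(x\mathsf 1,y,z,w)=w,\quad \mathsf{Bool}(\mathsf{Flipcoin}(x))=\mathsf 1,$$ $$\mathsf{Rec}(x,h_0,h_1,k,\epsilon)=x,\quad \mathsf{Rec}(x,h_0,h_1,k,y\mathsf b)=\mathsf{Trunc}(h_b\,y\,\mathsf{Rec}(x,h_0,h_1,k,y),\,k\,y),$$ $$\mathsf{Times}(x,\epsilon)=\epsilon,\quad \mathsf{Times}(x,y\mathsf b)=\mathsf{Times}(x,y)\,x,$$ together with $C[(\lambda x.t)u]=C[t\{u/x\}]$ and, for $x$ not free in $t$, $C[\lambda x.tx]=C[t]$, for every one-hole (variable-capturing) context $C[\ ]$ of type $s$. Here $\mathsf{Bool}(x):=\mathsf{BAnd}(\mathsf{Eps}(\mathsf{Tail}(x)),\mathsf{BNeg}(\mathsf{Eps}(x)))$ with $\mathsf B(x):=\mathsf{Cond}(x,\epsilon,\mathsf 0,\mathsf 1)$, $\mathsf{BNeg}(x):=\mathsf{Cond}(x,\epsilon,\mathsf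 1,\mathsf 0)$, $\mathsf{BAnd}(x,y):=\mathsf{Cond}(\mathsf B(x),\epsilon,\mathsf 0,\mathsf B(y))$, $\mathsf{Eps}(x):=\mathsf{Cond}(x,\mathsf 1,\mathsf 0,\mathsf 0)$. $\mathsf{Sub}$ is a fixed closed term for the characteristic function of "$x$ is a prefix of $y$", defined by bounded recursion: $\mathsf{Sub}(x,\epsilon)=\mathsf{Eps}(x)$, $\mathsf{Sub}(x,y\mathsf b)=\mathsf{BOr}(\mathsf{Sub}(x,y),\mathsf{Eq}(x,y\mathsf b))$, where $\mathsf{BOr}(x,y):=\mathsf{Cond}(\mathsf B(x),\mathsf B(y),\mathsf B(y),\mathsf 1)$ and $\mathsf{Eq}$ is a fixed term, also built by bounded recursion, for the characteristic function of string equality. **The theory $\mathcal I\mathsf{POR}^\lambda$.** Formulas are built from the atoms $t=u$, $t\subseteq u$, $\mathtt{Flip}(t)$ ($t,u$ terms of type $s$, possibly open) by $\wedge,\vee,\to$ and by $\forall,\exists$ over variables of all types; $\bot:=(\mathsf 0=\mathsf 1)$, $\neg F:=F\to\bot$, and $t\preceq u:=\mathsf{Times}(\mathsf 1,t)\subseteq\mathsf{Times}(\mathsf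 1,u)$. $\vdash$ denotes derivability in intuitionistic many-sorted predicate calculus with the rules of equality (reflexivity; replacement of equals in formulas; and if $\vdash t=u$ then $\vdash C[t]=C[u]$ for every context $C[\ ]$ of type $s$, also when the hole lies below $\lambda$-abstractions binding variables of $t,u$), from the axioms of $\mathsf{POR}^\lambda$ and: $x\subseteq y\leftrightarrow\mathsf{Sub}(x,y)=\mathsf 1$; $x=\epsilon\vee x=\mathsf{Tail}(x)\mathsf 0\vee x=\mathsf{Tail}(x)\mathsf 1$; $\mathsf 0=\mathsf 1\to x=\epsilon$; $\mathsf{Cond}(x,y,z,w)=w'\leftrightarrow(x=\epsilon\wedge w'=y)\vee(x=\mathsf{Tail}(x)\mathsf 0\wedge w'=z)\vee(x=\mathsf{Tail}(x)\mathsf 1\wedge w'=w)$; $\mathtt{Flip}(x)\leftrightarrow\mathsf{Flipcoin}(x)=\mathsf 1$; and the induction axioms $\big(F(\epsilon)\wedge(\forall x)(F(x)\to F(x\mathsf 0))\wedge(\forall x)(F(x)\to F(x\mathsf 1))\big)\to(\forall y)F(y)$ for $F$ of the form $(\exists z)(z\preceq t\wedge u=v)$, where $z$ is not free in $t$ and all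 free variables of $t$ have type $s$. A $\Sigma^b_0$-formula is one obtained from atoms by Boolean operations and subword quantification $(\forall x)\big((\exists w)(w\subseteq t\wedge wx\subseteq t)\to F\big)$, $(\exists x)(\exists w)(w\subseteq t\wedge wx\subseteq t\wedge F)$; a $\Sigma^b_1$-formula is one of the form $(\exists x_1\preceq t_1)\cdots(\exists x_n\preceq t_n)F$ with $F\in\Sigma^b_0$, where $(\exists x\preceq t)G:=(\exists x)(x\preceq t\wedge G)$. **Realizability.** For a formula $F$ and a finite sequence of terms $\mathbf t$ of the types determined by $F$, the formula $\mathbf t\circledR F$ is defined as follows ($\Lambda$ is the empty sequence, $\mathbf y(\mathbf x)$ the sequence $y_1\mathbf x,\dots,y_k\mathbf x$, with $y(\Lambda)=y$; bound variables are fresh): $$\begin{aligned} \Lambda\circledR F&:=F\quad(F\text{ atomic})\\ \mathbf x,\mathbf y\circledR(G\wedge H)&:=(\mathbf x\circledR G)\wedge(\mathbf y\circledR H)\\ z,\mathbf x,\mathbf y\circledR(G\vee H)&:=(z=\mathsf 0\wedge\mathbf x\circledR G)\vee(z\ne\mathsf 0\wedge\mathbf y\circledR H)\\ \mathbf y\circledR(G\to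 H)&:=(\forall\mathbf x)(\mathbf x\circledR G\to\mathbf y(\mathbf x)\circledR H)\wedge(G\to H)\\ z,\mathbf x\circledR(\exists y)G&:=\mathbf x\circledR G\{z/y\}\\ \mathbf x\circledR(\forall y)G&:=(\forall y)(\mathbf x(y)\circledR G). \end{aligned}$$ **Theorem.** 1. (Soundness) For every formula $F$ and all terms $\mathbf t$ of the appropriate types: if $\vdash\mathbf t\circledR F$, then $\vdash F$. 2. (Completeness) For every formula $F$: if $\vdash F$, then there are terms $\mathbf t$, with free variables among those of $F$'s context, such that $\vdash\mathbf t\circledR F$. 3. If $F(x,y)$ is a $\Sigma^b_1$-formula with at most $x,y:s$ free and $\vdash(\forall x)(\exists y)F(x,y)$, then there is a closed term $t:s\Rightarrow s$ of $\mathsf{POR}^\lambda$ such that $\vdash(\forall x)F(x,t\,x)$. -/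

import Mathlib

namespace IPOR

/-! ### Types and terms of the calculus (intrinsically typed, de Bruijn variables) -/

/-- Simple types over the single base type `s` of binary strings. -/
inductive Ty : Type
  | s : Ty
  | arr : Ty → Ty → Ty

infixr:65 " ⇒' " => Ty.arr

/-- A typing context: the list of the types of the variables in scope, innermost first. -/
abbrev Ctx : Type := List Ty

/-- `Var Γ a`: the variables of type `a` in the context `Γ`. -/
inductive Var : Ctx → Ty → Type
  | zero {Γ : Ctx} {a : Ty} : Var (a :: Γ) a
  | succ {Γ : Ctx} {a b : Ty} : Var Γ a → Var (b :: Γ) a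

/-- The constants. `times` is string multiplication (self-concatenation). -/
inductive Con : Ty → Type
  | zero : Con Ty.s
  | one : Con Ty.s
  | eps : Con Ty.s
  | cat : Con (Ty.s ⇒' Ty.s ⇒' Ty.s)
  | tail : Con (Ty.s ⇒' Ty.s)
  | trunc : Con (Ty.s ⇒' Ty.s ⇒' Ty.s)
  | cond : Con (Ty.s ⇒' Ty.s ⇒' Ty.s ⇒' Ty.s ⇒' Ty.s)
  | flipcoin : Con (Ty.s ⇒' Ty.s)
  | recn : Con (Ty.s ⇒' (Ty.s ⇒' Ty.s ⇒' Ty.s) ⇒' (Ty.s ⇒' Ty.s ⇒' Ty.s) ⇒'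
      (Ty.s ⇒' Ty.s) ⇒' Ty.s ⇒' Ty.s)
  | times : Con (Ty.s ⇒' Ty.s ⇒' Ty.s)

/-- `Tm Γ a`: the terms of type `a` with free variables in `Γ`. -/
inductive Tm : Ctx → Ty → Type
  | var {Γ : Ctx} {a : Ty} : Var Γ a → Tm Γ a
  | con {Γ : Ctx} {a : Ty} : Con a → Tm Γ a
  | app {Γ : Ctx} {a b : Ty} : Tm Γ (a ⇒' b) → Tm Γ a → Tm Γ b
  | lam {Γ : Ctx} {a b : Ty} : Tm (a :: Γ) b → Tm Γ (a ⇒' b)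

/-! ### Renaming and capture-avoiding substitution -/

/-- Renamings of variables. -/
abbrev Ren (Γ Δ : Ctx) : Type := ∀ a : Ty, Var Γ a → Var Δ a

/-- Simultaneous substitutions. -/
abbrev Sb (Γ Δ : Ctx) : Type := ∀ a : Ty, Var Γ a → Tm Δ a

/-- The weakening by one fresh variable. -/
def Ren.wk {Γ : Ctx} (b : Ty) : Ren Γ (b :: Γ) := fun _ x => Var.succ x

/-- A renaming under a binder. -/
def Ren.lift {Γ Δ : Ctx} (ρ : Ren Γ Δ) (b : Ty) : Ren (b :: Γ) (b :: Δ)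
  | _, Var.zero => Var.zero
  | _, Var.succ x => Var.succ (ρ _ x)

def Tm.ren : {Γ Δ : Ctx} → {a : Ty} → Ren Γ Δ → Tm Γ a → Tm Δ a
  | _, _, _, ρ, Tm.var x => Tm.var (ρ _ x)
  | _, _, _, _, Tm.con c => Tm.con c
  | _, _, _, ρ, Tm.app t u => Tm.app (t.ren ρ) (u.ren ρ)
  | _, _, _, ρ, Tm.lam t => Tm.lam (t.ren (ρ.lift _))

/-- `t` seen in a context with one more variable (not occurring in `t`). -/
def Tm.wk {Γ : Ctx} {a : Ty} (b : Ty) (t : Tm Γ a) : Tm (b :: Γ) a := t.ren (Ren.wk b)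

/-- The identity substitution. -/
def Sb.id (Γ : Ctx) : Sb Γ Γ := fun _ x => Tm.var x

/-- Extends a substitution by a term for the innermost variable. -/
def Sb.cons {Γ Δ : Ctx} {b : Ty} (u : Tm Δ b) (σ : Sb Γ Δ) : Sb (b :: Γ) Δ
  | _, Var.zero => u
  | _, Var.succ x => σ _ x

/-- A substitution followed by a weakening. -/
def Sb.wk {Γ Δ : Ctx} (σ : Sb Γ Δ) (b : Ty) : Sb Γ (b :: Δ) := fun _ x => (σ _ x).wk b

/-- A substitution under a binder. -/
def Sb.lift {Γ Δ : Ctx} (σ : Sb Γ Δ) (b : Ty) : Sb (b :: Γ) (b :: Δ) :=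
  Sb.cons (Tm.var Var.zero) (σ.wk b)

/-- The substitution of `u` for the innermost variable. -/
def Sb.inst {Γ : Ctx} {b : Ty} (u : Tm Γ b) : Sb (b :: Γ) Γ := Sb.cons u (Sb.id Γ)

def Tm.subst : {Γ Δ : Ctx} → {a : Ty} → Sb Γ Δ → Tm Γ a → Tm Δ a
  | _, _, _, σ, Tm.var x => σ _ x
  | _, _, _, _, Tm.con c => Tm.con c
  | _, _, _, σ, Tm.app t u => Tm.app (t.subst σ) (u.subst σ)
  | _, _, _, σ, Tm.lam t => Tm.lam (t.subst (σ.lift _))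

/-- Every free variable of the term satisfies `P`. -/
def Tm.FreeVarsIn : {Γ : Ctx} → {a : Ty} → Tm Γ a → (∀ b : Ty, Var Γ b → Prop) → Prop
  | _, _, Tm.var x, P => P _ x
  | _, _, Tm.con _, _ => True
  | _, _, Tm.app t u, P => t.FreeVarsIn P ∧ u.FreeVarsIn P
  | Γ, _, @Tm.lam _ a _ t, P =>
      t.FreeVarsIn (fun b (x : Var (a :: Γ) b) => ∀ y : Var Γ b, x = Var.succ y → P b y)

/-- All free variables of the term are first-order, that is, of type `s`. -/
def Tm.FirstOrder {Γ : Ctx} {a : Ty} (t : Tm Γ a) : Prop :=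
  t.FreeVarsIn (fun b _ => b = Ty.s)

/-! ### Abbreviations for terms of type `s` -/

section Abbreviations

variable {Γ : Ctx}

def zeroT : Tm Γ Ty.s := Tm.con Con.zero
def oneT : Tm Γ Ty.s := Tm.con Con.one
def epsT : Tm Γ Ty.s := Tm.con Con.eps

/-- The constant `0` or `1`. -/
def bitT : Bool → Tm Γ Ty.s
  | false => zeroT
  | true => oneT

def catT (x y : Tm Γ Ty.s) : Tm Γ Ty.s := Tm.app (Tm.app (Tm.con Con.cat) x) y
def tailT (x : Tm Γ Ty.s) : Tm Γ Ty.s := Tm.app (Tm.con Con.tail) x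
def truncT (x y : Tm Γ Ty.s) : Tm Γ Ty.s := Tm.app (Tm.app (Tm.con Con.trunc) x) y
def condT (x y z w : Tm Γ Ty.s) : Tm Γ Ty.s :=
  Tm.app (Tm.app (Tm.app (Tm.app (Tm.con Con.cond) x) y) z) w
def flipcoinT (x : Tm Γ Ty.s) : Tm Γ Ty.s := Tm.app (Tm.con Con.flipcoin) x
def timesT (x y : Tm Γ Ty.s) : Tm Γ Ty.s := Tm.app (Tm.app (Tm.con Con.times) x) y

/-- Bounded recursion on notation: `recT x h₀ h₁ k y`. -/
def recT (x : Tm Γ Ty.s) (h₀ h₁ : Tm Γ (Ty.s ⇒' Ty.s ⇒' Ty.s)) (k : Tm Γ (Ty.s ⇒' Ty.s))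
    (y : Tm Γ Ty.s) : Tm Γ Ty.s :=
  Tm.app (Tm.app (Tm.app (Tm.app (Tm.app (Tm.con Con.recn) x) h₀) h₁) k) y

/-- The string `x` followed by the bit `b`. -/
def snocT (x : Tm Γ Ty.s) (b : Bool) : Tm Γ Ty.s := catT x (bitT b)

/-- The last digit of `x`. -/
def BT (x : Tm Γ Ty.s) : Tm Γ Ty.s := condT x epsT zeroT oneT
def BNegT (x : Tm Γ Ty.s) : Tm Γ Ty.s := condT x epsT oneT zeroT
def BOrT (x y : Tm Γ Ty.s) : Tm Γ Ty.s := condT (BT x) (BT y) (BT y) oneT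
def BAndT (x y : Tm Γ Ty.s) : Tm Γ Ty.s := condT (BT x) epsT zeroT (BT y)
/-- The characteristic function of `x = ε`. -/
def EpsT (x : Tm Γ Ty.s) : Tm Γ Ty.s := condT x oneT zeroT zeroT
/-- The characteristic function of `x = 0 ∨ x = 1`. -/
def BoolT (x : Tm Γ Ty.s) : Tm Γ Ty.s := BAndT (EpsT (tailT x)) (BNegT (EpsT x))

/-- `λ x y. Drop(x, y)`, the string `x` without its last `|y|` digits:
`Drop(x, ε) = x` and `Drop(x, y b) = Tail(Drop(x, y))`, with length bound `x`. -/
def dropC : Tm Γ (Ty.s ⇒' Ty.s ⇒' Ty.s) :=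
  Tm.lam (Tm.lam (recT (Tm.var (Var.succ Var.zero))
    (Tm.lam (Tm.lam (tailT (Tm.var Var.zero))))
    (Tm.lam (Tm.lam (tailT (Tm.var Var.zero))))
    (Tm.lam (Tm.var (Var.succ (Var.succ Var.zero))))
    (Tm.var Var.zero)))

def dropT (x y : Tm Γ Ty.s) : Tm Γ Ty.s := Tm.app (Tm.app dropC x) y

/-- The last digit of the prefix of `x` of length `|y|` (for `1 ≤ |y| ≤ |x|`). -/
def digitT (x y : Tm Γ Ty.s) : Tm Γ Ty.s := BT (dropT x (dropT x y))

/-- `λ x y. Match(x, y)`: for `|x| = |y|`, the characteristic function of `x = y`, by comparing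
the digits one by one:
`Match(x, ε) = 1`, `Match(x, y0) = BAnd(Match(x, y), BNeg(digit(x, y0)))`,
`Match(x, y1) = BAnd(Match(x, y), digit(x, y1))`, with length bound `0`. -/
def matchC : Tm Γ (Ty.s ⇒' Ty.s ⇒' Ty.s) :=
  Tm.lam (Tm.lam (recT oneT
    (Tm.lam (Tm.lam (BAndT (Tm.var Var.zero)
      (BNegT (digitT (Tm.var (Var.succ (Var.succ (Var.succ Var.zero))))
        (snocT (Tm.var (Var.succ Var.zero)) false))))))
    (Tm.lam (Tm.lam (BAndT (Tm.var Var.zero)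
      (digitT (Tm.var (Var.succ (Var.succ (Var.succ Var.zero))))
        (snocT (Tm.var (Var.succ Var.zero)) true)))))
    (Tm.lam zeroT)
    (Tm.var Var.zero)))

/-- The characteristic function of `x = y`: equal lengths and equal digits. -/
def EqT (x y : Tm Γ Ty.s) : Tm Γ Ty.s :=
  BAndT (BAndT (EpsT (dropT x y)) (EpsT (dropT y x))) (Tm.app (Tm.app matchC x) y)

/-- `λ x y. Sub(x, y)`, the characteristic function of "`x` is a prefix of `y`":
`Sub(x, ε) = Eps(x)`, `Sub(x, y b) = BOr(Sub(x, y), Eq(x, y b))`, with length bound `0`. -/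
def subC : Tm Γ (Ty.s ⇒' Ty.s ⇒' Ty.s) :=
  Tm.lam (Tm.lam (recT (EpsT (Tm.var (Var.succ Var.zero)))
    (Tm.lam (Tm.lam (BOrT (Tm.var Var.zero)
      (EqT (Tm.var (Var.succ (Var.succ (Var.succ Var.zero))))
        (snocT (Tm.var (Var.succ Var.zero)) false)))))
    (Tm.lam (Tm.lam (BOrT (Tm.var Var.zero)
      (EqT (Tm.var (Var.succ (Var.succ (Var.succ Var.zero))))
        (snocT (Tm.var (Var.succ Var.zero)) true)))))
    (Tm.lam zeroT)
    (Tm.var Var.zero)))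

def SubT (x y : Tm Γ Ty.s) : Tm Γ Ty.s := Tm.app (Tm.app subC x) y

end Abbreviations

/-! ### Equations of the calculus -/

/-- `TmCx Δ τ Γ a`: term contexts `C[ ]` of type `a` over `Γ` with exactly one hole, of type `τ`;
`Δ` extends `Γ` by the variables bound in `C` above the hole. -/
inductive TmCx (Δ : Ctx) (τ : Ty) : Ctx → Ty → Type
  | hole : TmCx Δ τ Δ τ
  | appL {Γ : Ctx} {a b : Ty} : TmCx Δ τ Γ (a ⇒' b) → Tm Γ a → TmCx Δ τ Γ b
  | appR {Γ : Ctx} {a b : Ty} : Tm Γ (a ⇒' b) → TmCx Δ τ Γ a → TmCx Δ τ Γ b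
  | lam {Γ : Ctx} {a b : Ty} : TmCx Δ τ (a :: Γ) b → TmCx Δ τ Γ (a ⇒' b)

/-- `C[t]`, the (variable-capturing) replacement of the hole by `t`. -/
def TmCx.fill {Δ : Ctx} {τ : Ty} (t : Tm Δ τ) : {Γ : Ctx} → {a : Ty} → TmCx Δ τ Γ a → Tm Γ a
  | _, _, TmCx.hole => t
  | _, _, TmCx.appL C u => Tm.app (C.fill t) u
  | _, _, TmCx.appR u C => Tm.app u (C.fill t)
  | _, _, TmCx.lam C => Tm.lam (C.fill t)

/-- The axioms of the equational theory: defining equations of the constants, (β) and (ν). -/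
inductive EqAx : {Γ : Ctx} → Tm Γ Ty.s → Tm Γ Ty.s → Prop
  | eps_cat {Γ : Ctx} (x : Tm Γ Ty.s) : EqAx (catT epsT x) x
  | cat_eps {Γ : Ctx} (x : Tm Γ Ty.s) : EqAx (catT x epsT) x
  | cat_snoc {Γ : Ctx} (x y : Tm Γ Ty.s) (b : Bool) :
      EqAx (catT x (snocT y b)) (snocT (catT x y) b)
  | tail_eps {Γ : Ctx} : EqAx (tailT (epsT : Tm Γ Ty.s)) epsT
  | tail_snoc {Γ : Ctx} (x : Tm Γ Ty.s) (b : Bool) : EqAx (tailT (snocT x b)) x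
  | trunc_eps {Γ : Ctx} (x : Tm Γ Ty.s) : EqAx (truncT x epsT) epsT
  | eps_trunc {Γ : Ctx} (x : Tm Γ Ty.s) : EqAx (truncT epsT x) epsT
  | trunc_snoc {Γ : Ctx} (x y : Tm Γ Ty.s) (b c : Bool) :
      EqAx (truncT (snocT x b) (snocT y c)) (snocT (truncT x y) b)
  | cond_eps {Γ : Ctx} (y z w : Tm Γ Ty.s) : EqAx (condT epsT y z w) y
  | cond_zero {Γ : Ctx} (x y z w : Tm Γ Ty.s) : EqAx (condT (snocT x false) y z w) z
  | cond_one {Γ : Ctx} (x y z w : Tm Γ Ty.s) : EqAx (condT (snocT x true) y z w) w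
  | flipcoin {Γ : Ctx} (x : Tm Γ Ty.s) : EqAx (BoolT (flipcoinT x)) oneT
  | rec_eps {Γ : Ctx} (x : Tm Γ Ty.s) (h₀ h₁ : Tm Γ (Ty.s ⇒' Ty.s ⇒' Ty.s))
      (k : Tm Γ (Ty.s ⇒' Ty.s)) : EqAx (recT x h₀ h₁ k epsT) x
  | rec_zero {Γ : Ctx} (x : Tm Γ Ty.s) (h₀ h₁ : Tm Γ (Ty.s ⇒' Ty.s ⇒' Ty.s))
      (k : Tm Γ (Ty.s ⇒' Ty.s)) (y : Tm Γ Ty.s) :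
      EqAx (recT x h₀ h₁ k (snocT y false))
        (truncT (Tm.app (Tm.app h₀ y) (recT x h₀ h₁ k y)) (Tm.app k y))
  | rec_one {Γ : Ctx} (x : Tm Γ Ty.s) (h₀ h₁ : Tm Γ (Ty.s ⇒' Ty.s ⇒' Ty.s))
      (k : Tm Γ (Ty.s ⇒' Ty.s)) (y : Tm Γ Ty.s) :
      EqAx (recT x h₀ h₁ k (snocT y true))
        (truncT (Tm.app (Tm.app h₁ y) (recT x h₀ h₁ k y)) (Tm.app k y))
  | times_eps {Γ : Ctx} (x : Tm Γ Ty.s) : EqAx (timesT x epsT) epsT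
  | times_snoc {Γ : Ctx} (x y : Tm Γ Ty.s) (b : Bool) :
      EqAx (timesT x (snocT y b)) (catT (timesT x y) x)
  | beta {Γ Δ : Ctx} {a b : Ty} (C : TmCx Δ b Γ Ty.s) (t : Tm (a :: Δ) b) (u : Tm Δ a) :
      EqAx (C.fill (Tm.app (Tm.lam t) u)) (C.fill (t.subst (Sb.inst u)))
  | eta {Γ Δ : Ctx} {a b : Ty} (C : TmCx Δ (a ⇒' b) Γ Ty.s) (t : Tm Δ (a ⇒' b)) :
      EqAx (C.fill (Tm.lam (Tm.app (t.wk a) (Tm.var Var.zero)))) (C.fill t)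

/-! ### Formulas -/

/-- `Fm Γ`: formulas with free variables in `Γ`. The atoms are equations between terms of type `s`,
`t ⊆ u` and `Flip(t)`; quantifiers range over variables of any type. -/
inductive Fm : Ctx → Type
  | eq {Γ : Ctx} : Tm Γ Ty.s → Tm Γ Ty.s → Fm Γ
  | pre {Γ : Ctx} : Tm Γ Ty.s → Tm Γ Ty.s → Fm Γ
  | flip {Γ : Ctx} : Tm Γ Ty.s → Fm Γ
  | and {Γ : Ctx} : Fm Γ → Fm Γ → Fm Γ
  | or {Γ : Ctx} : Fm Γ → Fm Γ → Fm Γ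
  | imp {Γ : Ctx} : Fm Γ → Fm Γ → Fm Γ
  | all {Γ : Ctx} (a : Ty) : Fm (a :: Γ) → Fm Γ
  | ex {Γ : Ctx} (a : Ty) : Fm (a :: Γ) → Fm Γ

def Fm.subst : {Γ Δ : Ctx} → Sb Γ Δ → Fm Γ → Fm Δ
  | _, _, σ, Fm.eq t u => Fm.eq (t.subst σ) (u.subst σ)
  | _, _, σ, Fm.pre t u => Fm.pre (t.subst σ) (u.subst σ)
  | _, _, σ, Fm.flip t => Fm.flip (t.subst σ)
  | _, _, σ, Fm.and F G => Fm.and (F.subst σ) (G.subst σ)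
  | _, _, σ, Fm.or F G => Fm.or (F.subst σ) (G.subst σ)
  | _, _, σ, Fm.imp F G => Fm.imp (F.subst σ) (G.subst σ)
  | _, _, σ, Fm.all a F => Fm.all a (F.subst (σ.lift a))
  | _, _, σ, Fm.ex a F => Fm.ex a (F.subst (σ.lift a))

/-- The renaming `ρ` applied to a formula. -/
def Fm.ren {Γ Δ : Ctx} (ρ : Ren Γ Δ) (F : Fm Γ) : Fm Δ := F.subst (fun _ x => Tm.var (ρ _ x))

/-- `F` seen in a context with one more variable (not occurring in `F`). -/
def Fm.wk {Γ : Ctx} (b : Ty) (F : Fm Γ) : Fm (b :: Γ) := F.ren (Ren.wk b)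

/-- `F{u/x}` for the innermost variable `x`. -/
def Fm.inst {Γ : Ctx} {b : Ty} (F : Fm (b :: Γ)) (u : Tm Γ b) : Fm Γ := F.subst (Sb.inst u)

/-- `⊥ := (0 = 1)`. -/
def Fm.bot {Γ : Ctx} : Fm Γ := Fm.eq zeroT oneT

def Fm.neg {Γ : Ctx} (F : Fm Γ) : Fm Γ := Fm.imp F Fm.bot

def Fm.iff {Γ : Ctx} (F G : Fm Γ) : Fm Γ := Fm.and (Fm.imp F G) (Fm.imp G F)

/-- `t ≼ u`, that is `1^t ⊆ 1^u`, where `1^t` is `Times(1, t)`. -/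
def Fm.le {Γ : Ctx} (t u : Tm Γ Ty.s) : Fm Γ := Fm.pre (timesT oneT t) (timesT oneT u)

/-- Bounded quantification `(∃ x ≼ t) F`; `x` is not free in `t`. -/
def Fm.exLe {Γ : Ctx} (t : Tm Γ Ty.s) (F : Fm (Ty.s :: Γ)) : Fm Γ :=
  Fm.ex Ty.s (Fm.and (Fm.le (Tm.var Var.zero) (t.wk Ty.s)) F)

/-- `(∃ w ⊆ t)(w x ⊆ t ∧ F) := (∃ w)(w ⊆ t ∧ (w x ⊆ t ∧ F))` for the innermost variable `x`;
`x` is not free in `t` and `w` is not free in `t` and `F`. -/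
def Fm.exSubword {Γ : Ctx} (t : Tm Γ Ty.s) (F : Fm (Ty.s :: Γ)) : Fm Γ :=
  Fm.ex Ty.s (Fm.ex Ty.s
    (Fm.and (Fm.pre (Tm.var Var.zero) ((t.wk Ty.s).wk Ty.s))
      (Fm.and
        (Fm.pre (catT (Tm.var Var.zero) (Tm.var (Var.succ Var.zero))) ((t.wk Ty.s).wk Ty.s))
        (F.wk Ty.s))))

/-- Subword quantification `(∀ x ⊆* t) F := (∀ x)((∃ w ⊆ t)(w x ⊆ t) → F)`. -/
def Fm.allSubword {Γ : Ctx} (t : Tm Γ Ty.s) (F : Fm (Ty.s :: Γ)) : Fm Γ :=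
  Fm.all Ty.s (Fm.imp
    (Fm.ex Ty.s
      (Fm.and (Fm.pre (Tm.var Var.zero) ((t.wk Ty.s).wk Ty.s))
        (Fm.pre (catT (Tm.var Var.zero) (Tm.var (Var.succ Var.zero))) ((t.wk Ty.s).wk Ty.s))))
    F)

/-- `Σᵇ₀`-formulas: the closure of the atoms under Boolean operations (negation is implication of
the atom `⊥`) and subword quantification. -/
inductive SigmaB0 : {Γ : Ctx} → Fm Γ → Prop
  | eq {Γ : Ctx} (t u : Tm Γ Ty.s) : SigmaB0 (Fm.eq t u)
  | pre {Γ : Ctx} (t u : Tm Γ Ty.s) : SigmaB0 (Fm.pre t u)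
  | flip {Γ : Ctx} (t : Tm Γ Ty.s) : SigmaB0 (Fm.flip t)
  | and {Γ : Ctx} {F G : Fm Γ} : SigmaB0 F → SigmaB0 G → SigmaB0 (Fm.and F G)
  | or {Γ : Ctx} {F G : Fm Γ} : SigmaB0 F → SigmaB0 G → SigmaB0 (Fm.or F G)
  | imp {Γ : Ctx} {F G : Fm Γ} : SigmaB0 F → SigmaB0 G → SigmaB0 (Fm.imp F G)
  | allSubword {Γ : Ctx} (t : Tm Γ Ty.s) {F : Fm (Ty.s :: Γ)} :
      SigmaB0 F → SigmaB0 (Fm.allSubword t F)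
  | exSubword {Γ : Ctx} (t : Tm Γ Ty.s) {F : Fm (Ty.s :: Γ)} :
      SigmaB0 F → SigmaB0 (Fm.exSubword t F)

/-- `Σᵇ₁`-formulas: `(∃ x₁ ≼ t₁) ⋯ (∃ xₙ ≼ tₙ) F` with `F` a `Σᵇ₀`-formula. -/
inductive SigmaB1 : {Γ : Ctx} → Fm Γ → Prop
  | base {Γ : Ctx} {F : Fm Γ} : SigmaB0 F → SigmaB1 F
  | exLe {Γ : Ctx} (t : Tm Γ Ty.s) {F : Fm (Ty.s :: Γ)} : SigmaB1 F → SigmaB1 (Fm.exLe t F)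

/-! ### The theory -/

/-- `F(x b)` for the innermost variable `x` and a bit `b`. -/
def Fm.succBit {Γ : Ctx} (F : Fm (Ty.s :: Γ)) (b : Bool) : Fm (Ty.s :: Γ) :=
  F.subst (Sb.cons (snocT (Tm.var Var.zero) b) (fun _ x => Tm.var (Var.succ x)))

/-- Induction on notation for `F(x)`, with `x` the innermost variable:
`(F(ε) ∧ (∀x)(F(x) → F(x0)) ∧ (∀x)(F(x) → F(x1))) → (∀y)F(y)`. -/
def Fm.induction {Γ : Ctx} (F : Fm (Ty.s :: Γ)) : Fm Γ :=
  Fm.imp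
    (Fm.and (F.inst epsT)
      (Fm.and (Fm.all Ty.s (Fm.imp F (F.succBit false)))
        (Fm.all Ty.s (Fm.imp F (F.succBit true)))))
    (Fm.all Ty.s F)

/-- The non-logical axioms other than equations. -/
inductive Ax : {Γ : Ctx} → Fm Γ → Prop
  | pre {Γ : Ctx} (x y : Tm Γ Ty.s) : Ax (Fm.iff (Fm.pre x y) (Fm.eq (SubT x y) oneT))
  | cases {Γ : Ctx} (x : Tm Γ Ty.s) :
      Ax (Fm.or (Fm.eq x epsT)
        (Fm.or (Fm.eq x (snocT (tailT x) false)) (Fm.eq x (snocT (tailT x) true))))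
  | zero_one {Γ : Ctx} (x : Tm Γ Ty.s) : Ax (Fm.imp (Fm.eq zeroT oneT) (Fm.eq x epsT))
  | cond {Γ : Ctx} (x y z w w' : Tm Γ Ty.s) :
      Ax (Fm.iff (Fm.eq (condT x y z w) w')
        (Fm.or (Fm.and (Fm.eq x epsT) (Fm.eq w' y))
          (Fm.or (Fm.and (Fm.eq x (snocT (tailT x) false)) (Fm.eq w' z))
            (Fm.and (Fm.eq x (snocT (tailT x) true)) (Fm.eq w' w)))))
  | flip {Γ : Ctx} (x : Tm Γ Ty.s) : Ax (Fm.iff (Fm.flip x) (Fm.eq (flipcoinT x) oneT))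
  /-- Induction for the formulas `(∃ z ≼ t) u = v`, `t` with first-order free variables only. -/
  | induction {Γ : Ctx} (t : Tm (Ty.s :: Γ) Ty.s) (u v : Tm (Ty.s :: Ty.s :: Γ) Ty.s) :
      t.FirstOrder → Ax (Fm.induction (Fm.exLe t (Fm.eq u v)))

/-- `Prov H F`: the formula `F` is derivable from the hypotheses `H` in the intuitionistic theory
(natural deduction). The equality rules are reflexivity, replacement of equals in formulas, and
replacement of provably equal terms in term contexts, also below abstractions. -/
inductive Prov : {Γ : Ctx} → List (Fm Γ) → Fm Γ → Prop
  | hyp {Γ : Ctx} {H : List (Fm Γ)} {F : Fm Γ} : F ∈ H → Prov H F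
  | andI {Γ : Ctx} {H : List (Fm Γ)} {F G : Fm Γ} : Prov H F → Prov H G → Prov H (Fm.and F G)
  | andE₁ {Γ : Ctx} {H : List (Fm Γ)} {F G : Fm Γ} : Prov H (Fm.and F G) → Prov H F
  | andE₂ {Γ : Ctx} {H : List (Fm Γ)} {F G : Fm Γ} : Prov H (Fm.and F G) → Prov H G
  | orI₁ {Γ : Ctx} {H : List (Fm Γ)} {F G : Fm Γ} : Prov H F → Prov H (Fm.or F G)
  | orI₂ {Γ : Ctx} {H : List (Fm Γ)} {F G : Fm Γ} : Prov H G → Prov H (Fm.or F G)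
  | orE {Γ : Ctx} {H : List (Fm Γ)} {F G K : Fm Γ} :
      Prov H (Fm.or F G) → Prov (F :: H) K → Prov (G :: H) K → Prov H K
  | impI {Γ : Ctx} {H : List (Fm Γ)} {F G : Fm Γ} : Prov (F :: H) G → Prov H (Fm.imp F G)
  | impE {Γ : Ctx} {H : List (Fm Γ)} {F G : Fm Γ} : Prov H (Fm.imp F G) → Prov H F → Prov H G
  | botE {Γ : Ctx} {H : List (Fm Γ)} {F : Fm Γ} : Prov H Fm.bot → Prov H F
  | allI {Γ : Ctx} {H : List (Fm Γ)} {a : Ty} {F : Fm (a :: Γ)} :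
      Prov (H.map (Fm.wk a)) F → Prov H (Fm.all a F)
  | allE {Γ : Ctx} {H : List (Fm Γ)} {a : Ty} {F : Fm (a :: Γ)} (t : Tm Γ a) :
      Prov H (Fm.all a F) → Prov H (F.inst t)
  | exI {Γ : Ctx} {H : List (Fm Γ)} {a : Ty} {F : Fm (a :: Γ)} (t : Tm Γ a) :
      Prov H (F.inst t) → Prov H (Fm.ex a F)
  | exE {Γ : Ctx} {H : List (Fm Γ)} {a : Ty} {F : Fm (a :: Γ)} {K : Fm Γ} :
      Prov H (Fm.ex a F) → Prov (F :: H.map (Fm.wk a)) (K.wk a) → Prov H K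
  | eqRefl {Γ : Ctx} {H : List (Fm Γ)} (t : Tm Γ Ty.s) : Prov H (Fm.eq t t)
  | eqSubst {Γ : Ctx} {H : List (Fm Γ)} {t u : Tm Γ Ty.s} (F : Fm (Ty.s :: Γ)) :
      Prov H (Fm.eq t u) → Prov H (F.inst t) → Prov H (F.inst u)
  | eqContext {Γ Δ : Ctx} {H : List (Fm Γ)} (C : TmCx Δ Ty.s Γ Ty.s) {t u : Tm Δ Ty.s} :
      Prov [] (Fm.eq t u) → Prov H (Fm.eq (C.fill t) (C.fill u))
  | eqAx {Γ : Ctx} {H : List (Fm Γ)} {t u : Tm Γ Ty.s} : EqAx t u → Prov H (Fm.eq t u)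
  | ax {Γ : Ctx} {H : List (Fm Γ)} {F : Fm Γ} : Ax F → Prov H F

/-- `F` is a theorem. -/
def Provable {Γ : Ctx} (F : Fm Γ) : Prop := Prov [] F

/-! ### Realizability -/

/-- Finite sequences of terms of the given types. -/
def Tms (Γ : Ctx) : List Ty → Type
  | [] => Unit
  | a :: l => Tm Γ a × Tms Γ l

def Tms.head {Γ : Ctx} {a : Ty} {l : List Ty} (t : Tms Γ (a :: l)) : Tm Γ a := t.1

def Tms.rest {Γ : Ctx} {a : Ty} {l : List Ty} (t : Tms Γ (a :: l)) : Tms Γ l := t.2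

def Tms.wk {Γ : Ctx} (b : Ty) : (l : List Ty) → Tms Γ l → Tms (b :: Γ) l
  | [], _ => ()
  | _ :: l, (t, ts) => (t.wk b, Tms.wk b l ts)

/-- The first part of a concatenated sequence. -/
def Tms.left {Γ : Ctx} : (l m : List Ty) → Tms Γ (l ++ m) → Tms Γ l
  | [], _, _ => ()
  | _ :: l, m, (t, ts) => (t, Tms.left l m ts)

/-- The second part of a concatenated sequence. -/
def Tms.right {Γ : Ctx} : (l m : List Ty) → Tms Γ (l ++ m) → Tms Γ m
  | [], _, ts => ts
  | _ :: l, m, (_, ts) => Tms.right l m ts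

/-- The type `a₁ ⇒ ⋯ ⇒ aₙ ⇒ b`. -/
def arrs : List Ty → Ty → Ty
  | [], b => b
  | a :: l, b => a ⇒' arrs l b

/-- `t(x₁, …, xₙ)`, with `t(Λ) = t`. -/
def apps {Γ : Ctx} {b : Ty} : (l : List Ty) → Tm Γ (arrs l b) → Tms Γ l → Tm Γ b
  | [], t, _ => t
  | _ :: l, t, (x, xs) => apps l (Tm.app t x) xs

/-- `y₁(𝐱), …, yₖ(𝐱)`. -/
def Tms.apps {Γ : Ctx} (l : List Ty) :
    (m : List Ty) → Tms Γ (m.map (arrs l)) → Tms Γ l → Tms Γ m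
  | [], _, _ => ()
  | _ :: m, (y, ys), xs => (IPOR.apps l y xs, Tms.apps l m ys xs)

/-- The context `Γ` extended by variables of the types `l`, the last one innermost. -/
def ext : List Ty → Ctx → Ctx
  | [], Γ => Γ
  | a :: l, Γ => ext l (a :: Γ)

/-- The inclusion of `Γ` into its extension. -/
def Ren.wks : {Γ : Ctx} → (l : List Ty) → Ren Γ (ext l Γ)
  | _, [] => fun _ x => x
  | _, _ :: l => fun _ x => Ren.wks l _ (Var.succ x)

/-- The sequence of the new variables of the extension. -/
def Tms.vars : {Γ : Ctx} → (l : List Ty) → Tms (ext l Γ) l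
  | _, [] => ()
  | _, _ :: l => (Tm.var (Ren.wks l _ Var.zero), Tms.vars l)

def Tms.ren {Γ Δ : Ctx} (ρ : Ren Γ Δ) : (l : List Ty) → Tms Γ l → Tms Δ l
  | [], _ => ()
  | _ :: l, (t, ts) => (t.ren ρ, Tms.ren ρ l ts)

/-- `(∀ x₁) ⋯ (∀ xₙ) F`. -/
def Fm.alls : {Γ : Ctx} → (l : List Ty) → Fm (ext l Γ) → Fm Γ
  | _, [], F => F
  | _, a :: l, F => Fm.all a (Fm.alls l F)

/-- The types of the sequences `𝐱` for which `𝐱 ® F` is formed. -/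
def Fm.rtys : {Γ : Ctx} → Fm Γ → List Ty
  | _, Fm.eq _ _ => []
  | _, Fm.pre _ _ => []
  | _, Fm.flip _ => []
  | _, Fm.and G H => G.rtys ++ H.rtys
  | _, Fm.or G H => Ty.s :: (G.rtys ++ H.rtys)
  | _, Fm.imp G H => H.rtys.map (arrs G.rtys)
  | _, Fm.all a G => G.rtys.map (arrs [a])
  | _, Fm.ex a G => a :: G.rtys

/-- `F.realize σ 𝐭` is the formula `𝐭 ® Fσ`, where `Fσ` is `F` under the substitution `σ`. -/
def Fm.realize : {Γ Δ : Ctx} → (F : Fm Γ) → Sb Γ Δ → Tms Δ F.rtys → Fm Δ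
  | _, _, Fm.eq t u, σ, _ => Fm.eq (t.subst σ) (u.subst σ)
  | _, _, Fm.pre t u, σ, _ => Fm.pre (t.subst σ) (u.subst σ)
  | _, _, Fm.flip t, σ, _ => Fm.flip (t.subst σ)
  | _, _, Fm.and G H, σ, r =>
      Fm.and (G.realize σ (Tms.left G.rtys H.rtys r)) (H.realize σ (Tms.right G.rtys H.rtys r))
  | _, _, Fm.or G H, σ, r =>
      Fm.or
        (Fm.and (Fm.eq r.head zeroT) (G.realize σ (Tms.left G.rtys H.rtys r.rest)))
        (Fm.and (Fm.neg (Fm.eq r.head zeroT)) (H.realize σ (Tms.right G.rtys H.rtys r.rest)))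
  | _, _, Fm.imp G H, σ, y =>
      Fm.and
        (Fm.alls G.rtys
          (Fm.imp
            (G.realize (fun _ x => (σ _ x).ren (Ren.wks G.rtys)) (Tms.vars G.rtys))
            (H.realize (fun _ x => (σ _ x).ren (Ren.wks G.rtys))
              (Tms.apps G.rtys H.rtys (Tms.ren (Ren.wks G.rtys) _ y) (Tms.vars G.rtys)))))
        (Fm.imp (G.subst σ) (H.subst σ))
  | _, _, Fm.all a G, σ, x =>
      Fm.all a (G.realize (σ.lift a)
        (Tms.apps [a] G.rtys (Tms.wk a _ x) (Tm.var Var.zero, ())))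
  | _, _, Fm.ex _ G, σ, r => G.realize (Sb.cons r.head σ) r.rest

/-- The formula `𝐭 ® F`. -/
def Fm.realizedBy {Γ : Ctx} (F : Fm Γ) (t : Tms Γ F.rtys) : Fm Γ := F.realize (Sb.id Γ) t

end IPOR

/-! Soundness is an induction on the formula (`Prov.of_realize`). Implication, the one clause that
could fail, is harmless because a realizer of `G → H` carries `G → H` as a conjunct.

Completeness is an induction on derivations (`Prov.realizable`). The inductive statement,
`Realizable`, ranges over all substitutions and all lists of hypotheses under which the assumptions
have realizers. Witnesses of existential assumptions are then absorbed by the substitution.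
Realizers of discharged assumptions become fresh variables. Atoms have the empty realizer, so for
atomic conclusions derivability is enough. The logical rules use λ-abstraction, application and, for
disjunction elimination, definition by cases at all types (`Tm.ite`).

The induction axioms carry the arithmetic. A realizer of `F(x) = (∃ z ≼ t) u = v` is a single string
`z`. Hence realizers of the premises are a string `a` and two functions `h₀, h₁ : s ⇒ s ⇒ s`, and
the conclusion is realized by `λ n. Rec(a, h₀, h₁, k, n)`. Two points need proof. First, the
truncation built into `Rec` must do nothing. For this `k(n)` is taken to be a string of ones at
least as long as any `z ≼ t(n0)` or `z ≼ t(n1)`; turning `z ≼ t` into an equation about lengths is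
the work of `cond_sub_drop` and `pow_cat_drop`. Second, "the value at `n` realizes `F(n)`" must be
proved by an admissible induction. As `z ≼ t` is equivalent to `Sub(1^z, 1^t) = 1`, the conjunction
`z ≼ t ∧ u = v` can be coded as one equation (`mk_code`), and induction for equations suffices
(`Q.induction`, `Realizable.realize_rec`).

For the last claim, the first component of a realizer of `(∀x)(∃y)F` is a closed term of type `s ⇒
s`, and soundness applied to the remaining components gives `F(x, t x)`. -/

namespace IPOR

/-! ### Substitution calculus -/

/-- A renaming as a substitution. -/
def Ren.toSb {Γ Δ : Ctx} (ρ : Ren Γ Δ) : Sb Γ Δ := fun _ x => Tm.var (ρ _ x)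

/-- Composition of substitutions, first `σ`, then `τ`. -/
def Sb.comp {Γ Δ Θ : Ctx} (σ : Sb Γ Δ) (τ : Sb Δ Θ) : Sb Γ Θ := fun _ x => (σ _ x).subst τ

theorem Sb.ext_apply {Γ Δ : Ctx} {σ τ : Sb Γ Δ} (h : ∀ a x, σ a x = τ a x) : σ = τ :=
  funext fun a => funext fun x => h a x

theorem Sb.ext_cons {Γ Δ : Ctx} {b : Ty} {σ τ : Sb (b :: Γ) Δ}
    (h₀ : σ b Var.zero = τ b Var.zero)
    (h₁ : ∀ a (x : Var Γ a), σ a (Var.succ x) = τ a (Var.succ x)) : σ = τ :=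
  Sb.ext_apply fun a x => by cases x with
    | zero => exact h₀
    | succ x => exact h₁ a x

@[simp] theorem Sb.cons_zero {Γ Δ : Ctx} {b : Ty} (u : Tm Δ b) (σ : Sb Γ Δ) :
    Sb.cons u σ b Var.zero = u := rfl

@[simp] theorem Sb.cons_succ {Γ Δ : Ctx} {a b : Ty} (u : Tm Δ b) (σ : Sb Γ Δ) (x : Var Γ a) :
    Sb.cons u σ a (Var.succ x) = σ a x := rfl

@[simp] theorem Sb.lift_zero {Γ Δ : Ctx} {b : Ty} (σ : Sb Γ Δ) :
    σ.lift b b Var.zero = Tm.var Var.zero := rfl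

@[simp] theorem Sb.lift_succ {Γ Δ : Ctx} {a b : Ty} (σ : Sb Γ Δ) (x : Var Γ a) :
    σ.lift b a (Var.succ x) = (σ a x).wk b := rfl

@[simp] theorem Sb.inst_zero {Γ : Ctx} {b : Ty} (u : Tm Γ b) : Sb.inst u b Var.zero = u := rfl

@[simp] theorem Ren.wk_apply {Γ : Ctx} {a b : Ty} (x : Var Γ a) : Ren.wk b a x = Var.succ x := rfl

@[simp] theorem Ren.toSb_apply {Γ Δ : Ctx} {a : Ty} (ρ : Ren Γ Δ) (x : Var Γ a) :
    ρ.toSb a x = Tm.var (ρ a x) := rfl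

@[simp] theorem Sb.comp_apply {Γ Δ Θ : Ctx} {a : Ty} (σ : Sb Γ Δ) (τ : Sb Δ Θ) (x : Var Γ a) :
    σ.comp τ a x = (σ a x).subst τ := rfl

@[simp] theorem Sb.lift_id {Γ : Ctx} (b : Ty) : (Sb.id Γ).lift b = Sb.id (b :: Γ) :=
  Sb.ext_cons rfl fun _ _ => rfl

theorem Ren.toSb_lift {Γ Δ : Ctx} (ρ : Ren Γ Δ) (b : Ty) : ρ.toSb.lift b = (ρ.lift b).toSb :=
  Sb.ext_cons rfl fun _ _ => rfl

namespace Tm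

@[simp] theorem subst_id {Γ : Ctx} {a : Ty} (t : Tm Γ a) : t.subst (Sb.id Γ) = t := by
  induction t with
  | var x => rfl
  | con c => rfl
  | app t u iht ihu => simp [subst, iht, ihu]
  | lam t ih => simp [subst, ih]

theorem ren_eq_subst {Γ Δ : Ctx} {a : Ty} (ρ : Ren Γ Δ) (t : Tm Γ a) :
    t.ren ρ = t.subst ρ.toSb := by
  induction t generalizing Δ with
  | var x => rfl
  | con c => rfl
  | app t u iht ihu => simp [subst, ren, iht, ihu]
  | lam t ih => simp [subst, ren, ih, Ren.toSb_lift]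

/-- The fusion laws involving a renaming must precede `subst_subst`: pushing a substitution under a
binder weakens its values, which is itself a renaming. -/
theorem ren_subst {Γ Δ Θ : Ctx} {a : Ty} (ρ : Ren Γ Δ) (σ : Sb Δ Θ) (t : Tm Γ a) :
    (t.ren ρ).subst σ = t.subst (ρ.toSb.comp σ) := by
  induction t generalizing Δ Θ with
  | var x => rfl
  | con c => rfl
  | app t u iht ihu => simp [subst, ren, iht, ihu]
  | lam t ih =>
    simp only [subst, ren, ih]
    congr 2
    exact Sb.ext_cons rfl fun _ _ => rfl

theorem subst_ren {Γ Δ Θ : Ctx} {a : Ty} (σ : Sb Γ Δ) (ρ : Ren Δ Θ) (t : Tm Γ a) :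
    (t.subst σ).ren ρ = t.subst (σ.comp ρ.toSb) := by
  induction t generalizing Δ Θ with
  | var x => exact ren_eq_subst _ _
  | con c => rfl
  | app t u iht ihu => simp [subst, ren, iht, ihu]
  | lam t ih =>
    simp only [subst, ren, ih]
    congr 2
    refine Sb.ext_cons rfl fun _ x => ?_
    simp only [Sb.comp_apply, Sb.lift_succ, wk, ren_subst]
    rw [ren_eq_subst, ← ren_eq_subst ρ, ren_subst]
    rfl

theorem subst_subst {Γ Δ Θ : Ctx} {a : Ty} (σ : Sb Γ Δ) (τ : Sb Δ Θ) (t : Tm Γ a) :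
    (t.subst σ).subst τ = t.subst (σ.comp τ) := by
  induction t generalizing Δ Θ with
  | var x => rfl
  | con c => rfl
  | app t u iht ihu => simp [subst, iht, ihu]
  | lam t ih =>
    simp only [subst, ih]
    congr 2
    refine Sb.ext_cons rfl fun _ x => ?_
    simp only [Sb.comp_apply, Sb.lift_succ, wk, ren_subst, subst_ren]
    congr 1
    exact Sb.ext_apply fun _ _ => ren_eq_subst _ _

theorem wk_subst {Γ Δ : Ctx} {a b : Ty} (t : Tm Γ a) (σ : Sb (b :: Γ) Δ) :
    (t.wk b).subst σ = t.subst (fun _ x => σ _ (Var.succ x)) := ren_subst _ _ _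

@[simp] theorem wk_inst {Γ : Ctx} {a b : Ty} (t : Tm Γ a) (u : Tm Γ b) :
    (t.wk b).subst (Sb.inst u) = t := (wk_subst t _).trans t.subst_id

@[simp] theorem wk_cons {Γ Δ : Ctx} {a b : Ty} (t : Tm Γ a) (u : Tm Δ b) (σ : Sb Γ Δ) :
    (t.wk b).subst (Sb.cons u σ) = t.subst σ := wk_subst t _

theorem subst_wk {Γ Δ : Ctx} {a b : Ty} (t : Tm Γ a) (σ : Sb Γ Δ) :
    (t.subst σ).wk b = t.subst (σ.wk b) := by
  rw [wk, subst_ren]; congr 1; exact Sb.ext_apply fun _ _ => (ren_eq_subst _ _).symm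

theorem wk_lift {Γ Δ : Ctx} {a b : Ty} (t : Tm Γ a) (σ : Sb Γ Δ) :
    (t.wk b).subst (σ.lift b) = (t.subst σ).wk b := by
  rw [Sb.lift, wk_cons, subst_wk]

theorem ren_ren {Γ Δ Θ : Ctx} {a : Ty} (ρ : Ren Γ Δ) (ξ : Ren Δ Θ) (t : Tm Γ a) :
    (t.ren ρ).ren ξ = t.ren (fun _ x => ξ _ (ρ _ x)) := by
  rw [ren_eq_subst ξ, ren_subst, ren_eq_subst]; rfl

theorem wk_ren {Γ Δ : Ctx} {a b : Ty} (t : Tm Γ a) (ρ : Ren Γ Δ) :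
    (t.wk b).ren (ρ.lift b) = (t.ren ρ).wk b := by
  rw [wk, wk, ren_ren, ren_ren]; rfl

end Tm

namespace Sb

@[simp] theorem comp_id {Γ Δ : Ctx} (σ : Sb Γ Δ) : σ.comp (Sb.id Δ) = σ :=
  Sb.ext_apply fun _ _ => Tm.subst_id _

theorem comp_assoc {Γ Δ Θ Ξ : Ctx} (σ : Sb Γ Δ) (τ : Sb Δ Θ) (υ : Sb Θ Ξ) :
    (σ.comp τ).comp υ = σ.comp (τ.comp υ) := Sb.ext_apply fun _ _ => Tm.subst_subst _ _ _

theorem comp_cons {Γ Δ Θ : Ctx} {b : Ty} (u : Tm Δ b) (σ : Sb Γ Δ) (τ : Sb Δ Θ) :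
    (Sb.cons u σ).comp τ = Sb.cons (u.subst τ) (σ.comp τ) :=
  Sb.ext_cons rfl fun _ _ => rfl

theorem inst_comp {Γ Δ : Ctx} {b : Ty} (u : Tm Γ b) (τ : Sb Γ Δ) :
    (Sb.inst u).comp τ = Sb.cons (u.subst τ) τ := comp_cons _ _ _

theorem lift_comp_cons {Γ Δ Θ : Ctx} {b : Ty} (σ : Sb Γ Δ) (u : Tm Θ b) (τ : Sb Δ Θ) :
    (σ.lift b).comp (Sb.cons u τ) = Sb.cons u (σ.comp τ) :=
  Sb.ext_cons rfl fun _ _ => Tm.wk_cons _ _ _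

theorem lift_comp_inst {Γ Δ : Ctx} {b : Ty} (σ : Sb Γ Δ) (u : Tm Δ b) :
    (σ.lift b).comp (Sb.inst u) = Sb.cons u σ := by
  rw [Sb.inst, lift_comp_cons, comp_id]

theorem lift_comp_lift {Γ Δ Θ : Ctx} (b : Ty) (σ : Sb Γ Δ) (τ : Sb Δ Θ) :
    (σ.lift b).comp (τ.lift b) = (σ.comp τ).lift b :=
  Sb.ext_cons rfl fun _ _ => Tm.wk_lift _ _

theorem wk_eq_comp {Γ Δ : Ctx} (σ : Sb Γ Δ) (b : Ty) : σ.wk b = σ.comp (Ren.wk b).toSb :=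
  Sb.ext_apply fun _ _ => Tm.ren_eq_subst _ _

theorem cons_zero_succ {Γ Δ : Ctx} {b : Ty} (σ : Sb (b :: Γ) Δ) :
    Sb.cons (σ b Var.zero) (fun _ x => σ _ (Var.succ x)) = σ :=
  Sb.ext_cons rfl fun _ _ => rfl

end Sb

namespace Fm

@[simp] theorem subst_id {Γ : Ctx} (F : Fm Γ) : F.subst (Sb.id Γ) = F := by
  induction F <;> simp_all [subst]

theorem subst_subst {Γ Δ Θ : Ctx} (σ : Sb Γ Δ) (τ : Sb Δ Θ) (F : Fm Γ) :
    (F.subst σ).subst τ = F.subst (σ.comp τ) := by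
  induction F generalizing Δ Θ <;> simp_all [subst, Tm.subst_subst, Sb.lift_comp_lift]

theorem ren_eq {Γ Δ : Ctx} (ρ : Ren Γ Δ) (F : Fm Γ) : F.ren ρ = F.subst ρ.toSb := rfl

theorem wk_eq {Γ : Ctx} (b : Ty) (F : Fm Γ) : F.wk b = F.subst (Ren.wk b).toSb := rfl

@[simp] theorem wk_cons {Γ Δ : Ctx} {b : Ty} (F : Fm Γ) (u : Tm Δ b) (σ : Sb Γ Δ) :
    (F.wk b).subst (Sb.cons u σ) = F.subst σ := subst_subst _ _ _

@[simp] theorem wk_inst {Γ : Ctx} {b : Ty} (F : Fm Γ) (u : Tm Γ b) : (F.wk b).inst u = F :=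
  (wk_cons _ _ _).trans F.subst_id

theorem subst_wk {Γ Δ : Ctx} {b : Ty} (F : Fm Γ) (σ : Sb Γ Δ) :
    (F.subst σ).wk b = F.subst (σ.wk b) := by
  rw [wk_eq, subst_subst, Sb.wk_eq_comp]

theorem wk_lift {Γ Δ : Ctx} {b : Ty} (F : Fm Γ) (σ : Sb Γ Δ) :
    (F.wk b).subst (σ.lift b) = (F.subst σ).wk b := by
  rw [Sb.lift, wk_cons, subst_wk]

theorem inst_subst {Γ Δ : Ctx} {b : Ty} (F : Fm (b :: Γ)) (u : Tm Γ b) (σ : Sb Γ Δ) :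
    (F.inst u).subst σ = (F.subst (σ.lift b)).inst (u.subst σ) := by
  rw [inst, inst, subst_subst, subst_subst, Sb.inst_comp, Sb.lift_comp_inst]

end Fm

/-- Renaming of the free variables of a context `C[ ]`, with the renaming of the variables at the
hole. -/
theorem TmCx.fill_ren {Δ : Ctx} {τ : Ty} {Γ : Ctx} {a : Ty} (C : TmCx Δ τ Γ a) {Γ' : Ctx}
    (ρ : Ren Γ Γ') : ∃ (Δ' : Ctx) (ξ : Ren Δ Δ') (D : TmCx Δ' τ Γ' a),
      ∀ t, (C.fill t).ren ρ = D.fill (t.ren ξ) := by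
  induction C generalizing Γ' with
  | hole => exact ⟨Γ', ρ, TmCx.hole, fun _ => rfl⟩
  | appL C u ih =>
    obtain ⟨Δ', ξ, D, h⟩ := ih ρ
    exact ⟨Δ', ξ, D.appL (u.ren ρ), fun t => by simp [fill, Tm.ren, h]⟩
  | appR u C ih =>
    obtain ⟨Δ', ξ, D, h⟩ := ih ρ
    exact ⟨Δ', ξ, D.appR (u.ren ρ), fun t => by simp [fill, Tm.ren, h]⟩
  | lam C ih =>
    obtain ⟨Δ', ξ, D, h⟩ := ih (ρ.lift _)
    exact ⟨Δ', ξ, D.lam, fun t => by simp [fill, Tm.ren, h]⟩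

/-- Composition of contexts. -/
def TmCx.comp {Δ : Ctx} {τ : Ty} {Θ : Ctx} {b : Ty} (D : TmCx Θ b Δ τ) :
    {Γ : Ctx} → {a : Ty} → TmCx Δ τ Γ a → TmCx Θ b Γ a
  | _, _, TmCx.hole => D
  | _, _, TmCx.appL C u => TmCx.appL (D.comp C) u
  | _, _, TmCx.appR u C => TmCx.appR u (D.comp C)
  | _, _, TmCx.lam C => TmCx.lam (D.comp C)

theorem TmCx.fill_comp {Δ : Ctx} {τ : Ty} {Θ : Ctx} {b : Ty} (D : TmCx Θ b Δ τ) {Γ : Ctx} {a : Ty}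
    (C : TmCx Δ τ Γ a) (t : Tm Θ b) : (D.comp C).fill t = C.fill (D.fill t) := by
  induction C with
  | hole => rfl
  | appL C u ih => simp [fill, comp, ih]
  | appR u C ih => simp [fill, comp, ih]
  | lam C ih => simp [fill, comp, ih]

theorem Tm.FreeVarsIn.ren {Γ : Ctx} {a : Ty} {t : Tm Γ a} {P : ∀ b : Ty, Var Γ b → Prop}
    (h : t.FreeVarsIn P) {Δ : Ctx} (ρ : Ren Γ Δ) {Q : ∀ b : Ty, Var Δ b → Prop}
    (hρ : ∀ b x, P b x → Q b (ρ b x)) : (t.ren ρ).FreeVarsIn Q := by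
  induction t generalizing Δ with
  | var x => exact hρ _ _ h
  | con c => trivial
  | app t u iht ihu => exact ⟨iht h.1 ρ hρ, ihu h.2 ρ hρ⟩
  | lam t ih =>
    refine ih h _ fun b x hx y hy => ?_
    cases x with
    | zero => cases hy
    | succ x => cases hy; exact hρ _ _ (hx _ rfl)

theorem Tm.FirstOrder.ren {Γ Δ : Ctx} {a : Ty} {t : Tm Γ a} (h : t.FirstOrder) (ρ : Ren Γ Δ) :
    (t.ren ρ).FirstOrder :=
  Tm.FreeVarsIn.ren h ρ fun _ _ h => h


/-! ### Structural properties of derivability -/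

theorem EqAx.ren {Γ Δ : Ctx} (ρ : Ren Γ Δ) {t u : Tm Γ Ty.s} (h : EqAx t u) :
    EqAx (t.ren ρ) (u.ren ρ) := by
  cases h with
  | eps_cat => exact EqAx.eps_cat _
  | cat_eps => exact EqAx.cat_eps _
  | cat_snoc x y b =>
    have := EqAx.cat_snoc (x.ren ρ) (y.ren ρ) b
    cases b <;> exact this
  | tail_eps => exact EqAx.tail_eps
  | tail_snoc _ b =>
    have := EqAx.tail_snoc (u.ren ρ) b
    cases b <;> exact this
  | trunc_eps => exact EqAx.trunc_eps _
  | eps_trunc => exact EqAx.eps_trunc _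
  | trunc_snoc x y b c =>
    have := EqAx.trunc_snoc (x.ren ρ) (y.ren ρ) b c
    cases b <;> cases c <;> exact this
  | cond_eps => exact EqAx.cond_eps _ _ _
  | cond_zero => exact EqAx.cond_zero _ _ _ _
  | cond_one => exact EqAx.cond_one _ _ _ _
  | flipcoin => exact EqAx.flipcoin _
  | rec_eps => exact EqAx.rec_eps _ _ _ _
  | rec_zero => exact EqAx.rec_zero _ _ _ _ _
  | rec_one => exact EqAx.rec_one _ _ _ _ _
  | times_eps => exact EqAx.times_eps _
  | times_snoc x y b =>
    have := EqAx.times_snoc (x.ren ρ) (y.ren ρ) b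
    cases b <;> exact this
  | beta C t u =>
    obtain ⟨Δ', ξ, D, hD⟩ := C.fill_ren ρ
    rw [hD, hD]
    have h : (t.subst (Sb.inst u)).ren ξ = (t.ren (ξ.lift _)).subst (Sb.inst (u.ren ξ)) := by
      rw [Tm.subst_ren, Tm.ren_subst]
      congr 1
      refine Sb.ext_cons ?_ fun _ _ => rfl
      exact (Tm.ren_eq_subst _ _).symm
    rw [h]
    exact EqAx.beta D (t.ren (ξ.lift _)) (u.ren ξ)
  | eta C t =>
    obtain ⟨Δ', ξ, D, hD⟩ := C.fill_ren ρ
    rw [hD, hD]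
    have := EqAx.eta D (t.ren ξ)
    rw [← Tm.wk_ren] at this
    exact this

theorem Fm.induction_subst {Γ Δ : Ctx} (F : Fm (Ty.s :: Γ)) (σ : Sb Γ Δ) :
    F.induction.subst σ = (F.subst (σ.lift Ty.s)).induction := by
  have h : ∀ b, (F.succBit b).subst (σ.lift Ty.s) = (F.subst (σ.lift Ty.s)).succBit b := by
    intro b
    rw [succBit, succBit, subst_subst, subst_subst]
    congr 1
    refine Sb.ext_cons ?_ fun _ _ => ?_
    · cases b <;> rfl
    · simp only [Sb.comp_apply, Sb.cons_succ, Sb.lift_succ, Tm.wk_cons, Tm.subst]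
      exact Tm.ren_eq_subst _ _
  simp only [Fm.induction, subst, inst_subst, h]
  rfl

theorem Fm.exLe_subst {Γ Δ : Ctx} (t : Tm Γ Ty.s) (F : Fm (Ty.s :: Γ)) (σ : Sb Γ Δ) :
    (Fm.exLe t F).subst σ = Fm.exLe (t.subst σ) (F.subst (σ.lift Ty.s)) := by
  simp only [exLe, subst, le]
  rw [← Tm.wk_lift]
  rfl

theorem Fm.ren_eq_atom {Γ Δ : Ctx} (ρ : Ren Γ Δ) (t u : Tm Γ Ty.s) :
    (Fm.eq t u).ren ρ = Fm.eq (t.ren ρ) (u.ren ρ) := by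
  simp only [ren_eq, Fm.subst, Tm.ren_eq_subst]

/-- Stated for renamings only: they preserve the types of variables, hence the first-order condition
on the bound in an induction axiom. A substitution could bring variables of higher type into that
bound. -/
theorem Ax.ren {Γ Δ : Ctx} (ρ : Ren Γ Δ) {F : Fm Γ} (h : Ax F) : Ax (F.ren ρ) := by
  cases h with
  | pre => exact Ax.pre _ _
  | cases => exact Ax.cases _
  | zero_one => exact Ax.zero_one _
  | cond => exact Ax.cond _ _ _ _ _
  | flip => exact Ax.flip _
  | induction t u v h =>
    rw [Fm.ren_eq, Fm.induction_subst, Fm.exLe_subst]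
    refine Ax.induction _ _ _ ?_
    rw [Ren.toSb_lift, ← Tm.ren_eq_subst]
    exact h.ren _

namespace Prov

theorem mono {Γ : Ctx} {H : List (Fm Γ)} {F : Fm Γ} (h : Prov H F) {H' : List (Fm Γ)}
    (hs : H ⊆ H') : Prov H' F := by
  induction h with
  | hyp h => exact hyp (hs h)
  | andI _ _ ih₁ ih₂ => exact andI (ih₁ hs) (ih₂ hs)
  | andE₁ _ ih => exact andE₁ (ih hs)
  | andE₂ _ ih => exact andE₂ (ih hs)
  | orI₁ _ ih => exact orI₁ (ih hs)
  | orI₂ _ ih => exact orI₂ (ih hs)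
  | orE _ _ _ ih ih₁ ih₂ =>
    exact orE (ih hs) (ih₁ (List.cons_subset_cons _ hs)) (ih₂ (List.cons_subset_cons _ hs))
  | impI _ ih => exact impI (ih (List.cons_subset_cons _ hs))
  | impE _ _ ih₁ ih₂ => exact impE (ih₁ hs) (ih₂ hs)
  | botE _ ih => exact botE (ih hs)
  | allI _ ih => exact allI (ih (List.map_subset _ hs))
  | allE t _ ih => exact allE t (ih hs)
  | exI t _ ih => exact exI t (ih hs)
  | exE _ _ ih₁ ih₂ => exact exE (ih₁ hs) (ih₂ (List.cons_subset_cons _ (List.map_subset _ hs)))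
  | eqRefl t => exact eqRefl t
  | eqSubst F _ _ ih₁ ih₂ => exact eqSubst F (ih₁ hs) (ih₂ hs)
  | eqContext C h _ => exact eqContext C h
  | eqAx h => exact eqAx h
  | ax h => exact ax h

theorem cons {Γ : Ctx} {H : List (Fm Γ)} {F : Fm Γ} (h : Prov H F) (G : Fm Γ) : Prov (G :: H) F :=
  h.mono (List.subset_cons_self _ _)

theorem of_nil {Γ : Ctx} {H : List (Fm Γ)} {F : Fm Γ} (h : Prov [] F) : Prov H F :=
  h.mono (List.nil_subset _)

theorem hyp₀ {Γ : Ctx} {H : List (Fm Γ)} {F : Fm Γ} : Prov (F :: H) F := hyp List.mem_cons_self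

theorem map_wk_ren {Γ Δ : Ctx} (ρ : Ren Γ Δ) (b : Ty) (H : List (Fm Γ)) :
    (H.map (Fm.wk b)).map (Fm.ren (ρ.lift b)) = (H.map (Fm.ren ρ)).map (Fm.wk b) := by
  simp only [List.map_map]
  refine List.map_congr_left fun F _ => ?_
  simp only [Function.comp, Fm.ren_eq]
  rw [← Ren.toSb_lift, Fm.wk_lift]

theorem ren {Γ : Ctx} {H : List (Fm Γ)} {F : Fm Γ} (h : Prov H F) {Δ : Ctx} (ρ : Ren Γ Δ) :
    Prov (H.map (Fm.ren ρ)) (F.ren ρ) := by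
  induction h generalizing Δ with
  | hyp h => exact hyp (List.mem_map_of_mem h)
  | andI _ _ ih₁ ih₂ => exact andI (ih₁ ρ) (ih₂ ρ)
  | andE₁ _ ih => exact andE₁ (ih ρ)
  | andE₂ _ ih => exact andE₂ (ih ρ)
  | orI₁ _ ih => exact orI₁ (ih ρ)
  | orI₂ _ ih => exact orI₂ (ih ρ)
  | orE _ _ _ ih ih₁ ih₂ => exact orE (ih ρ) (ih₁ ρ) (ih₂ ρ)
  | impI _ ih => exact impI (ih ρ)
  | impE _ _ ih₁ ih₂ => exact impE (ih₁ ρ) (ih₂ ρ)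
  | botE _ ih => exact botE (ih ρ)
  | @allI Γ H a F _ ih =>
    have := ih (ρ.lift a)
    rw [map_wk_ren, Fm.ren_eq, ← Ren.toSb_lift] at this
    exact allI this
  | allE t _ ih =>
    rw [Fm.ren_eq, Fm.inst_subst]
    exact allE _ (ih ρ)
  | exI t _ ih =>
    have := ih ρ
    rw [Fm.ren_eq, Fm.inst_subst] at this
    exact exI (t.subst ρ.toSb) this
  | @exE Γ H a F K _ _ ih₁ ih₂ =>
    have := ih₂ (ρ.lift a)
    rw [List.map_cons, map_wk_ren, Fm.ren_eq, Fm.ren_eq, ← Ren.toSb_lift, Fm.wk_lift] at this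
    exact exE (ih₁ ρ) this
  | eqRefl t => exact eqRefl _
  | eqSubst F _ _ ih₁ ih₂ =>
    have := ih₂ ρ
    rw [Fm.ren_eq, Fm.inst_subst] at this ⊢
    exact eqSubst _ (ih₁ ρ) this
  | eqContext C h ih =>
    obtain ⟨Δ', ξ, D, hD⟩ := C.fill_ren ρ
    rw [Fm.ren_eq_atom, hD, hD]
    refine eqContext D ?_
    rw [← Fm.ren_eq_atom]
    exact ih ξ
  | eqAx h => rw [Fm.ren_eq_atom]; exact eqAx (h.ren ρ)
  | ax h => exact ax (h.ren ρ)

theorem wk {Γ : Ctx} {H : List (Fm Γ)} {F : Fm Γ} (h : Prov H F) (b : Ty) :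
    Prov (H.map (Fm.wk b)) (F.wk b) := h.ren _

/-- The substitution `σ` on `Γ`, extended by the identity of `Δ`. -/
def sbAppend : {Γ : Ctx} → {Δ : Ctx} → Sb Γ Δ → Sb (Γ ++ Δ) Δ
  | [], Δ, _ => Sb.id Δ
  | _ :: _, _, σ => Sb.cons (σ _ Var.zero) (sbAppend fun _ x => σ _ (Var.succ x))

def renLeft : {Γ : Ctx} → (Δ : Ctx) → Ren Γ (Γ ++ Δ)
  | _ :: _, _, _, Var.zero => Var.zero
  | _ :: _, Δ, _, Var.succ x => Var.succ (renLeft Δ _ x)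

def renRight : (Γ : Ctx) → (Δ : Ctx) → Ren Δ (Γ ++ Δ)
  | [], _ => fun _ x => x
  | _ :: Γ, Δ => fun _ x => Var.succ (renRight Γ Δ _ x)

theorem sbAppend_left {Γ Δ : Ctx} (σ : Sb Γ Δ) : (renLeft Δ).toSb.comp (sbAppend σ) = σ := by
  induction Γ with
  | nil => exact Sb.ext_apply fun _ x => by cases x
  | cons a Γ ih =>
    refine Sb.ext_cons rfl fun b x => ?_
    exact congrFun (congrFun (ih fun _ x => σ _ (Var.succ x)) b) x

theorem sbAppend_right {Γ Δ : Ctx} (σ : Sb Γ Δ) :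
    (renRight Γ Δ).toSb.comp (sbAppend σ) = Sb.id Δ := by
  induction Γ with
  | nil => rfl
  | cons a Γ ih => exact ih fun _ x => σ _ (Var.succ x)

theorem subst_append {Γ Δ : Ctx} {F : Fm (Γ ++ Δ)} (h : Prov [] F) (σ : Sb Γ Δ) :
    Prov [] (F.subst (sbAppend σ)) := by
  induction Γ with
  | nil => exact (Fm.subst_id F).symm ▸ h
  | cons a Γ ih =>
    -- The innermost variable of `Γ` is generalized and instantiated with its image, which lives in
    -- `Δ` and is first moved into the context `Γ ++ Δ` that remains.
    have h₁ : Prov [] (Fm.all a F) := allI h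
    have h₂ := ih (allE ((σ _ Var.zero).ren (renRight Γ Δ)) h₁) fun _ x => σ _ (Var.succ x)
    rw [Fm.inst, Fm.subst_subst, Sb.inst_comp, Tm.ren_subst, sbAppend_right, Tm.subst_id] at h₂
    exact h₂

theorem imps {Γ : Ctx} {H : List (Fm Γ)} {F : Fm Γ} :
    Prov H F ↔ Prov [] (H.foldl (fun F G => Fm.imp G F) F) := by
  induction H generalizing F with
  | nil => rfl
  | cons G H ih =>
    refine Iff.trans ⟨impI, fun h => impE (h.cons _) hyp₀⟩ ih

/-- Induction on the derivation breaks down at the induction axioms, which are not closed under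
substitution. Instead the hypotheses are discharged, the formula is renamed into `Γ ++ Δ`, and the
variables of `Γ` are eliminated by ∀-introduction and ∀-elimination. -/
theorem subst {Γ Δ : Ctx} {H : List (Fm Γ)} {F : Fm Γ} (h : Prov H F) (σ : Sb Γ Δ) :
    Prov (H.map (Fm.subst σ)) (F.subst σ) := by
  have key : ∀ {F : Fm Γ}, Prov [] F → Prov [] (F.subst σ) := by
    intro F h
    have := subst_append (h.ren (renLeft Δ)) σ
    rwa [Fm.ren_eq, Fm.subst_subst, sbAppend_left] at this
  have h' := key (imps.1 h)
  have e : ∀ (H : List (Fm Γ)) (F : Fm Γ), (H.foldl (fun F G => Fm.imp G F) F).subst σ =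
      (H.map (Fm.subst σ)).foldl (fun F G => Fm.imp G F) (F.subst σ) := by
    intro H
    induction H with
    | nil => intro F; rfl
    | cons G H ih => intro F; exact ih _
  rw [e] at h'
  exact imps.2 h'

/-- From `H` one can derive whatever follows from consequences of `H`. -/
theorem cuts {Γ : Ctx} {H H' : List (Fm Γ)} {F : Fm Γ} (h : Prov H' F)
    (hs : ∀ G ∈ H', Prov H G) : Prov H F := by
  induction H' generalizing F with
  | nil => exact h.of_nil
  | cons G H' ih =>
    exact impE (ih (impI h) fun G hG => hs G (List.mem_cons_of_mem _ hG))
      (hs G List.mem_cons_self)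

theorem symm {Γ : Ctx} {H : List (Fm Γ)} {t u : Tm Γ Ty.s} (h : Prov H (Fm.eq t u)) :
    Prov H (Fm.eq u t) := by
  have := eqSubst (Fm.eq (Tm.var Var.zero) (t.wk _)) h
    (by simpa [Fm.inst, Fm.subst, Tm.subst] using eqRefl t)
  simpa [Fm.inst, Fm.subst, Tm.subst] using this

theorem trans {Γ : Ctx} {H : List (Fm Γ)} {t u v : Tm Γ Ty.s} (h : Prov H (Fm.eq t u))
    (h' : Prov H (Fm.eq u v)) : Prov H (Fm.eq t v) := by
  have := eqSubst (Fm.eq (t.wk _) (Tm.var Var.zero)) h'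
    (by simpa [Fm.inst, Fm.subst, Tm.subst] using h)
  simpa [Fm.inst, Fm.subst, Tm.subst] using this

theorem congr {Γ : Ctx} {H : List (Fm Γ)} {t u : Tm Γ Ty.s} (f : Tm (Ty.s :: Γ) Ty.s)
    (h : Prov H (Fm.eq t u)) :
    Prov H (Fm.eq (f.subst (Sb.inst t)) (f.subst (Sb.inst u))) := by
  have := eqSubst (Fm.eq ((f.subst (Sb.inst t)).wk _) f) h
    (by simpa [Fm.inst, Fm.subst] using eqRefl _)
  simpa [Fm.inst, Fm.subst] using this

end Prov

/-! ### Provable equality of terms of all types -/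

/-- The congruence on terms of all types generated by β, η and provable equations. -/
inductive TmEq : {Γ : Ctx} → {a : Ty} → Tm Γ a → Tm Γ a → Prop
  | refl {Γ : Ctx} {a : Ty} (t : Tm Γ a) : TmEq t t
  | symm {Γ : Ctx} {a : Ty} {t u : Tm Γ a} : TmEq t u → TmEq u t
  | trans {Γ : Ctx} {a : Ty} {t u v : Tm Γ a} : TmEq t u → TmEq u v → TmEq t v
  | app {Γ : Ctx} {a b : Ty} {t t' : Tm Γ (a ⇒' b)} {u u' : Tm Γ a} :
      TmEq t t' → TmEq u u' → TmEq (Tm.app t u) (Tm.app t' u')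
  | lam {Γ : Ctx} {a b : Ty} {t t' : Tm (a :: Γ) b} : TmEq t t' → TmEq (Tm.lam t) (Tm.lam t')
  | beta {Γ : Ctx} {a b : Ty} (t : Tm (a :: Γ) b) (u : Tm Γ a) :
      TmEq (Tm.app (Tm.lam t) u) (t.subst (Sb.inst u))
  | eta {Γ : Ctx} {a b : Ty} (t : Tm Γ (a ⇒' b)) :
      TmEq (Tm.lam (Tm.app (t.wk a) (Tm.var Var.zero))) t
  | base {Γ : Ctx} {t u : Tm Γ Ty.s} : Prov [] (Fm.eq t u) → TmEq t u

namespace TmEq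

/-- The theory has equations at type `s` only, so equality at a higher type is expressed through
contexts of type `s`. The context varies in the induction: congruence for application and
abstraction adds a layer around the hole, and (β), (η) and `eqContext` already allow arbitrary
contexts. -/
theorem fill {Δ : Ctx} {a : Ty} {t u : Tm Δ a} (h : TmEq t u) {Γ : Ctx} (C : TmCx Δ a Γ Ty.s) :
    Prov [] (Fm.eq (C.fill t) (C.fill u)) := by
  induction h generalizing Γ with
  | refl t => exact Prov.eqRefl _
  | symm _ ih => exact (ih C).symm
  | trans _ _ ih₁ ih₂ => exact (ih₁ C).trans (ih₂ C)
  | @app Δ a b t t' u u' _ _ ih₁ ih₂ =>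
    have h₁ := ih₁ ((TmCx.appL TmCx.hole u).comp C)
    have h₂ := ih₂ ((TmCx.appR t' TmCx.hole).comp C)
    rw [TmCx.fill_comp, TmCx.fill_comp] at h₁ h₂
    exact h₁.trans h₂
  | lam _ ih =>
    have h := ih ((TmCx.lam TmCx.hole).comp C)
    rw [TmCx.fill_comp, TmCx.fill_comp] at h
    exact h
  | beta t u => exact Prov.eqAx (EqAx.beta C t u)
  | eta t => exact Prov.eqAx (EqAx.eta C t)
  | base h => exact Prov.eqContext C h

theorem prov {Γ : Ctx} {t u : Tm Γ Ty.s} (h : TmEq t u) {H : List (Fm Γ)} :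
    Prov H (Fm.eq t u) := (h.fill TmCx.hole).of_nil

theorem subst {Γ : Ctx} {a : Ty} {t u : Tm Γ a} (h : TmEq t u) {Δ : Ctx} (σ : Sb Γ Δ) :
    TmEq (t.subst σ) (u.subst σ) := by
  induction h generalizing Δ with
  | refl t => exact refl _
  | symm _ ih => exact (ih σ).symm
  | trans _ _ ih₁ ih₂ => exact (ih₁ σ).trans (ih₂ σ)
  | app _ _ ih₁ ih₂ => exact app (ih₁ σ) (ih₂ σ)
  | lam _ ih => exact lam (ih _)
  | beta t u =>
    have := beta (t.subst (σ.lift _)) (u.subst σ)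
    rw [Tm.subst_subst, Sb.lift_comp_inst, ← Sb.inst_comp, ← Tm.subst_subst] at this
    exact this
  | eta t =>
    have := eta (t.subst σ)
    rw [← Tm.wk_lift] at this
    exact this
  | base h => exact base (h.subst σ)

theorem wk {Γ : Ctx} {a : Ty} {t u : Tm Γ a} (h : TmEq t u) (b : Ty) : TmEq (t.wk b) (u.wk b) := by
  simp only [Tm.wk, Tm.ren_eq_subst]
  exact h.subst _

theorem of_eq {Γ : Ctx} {a : Ty} {t u : Tm Γ a} (h : t = u) : TmEq t u := h ▸ refl t

theorem app_lam {Γ : Ctx} {a b : Ty} {t : Tm (a :: Γ) b} {u : Tm Γ a} {v : Tm Γ b}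
    (h : TmEq (t.subst (Sb.inst u)) v) : TmEq (Tm.app (Tm.lam t) u) v := (beta t u).trans h

/-- Substitution of equals. -/
theorem subst_congr {Γ Δ : Ctx} {a : Ty} (t : Tm Γ a) {σ τ : Sb Γ Δ}
    (h : ∀ a x, TmEq (σ a x) (τ a x)) : TmEq (t.subst σ) (t.subst τ) := by
  induction t generalizing Δ with
  | var x => exact h _ x
  | con c => exact refl _
  | app t u iht ihu => exact app (iht h) (ihu h)
  | lam t ih =>
    refine lam (ih fun _ x => ?_)
    cases x with
    | zero => exact refl _
    | succ x => exact (h _ x).wk _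

end TmEq


/-! ### Sequences of terms -/

namespace Tms

def subst {Γ Δ : Ctx} (σ : Sb Γ Δ) : (l : List Ty) → Tms Γ l → Tms Δ l
  | [], _ => ()
  | _ :: l, t => (t.head.subst σ, subst σ l t.rest)

def append {Γ : Ctx} : (l m : List Ty) → Tms Γ l → Tms Γ m → Tms Γ (l ++ m)
  | [], _, _, u => u
  | _ :: l, m, t, u => (t.head, append l m t.rest u)

/-- Realizers of `F` and of `Fσ` have the same types, but the two lists agree only propositionally.
-/
def cast {Γ : Ctx} {l m : List Ty} (h : l = m) (t : Tms Γ l) : Tms Γ m := h ▸ t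

/-- Componentwise provable equality. -/
def Eq {Γ : Ctx} : (l : List Ty) → Tms Γ l → Tms Γ l → Prop
  | [], _, _ => True
  | _ :: l, t, u => TmEq t.head u.head ∧ Eq l t.rest u.rest

theorem wk_eq {Γ : Ctx} (b : Ty) (l : List Ty) (t : Tms Γ l) :
    Tms.wk b l t = t.subst (Ren.wk b).toSb := by
  induction l with
  | nil => rfl
  | cons a l ih => exact Prod.ext (Tm.ren_eq_subst _ _) (ih _)

theorem ren_eq {Γ Δ : Ctx} (ρ : Ren Γ Δ) (l : List Ty) (t : Tms Γ l) :
    Tms.ren ρ l t = t.subst ρ.toSb := by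
  induction l with
  | nil => rfl
  | cons a l ih => exact Prod.ext (Tm.ren_eq_subst _ _) (ih _)

theorem subst_subst {Γ Δ Θ : Ctx} (σ : Sb Γ Δ) (τ : Sb Δ Θ) (l : List Ty) (t : Tms Γ l) :
    (t.subst σ).subst τ = t.subst (σ.comp τ) := by
  induction l with
  | nil => rfl
  | cons a l ih => exact Prod.ext (Tm.subst_subst _ _ _) (ih _)

theorem subst_id {Γ : Ctx} (l : List Ty) (t : Tms Γ l) : t.subst (Sb.id Γ) = t := by
  induction l with
  | nil => rfl
  | cons a l ih => exact Prod.ext (Tm.subst_id _) (ih _)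

theorem subst_left {Γ Δ : Ctx} (σ : Sb Γ Δ) (l m : List Ty) (t : Tms Γ (l ++ m)) :
    (Tms.left l m t).subst σ = Tms.left l m (t.subst σ) := by
  induction l with
  | nil => rfl
  | cons a l ih => exact Prod.ext rfl (ih _)

theorem subst_right {Γ Δ : Ctx} (σ : Sb Γ Δ) (l m : List Ty) (t : Tms Γ (l ++ m)) :
    (Tms.right l m t).subst σ = Tms.right l m (t.subst σ) := by
  induction l with
  | nil => rfl
  | cons a l ih => exact ih _

@[simp] theorem left_append {Γ : Ctx} (l m : List Ty) (t : Tms Γ l) (u : Tms Γ m) :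
    Tms.left l m (append l m t u) = t := by
  induction l with
  | nil => rfl
  | cons a l ih => exact Prod.ext rfl (ih _)

@[simp] theorem right_append {Γ : Ctx} (l m : List Ty) (t : Tms Γ l) (u : Tms Γ m) :
    Tms.right l m (append l m t u) = u := by
  induction l with
  | nil => rfl
  | cons a l ih => exact ih _

theorem _root_.IPOR.apps_subst {Γ Δ : Ctx} (σ : Sb Γ Δ) {b : Ty} (l : List Ty) (t : Tm Γ (arrs l b))
    (x : Tms Γ l) : (IPOR.apps l t x).subst σ = IPOR.apps l (t.subst σ) (x.subst σ) := by
  induction l with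
  | nil => rfl
  | cons a l ih => exact ih _ _

theorem apps_subst {Γ Δ : Ctx} (σ : Sb Γ Δ) (l m : List Ty) (y : Tms Γ (m.map (arrs l)))
    (x : Tms Γ l) : (Tms.apps l m y x).subst σ = Tms.apps l m (y.subst σ) (x.subst σ) := by
  induction m with
  | nil => rfl
  | cons a m ih => exact Prod.ext (IPOR.apps_subst _ _ _ _) (ih _)

theorem cast_left {Γ : Ctx} {l l' m m' : List Ty} (hl : l = l') (hm : m = m') (h : l ++ m = l' ++ m')
    (t : Tms Γ (l ++ m)) : Tms.left l' m' (cast h t) = cast hl (Tms.left l m t) := by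
  subst hl hm; rfl

theorem cast_right {Γ : Ctx} {l l' m m' : List Ty} (hl : l = l') (hm : m = m')
    (h : l ++ m = l' ++ m') (t : Tms Γ (l ++ m)) :
    Tms.right l' m' (cast h t) = cast hm (Tms.right l m t) := by
  subst hl hm; rfl

theorem cast_head {Γ : Ctx} {a : Ty} {l l' : List Ty} (h : a :: l = a :: l')
    (t : Tms Γ (a :: l)) : (cast h t).head = t.head := by
  obtain ⟨-, rfl⟩ := List.cons.inj h; rfl

theorem cast_rest {Γ : Ctx} {a : Ty} {l l' : List Ty} (hl : l = l') (h : a :: l = a :: l')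
    (t : Tms Γ (a :: l)) : (cast h t).rest = cast hl t.rest := by
  subst hl; rfl

theorem cast_apps {Γ : Ctx} {l m m' : List Ty} (hm : m = m') (h : m.map (arrs l) = m'.map (arrs l))
    (y : Tms Γ (m.map (arrs l))) (x : Tms Γ l) :
    Tms.apps l m' (cast h y) x = cast hm (Tms.apps l m y x) := by
  subst hm; rfl

theorem cast_wk {Γ : Ctx} {b : Ty} {m m' : List Ty} (hm : m = m') (y : Tms Γ m) :
    Tms.wk b m' (cast hm y) = cast hm (Tms.wk b m y) := by
  subst hm; rfl

theorem cast_cast {Γ : Ctx} {l m : List Ty} (h : l = m) (h' : m = l) (t : Tms Γ l) :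
    cast h' (cast h t) = t := by
  subst h; rfl

theorem Eq.refl {Γ : Ctx} (l : List Ty) (t : Tms Γ l) : Eq l t t := by
  induction l with
  | nil => trivial
  | cons a l ih => exact ⟨TmEq.refl _, ih _⟩

theorem Eq.symm {Γ : Ctx} {l : List Ty} {t u : Tms Γ l} (h : Eq l t u) : Eq l u t := by
  induction l with
  | nil => trivial
  | cons a l ih => exact ⟨h.1.symm, ih h.2⟩

theorem Eq.trans {Γ : Ctx} {l : List Ty} {t u v : Tms Γ l} (h : Eq l t u) (h' : Eq l u v) :
    Eq l t v := by
  induction l with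
  | nil => trivial
  | cons a l ih => exact ⟨h.1.trans h'.1, ih h.2 h'.2⟩

theorem Eq.subst {Γ Δ : Ctx} (σ : Sb Γ Δ) {l : List Ty} {t u : Tms Γ l} (h : Eq l t u) :
    Eq l (t.subst σ) (u.subst σ) := by
  induction l with
  | nil => trivial
  | cons a l ih => exact ⟨h.1.subst σ, ih h.2⟩

theorem Eq.left {Γ : Ctx} {l m : List Ty} {t u : Tms Γ (l ++ m)} (h : Eq _ t u) :
    Eq l (Tms.left l m t) (Tms.left l m u) := by
  induction l with
  | nil => trivial
  | cons a l ih => exact ⟨h.1, ih h.2⟩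

theorem Eq.right {Γ : Ctx} {l m : List Ty} {t u : Tms Γ (l ++ m)} (h : Eq _ t u) :
    Eq m (Tms.right l m t) (Tms.right l m u) := by
  induction l with
  | nil => exact h
  | cons a l ih => exact ih h.2

theorem _root_.IPOR.TmEq.apps {Γ : Ctx} {b : Ty} {l : List Ty} {t u : Tm Γ (arrs l b)}
    (h : TmEq t u) (x : Tms Γ l) : TmEq (IPOR.apps l t x) (IPOR.apps l u x) := by
  induction l with
  | nil => exact h
  | cons a l ih => exact ih (h.app (TmEq.refl _)) _

theorem Eq.apps {Γ : Ctx} {l m : List Ty} {y z : Tms Γ (m.map (arrs l))} (h : Eq _ y z)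
    (x : Tms Γ l) : Eq m (Tms.apps l m y x) (Tms.apps l m z x) := by
  induction m with
  | nil => trivial
  | cons a m ih => exact ⟨h.1.apps x, ih h.2⟩

end Tms

/-! ### Blocks of variables -/

namespace Sb

/-- A substitution under a block of binders. -/
def lifts : {Γ Δ : Ctx} → (l : List Ty) → Sb Γ Δ → Sb (ext l Γ) (ext l Δ)
  | _, _, [], σ => σ
  | _, _, a :: l, σ => lifts l (σ.lift a)

/-- Extends a substitution by terms for a block of variables. -/
def conss : {Γ Δ : Ctx} → (l : List Ty) → Tms Δ l → Sb Γ Δ → Sb (ext l Γ) Δ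
  | _, _, [], _, σ => σ
  | _, _, _ :: l, x, σ => conss l x.rest (cons x.head σ)

theorem wks_lifts {Γ Δ : Ctx} (l : List Ty) (σ : Sb Γ Δ) :
    (Ren.wks l).toSb.comp (σ.lifts l) = σ.comp (Ren.wks l).toSb := by
  induction l generalizing Γ Δ with
  | nil => exact (comp_id σ).symm
  | cons a l ih =>
    have h := congrArg (fun τ => (Ren.wk a).toSb.comp τ) (ih (σ.lift a))
    simp only [← comp_assoc] at h
    refine Eq.trans (b := ((Ren.wk a).toSb.comp (Ren.wks l).toSb).comp ((σ.lift a).lifts l)) rfl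
      (h.trans ?_)
    refine ext_apply fun _ _ => ?_
    show Tm.subst _ (Tm.wk a _) = _
    rw [Tm.wk_subst]
    rfl

theorem wks_conss {Γ Δ : Ctx} (l : List Ty) (x : Tms Δ l) (σ : Sb Γ Δ) :
    (Ren.wks l).toSb.comp (conss l x σ) = σ := by
  induction l generalizing Γ with
  | nil => rfl
  | cons a l ih => exact congrArg (fun τ => (Ren.wk a).toSb.comp τ) (ih x.rest (cons x.head σ))

theorem lifts_conss {Γ Δ Θ : Ctx} (l : List Ty) (σ : Sb Γ Δ) (x : Tms Θ l) (τ : Sb Δ Θ) :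
    (σ.lifts l).comp (conss l x τ) = conss l x (σ.comp τ) := by
  induction l generalizing Γ Δ with
  | nil => rfl
  | cons a l ih =>
    exact (ih (σ.lift a) x.rest (cons x.head τ)).trans (congrArg _ (lift_comp_cons _ _ _))

theorem conss_vars {Γ : Ctx} (l : List Ty) :
    conss l (Tms.vars l) (Ren.wks l).toSb = Sb.id (IPOR.ext l Γ) := by
  induction l generalizing Γ with
  | nil => rfl
  | cons a l ih =>
    refine Eq.trans ?_ (ih (Γ := a :: Γ))
    exact congrArg (conss l _) (cons_zero_succ (Ren.wks l).toSb)

end Sb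

theorem Tms.vars_lifts {Γ Δ : Ctx} (l : List Ty) (σ : Sb Γ Δ) :
    (Tms.vars l).subst (σ.lifts l) = Tms.vars l := by
  induction l generalizing Γ Δ with
  | nil => rfl
  | cons a l ih =>
    refine Prod.ext ?_ (ih (σ.lift a))
    exact congrFun (congrFun (Sb.wks_lifts l (σ.lift a)) a) Var.zero

theorem Tms.vars_conss {Γ Δ : Ctx} (l : List Ty) (x : Tms Δ l) (σ : Sb Γ Δ) :
    (Tms.vars l).subst (Sb.conss l x σ) = x := by
  induction l generalizing Γ with
  | nil => rfl
  | cons a l ih =>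
    refine Prod.ext ?_ (ih x.rest (Sb.cons x.head σ))
    exact congrFun (congrFun (Sb.wks_conss l x.rest (Sb.cons x.head σ)) a) Var.zero

theorem Tms.ren_wks_lifts {Γ Δ : Ctx} (l m : List Ty) (σ : Sb Γ Δ) (t : Tms Γ m) :
    (Tms.ren (Ren.wks l) m t).subst (σ.lifts l) = Tms.ren (Ren.wks l) m (t.subst σ) := by
  rw [Tms.ren_eq, Tms.ren_eq, Tms.subst_subst, Tms.subst_subst, Sb.wks_lifts]

theorem Tms.wk_lift {Γ Δ : Ctx} (a : Ty) (m : List Ty) (σ : Sb Γ Δ) (t : Tms Γ m) :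
    (Tms.wk a m t).subst (σ.lift a) = Tms.wk a m (t.subst σ) := by
  rw [Tms.wk_eq, Tms.wk_eq, Tms.subst_subst, Tms.subst_subst, ← Sb.wk_eq_comp]
  rfl

theorem Fm.alls_subst {Γ Δ : Ctx} (l : List Ty) (F : Fm (ext l Γ)) (σ : Sb Γ Δ) :
    (Fm.alls l F).subst σ = Fm.alls l (F.subst (σ.lifts l)) := by
  induction l generalizing Γ Δ with
  | nil => rfl
  | cons a l ih => exact congrArg (Fm.all a) (ih F (σ.lift a))

theorem Prov.allsE {Γ : Ctx} {H : List (Fm Γ)} (l : List Ty) {F : Fm (ext l Γ)}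
    (h : Prov H (Fm.alls l F)) (x : Tms Γ l) : Prov H (F.subst (Sb.conss l x (Sb.id Γ))) := by
  induction l generalizing Γ with
  | nil => exact (Fm.subst_id F).symm ▸ h
  | cons a l ih =>
    have key : ∀ G : Fm (ext l (a :: Γ)), Prov H ((Fm.alls l G).inst x.head) →
        Prov H (G.subst (Sb.conss l x.rest (Sb.cons x.head (Sb.id Γ)))) := by
      intro G h
      rw [Fm.inst, Fm.alls_subst] at h
      have := ih h x.rest
      rwa [Fm.subst_subst, Sb.lifts_conss, Sb.comp_id] at this
    exact key F (allE x.head h)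

theorem Prov.allsI {Γ : Ctx} {H : List (Fm Γ)} (l : List Ty) {F : Fm (ext l Γ)}
    (h : Prov (H.map (Fm.ren (Ren.wks l))) F) : Prov H (Fm.alls l F) := by
  induction l generalizing Γ with
  | nil =>
    have : H.map (Fm.ren (Ren.wks [])) = H := by
      conv_rhs => rw [← List.map_id H]
      exact List.map_congr_left fun F _ => Fm.subst_id F
    rwa [this] at h
  | cons a l ih =>
    refine allI (ih ?_)
    rw [List.map_map]
    refine Eq.mp ?_ h
    congr 1
    refine List.map_congr_left fun F _ => ?_
    simp only [Function.comp, Fm.wk_eq, Fm.ren_eq, Fm.subst_subst]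
    rfl

/-- Abstraction over a block of variables. -/
def lams : {Γ : Ctx} → (l : List Ty) → {b : Ty} → Tm (ext l Γ) b → Tm Γ (arrs l b)
  | _, [], _, t => t
  | _, _ :: l, _, t => Tm.lam (lams l t)

def Tms.lams {Γ : Ctx} (l : List Ty) : (m : List Ty) → Tms (ext l Γ) m → Tms Γ (m.map (arrs l))
  | [], _ => ()
  | _ :: m, t => (IPOR.lams l t.head, Tms.lams l m t.rest)

theorem apps_lams {Γ Δ : Ctx} {b : Ty} (l : List Ty) (t : Tm (ext l Γ) b) (σ : Sb Γ Δ)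
    (x : Tms Δ l) : TmEq (apps l ((lams l t).subst σ) x) (t.subst (Sb.conss l x σ)) := by
  induction l generalizing Γ with
  | nil => exact TmEq.refl _
  | cons a l ih =>
    refine TmEq.trans (TmEq.apps ?_ x.rest) (ih (Γ := a :: Γ) t (Sb.cons x.head σ) x.rest)
    refine TmEq.app_lam (TmEq.of_eq ?_)
    rw [Tm.subst_subst, Sb.lift_comp_inst]
    rfl

theorem Tms.apps_lams {Γ Δ : Ctx} (l m : List Ty) (t : Tms (ext l Γ) m) (σ : Sb Γ Δ)
    (x : Tms Δ l) :
    Tms.Eq m (Tms.apps l m ((Tms.lams l m t).subst σ) x) (t.subst (Sb.conss l x σ)) := by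
  induction m with
  | nil => trivial
  | cons a m ih => exact ⟨IPOR.apps_lams l _ σ x, ih _⟩

/-! ### Realizability and substitution -/

namespace Fm

theorem rtys_subst {Γ Δ : Ctx} (F : Fm Γ) (σ : Sb Γ Δ) : (F.subst σ).rtys = F.rtys := by
  induction F generalizing Δ <;> simp_all [subst, rtys]

/-- The universally quantified implication in the definition of `𝐲 ® (G → H)`, for given
realizability predicates of `G` and `H`. -/
def realizeImp {Δ : Ctx} (l m : List Ty) (P : ∀ Θ, Ren Δ Θ → Tms Θ l → Fm Θ)
    (Q : ∀ Θ, Ren Δ Θ → Tms Θ m → Fm Θ) (y : Tms Δ (m.map (arrs l))) : Fm Δ :=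
  Fm.alls l (Fm.imp (P _ (Ren.wks l) (Tms.vars l))
    (Q _ (Ren.wks l) (Tms.apps l m (Tms.ren (Ren.wks l) _ y) (Tms.vars l))))

/-- With the two realizability predicates abstracted, the lists of types become free variables, and
the equations between them can be eliminated even though the lists also determine the extended
context. -/
theorem realizeImp_cast {Δ : Ctx} {l l' m m' : List Ty} (hl : l' = l) (hm : m' = m)
    (P : ∀ Θ, Ren Δ Θ → Tms Θ l → Fm Θ) (Q : ∀ Θ, Ren Δ Θ → Tms Θ m → Fm Θ)
    (h : m'.map (arrs l') = m.map (arrs l)) (y : Tms Δ (m'.map (arrs l'))) :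
    realizeImp l' m' (fun Θ ρ r => P Θ ρ (r.cast hl)) (fun Θ ρ r => Q Θ ρ (r.cast hm)) y =
      realizeImp l m P Q (y.cast h) := by
  subst hl hm; rfl

theorem realize_of_subst {Γ Δ Θ : Ctx} (F : Fm Γ) (σ : Sb Γ Δ) (τ : Sb Δ Θ)
    (r : Tms Θ (F.subst σ).rtys) :
    (F.subst σ).realize τ r = F.realize (σ.comp τ) (r.cast (F.rtys_subst σ)) := by
  induction F generalizing Δ Θ with
  | eq t u => simp only [subst, realize, Tm.subst_subst]
  | pre t u => simp only [subst, realize, Tm.subst_subst]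
  | flip t => simp only [subst, realize, Tm.subst_subst]
  | and G H ihG ihH =>
    have hG := G.rtys_subst σ
    have hH := H.rtys_subst σ
    exact congrArg₂ Fm.and
      ((ihG σ τ _).trans (congrArg (G.realize _) (Tms.cast_left hG hH _ r).symm))
      ((ihH σ τ _).trans (congrArg (H.realize _) (Tms.cast_right hG hH _ r).symm))
  | or G H ihG ihH =>
    have hG := G.rtys_subst σ
    have hH := H.rtys_subst σ
    have hGH := congrArg₂ (· ++ ·) hG hH
    have h₀ := Tms.cast_head (congrArg (Ty.s :: ·) hGH) r
    have h₁ := Tms.cast_rest hGH (congrArg (Ty.s :: ·) hGH) r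
    exact congrArg₂ Fm.or
      (congrArg₂ Fm.and (congrArg (Fm.eq · zeroT) h₀.symm)
        ((ihG σ τ _).trans (congrArg (G.realize _)
          ((Tms.cast_left hG hH hGH _).symm.trans (congrArg (Tms.left _ _) h₁.symm)))))
      (congrArg₂ Fm.and (congrArg (fun t => Fm.neg (Fm.eq t zeroT)) h₀.symm)
        ((ihH σ τ _).trans (congrArg (H.realize _)
          ((Tms.cast_right hG hH hGH _).symm.trans (congrArg (Tms.right _ _) h₁.symm)))))
  | imp G H ihG ihH =>
    have hc : ∀ (Ξ : Ctx) (ρ : Ren Θ Ξ), σ.comp (fun _ x => (τ _ x).ren ρ) =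
        fun _ x => ((σ.comp τ) _ x).ren ρ := fun Ξ ρ => Sb.ext_apply fun a x => by
      simp only [Sb.comp_apply, Tm.subst_ren]
      congr 1
      exact Sb.ext_apply fun _ _ => Tm.ren_eq_subst _ _
    have h := realizeImp_cast (G.rtys_subst σ) (H.rtys_subst σ)
      (fun _ ρ r => G.realize (fun _ x => ((σ.comp τ) _ x).ren ρ) r)
      (fun _ ρ r => H.realize (fun _ x => ((σ.comp τ) _ x).ren ρ) r)
      ((Fm.imp G H).rtys_subst σ) r
    refine congrArg₂ Fm.and (Eq.trans ?_ h)
      (congrArg₂ Fm.imp (subst_subst _ _ _) (subst_subst _ _ _))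
    refine congrArg₂ (fun P Q => realizeImp (G.subst σ).rtys (H.subst σ).rtys P Q r)
      (x := fun _ ρ r => (G.subst σ).realize (fun _ x => (τ _ x).ren ρ) r)
      (y := fun _ ρ r => (H.subst σ).realize (fun _ x => (τ _ x).ren ρ) r) ?_ ?_
    · funext Ξ ρ r
      rw [ihG, hc]
    · funext Ξ ρ r
      rw [ihH, hc]
  | all a G ih =>
    have hG := G.rtys_subst (σ.lift a)
    refine congrArg (Fm.all a) ((ih _ _ _).trans ?_)
    rw [Sb.lift_comp_lift]
    refine congrArg (G.realize _) ((Tms.cast_apps hG (congrArg _ hG) _ _).symm.trans ?_)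
    exact congrArg (fun y => Tms.apps [a] G.rtys y (Tm.var Var.zero, ()))
      (Tms.cast_wk (congrArg _ hG) r).symm
  | ex a G ih =>
    have hG := G.rtys_subst (σ.lift a)
    refine (ih (σ.lift a) (Sb.cons r.head τ) r.rest).trans ?_
    rw [Sb.lift_comp_cons]
    exact congrArg₂ (fun z x => G.realize (Sb.cons z (σ.comp τ)) x)
      (Tms.cast_head (congrArg (a :: ·) hG) r).symm
      (Tms.cast_rest hG (congrArg (a :: ·) hG) r).symm

theorem realize_subst {Γ Δ Θ : Ctx} (F : Fm Γ) (σ : Sb Γ Δ) (τ : Sb Δ Θ) (r : Tms Δ F.rtys) :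
    (F.realize σ r).subst τ = F.realize (σ.comp τ) (r.subst τ) := by
  induction F generalizing Δ Θ with
  | eq t u => simp only [subst, realize, Tm.subst_subst]
  | pre t u => simp only [subst, realize, Tm.subst_subst]
  | flip t => simp only [subst, realize, Tm.subst_subst]
  | and G H ihG ihH =>
    exact congrArg₂ Fm.and
      ((ihG σ τ _).trans (congrArg (G.realize _) (Tms.subst_left _ _ _ r)))
      ((ihH σ τ _).trans (congrArg (H.realize _) (Tms.subst_right _ _ _ r)))
  | or G H ihG ihH =>
    exact congrArg₂ Fm.or
      (congrArg₂ Fm.and rfl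
        ((ihG σ τ _).trans (congrArg (G.realize _) (Tms.subst_left _ _ _ r.rest))))
      (congrArg₂ Fm.and rfl
        ((ihH σ τ _).trans (congrArg (H.realize _) (Tms.subst_right _ _ _ r.rest))))
  | imp G H ihG ihH =>
    have hc : Sb.comp (fun _ x => (σ _ x).ren (Ren.wks G.rtys)) (τ.lifts G.rtys) =
        fun _ x => ((σ.comp τ) _ x).ren (Ren.wks G.rtys) := Sb.ext_apply fun a x => by
      simp only [Sb.comp_apply, Tm.ren_subst, Sb.wks_lifts]
      rw [← Tm.subst_subst, ← Tm.ren_eq_subst]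
    refine congrArg₂ Fm.and ((alls_subst _ _ _).trans (congrArg (Fm.alls _)
      (congrArg₂ Fm.imp ((ihG _ _ _).trans ?_) ((ihH _ _ _).trans ?_))))
      (congrArg₂ Fm.imp (subst_subst _ _ _) (subst_subst _ _ _))
    · rw [hc, Tms.vars_lifts]
    · rw [hc]
      refine congrArg (H.realize _) ((Tms.apps_subst _ _ _ _ _).trans ?_)
      rw [Tms.vars_lifts]
      exact congrArg (fun y => Tms.apps G.rtys H.rtys y (Tms.vars _)) (Tms.ren_wks_lifts _ _ _ r)
  | all a G ih =>
    refine congrArg (Fm.all a) ((ih _ _ _).trans ?_)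
    rw [Sb.lift_comp_lift]
    refine congrArg (G.realize _) ((Tms.apps_subst _ _ _ _ _).trans ?_)
    exact congrArg (fun y => Tms.apps [a] G.rtys y (Tm.var Var.zero, ())) (Tms.wk_lift _ _ _ r)
  | ex a G ih =>
    refine (ih _ _ _).trans ?_
    rw [Sb.comp_cons]
    rfl

theorem realize_wk {Γ Δ : Ctx} (F : Fm Γ) (σ : Sb Γ Δ) (b : Ty) (r : Tms Δ F.rtys) :
    (F.realize σ r).wk b = F.realize (σ.wk b) (Tms.wk b _ r) := by
  rw [wk_eq, realize_subst, Tms.wk_eq, Sb.wk_eq_comp]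

end Fm

/-! ### Provable equations -/

section SubstAbbreviations

variable {Γ Δ : Ctx} (σ : Sb Γ Δ)

@[simp] theorem subst_varT {a : Ty} (x : Var Γ a) : (Tm.var x).subst σ = σ a x := rfl
@[simp] theorem subst_app {a b : Ty} (t : Tm Γ (a ⇒' b)) (u : Tm Γ a) :
    (Tm.app t u).subst σ = Tm.app (t.subst σ) (u.subst σ) := rfl
@[simp] theorem subst_lam {a b : Ty} (t : Tm (a :: Γ) b) :
    (Tm.lam t).subst σ = Tm.lam (t.subst (σ.lift a)) := rfl
@[simp] theorem subst_zeroT : (zeroT : Tm Γ _).subst σ = zeroT := rfl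
@[simp] theorem subst_oneT : (oneT : Tm Γ _).subst σ = oneT := rfl
@[simp] theorem subst_epsT : (epsT : Tm Γ _).subst σ = epsT := rfl
@[simp] theorem subst_catT (x y : Tm Γ Ty.s) :
    (catT x y).subst σ = catT (x.subst σ) (y.subst σ) := rfl
@[simp] theorem subst_tailT (x : Tm Γ Ty.s) : (tailT x).subst σ = tailT (x.subst σ) := rfl
@[simp] theorem subst_truncT (x y : Tm Γ Ty.s) :
    (truncT x y).subst σ = truncT (x.subst σ) (y.subst σ) := rfl
@[simp] theorem subst_timesT (x y : Tm Γ Ty.s) :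
    (timesT x y).subst σ = timesT (x.subst σ) (y.subst σ) := rfl
@[simp] theorem subst_condT (x y z w : Tm Γ Ty.s) : (condT x y z w).subst σ =
    condT (x.subst σ) (y.subst σ) (z.subst σ) (w.subst σ) := rfl
@[simp] theorem subst_recT (x : Tm Γ Ty.s) (h₀ h₁ : Tm Γ (Ty.s ⇒' Ty.s ⇒' Ty.s))
    (k : Tm Γ (Ty.s ⇒' Ty.s)) (y : Tm Γ Ty.s) : (recT x h₀ h₁ k y).subst σ =
    recT (x.subst σ) (h₀.subst σ) (h₁.subst σ) (k.subst σ) (y.subst σ) := rfl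
@[simp] theorem subst_snocT (x : Tm Γ Ty.s) (b : Bool) :
    (snocT x b).subst σ = snocT (x.subst σ) b := by cases b <;> rfl
@[simp] theorem subst_dropT (x y : Tm Γ Ty.s) :
    (dropT x y).subst σ = dropT (x.subst σ) (y.subst σ) := rfl
@[simp] theorem subst_SubT (x y : Tm Γ Ty.s) :
    (SubT x y).subst σ = SubT (x.subst σ) (y.subst σ) := rfl
@[simp] theorem subst_EqT (x y : Tm Γ Ty.s) :
    (EqT x y).subst σ = EqT (x.subst σ) (y.subst σ) := rfl
@[simp] theorem subst_EpsT (x : Tm Γ Ty.s) : (EpsT x).subst σ = EpsT (x.subst σ) := rfl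
@[simp] theorem subst_BOrT (x y : Tm Γ Ty.s) :
    (BOrT x y).subst σ = BOrT (x.subst σ) (y.subst σ) := rfl

end SubstAbbreviations

theorem TmEq.beta₂ {Γ : Ctx} {a b c : Ty} (t : Tm (b :: a :: Γ) c) (u : Tm Γ a) (v : Tm Γ b) :
    TmEq (Tm.app (Tm.app (Tm.lam (Tm.lam t)) u) v) (t.subst (Sb.cons v (Sb.inst u))) := by
  refine TmEq.trans (TmEq.app (TmEq.beta _ _) (TmEq.refl _)) (TmEq.app_lam (TmEq.of_eq ?_))
  rw [Tm.subst_subst, Sb.lift_comp_inst]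

/-- Terms of type `s` up to provable equality under the hypotheses `H`. -/
def provSetoid {Γ : Ctx} (H : List (Fm Γ)) : Setoid (Tm Γ Ty.s) where
  r t u := Prov H (Fm.eq t u)
  iseqv := ⟨Prov.eqRefl, Prov.symm, Prov.trans⟩

/-- In this quotient, derivations of equations become rewriting: the equational axioms turn into
genuine equalities that `simp` can use, while case distinctions and inductions move to larger `H`.
-/
def Q {Γ : Ctx} (H : List (Fm Γ)) : Type := Quotient (provSetoid H)

namespace Q

variable {Γ : Ctx} {H : List (Fm Γ)}

def mk (H : List (Fm Γ)) (t : Tm Γ Ty.s) : Q H := Quotient.mk (provSetoid H) t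

theorem mk_eq {t u : Tm Γ Ty.s} : mk H t = mk H u ↔ Prov H (Fm.eq t u) :=
  ⟨fun h => Quotient.exact h, fun h => Quotient.sound (s := provSetoid H) h⟩

theorem ind {P : Q H → Prop} (h : ∀ t, P (mk H t)) (q : Q H) : P q := Quotient.ind h q

theorem app_congr (t : Tm Γ (Ty.s ⇒' Ty.s)) {x x' : Tm Γ Ty.s} (h : Prov H (Fm.eq x x')) :
    Prov H (Fm.eq (Tm.app t x) (Tm.app t x')) := by
  simpa using h.congr (Tm.app (t.wk _) (Tm.var Var.zero))

theorem app₂_congr (t : Tm Γ (Ty.s ⇒' Ty.s ⇒' Ty.s)) {x x' y y' : Tm Γ Ty.s}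
    (hx : Prov H (Fm.eq x x')) (hy : Prov H (Fm.eq y y')) :
    Prov H (Fm.eq (Tm.app (Tm.app t x) y) (Tm.app (Tm.app t x') y')) := by
  refine Prov.trans (u := Tm.app (Tm.app t x') y) ?_ (app_congr _ hy)
  simpa using hx.congr (Tm.app (Tm.app (t.wk _) (Tm.var Var.zero)) (y.wk _))

def app (t : Tm Γ (Ty.s ⇒' Ty.s)) : Q H → Q H :=
  Quotient.map' (s₁ := provSetoid H) (s₂ := provSetoid H) (fun x => Tm.app t x)
    fun _ _ h => app_congr t h

def app₂ (t : Tm Γ (Ty.s ⇒' Ty.s ⇒' Ty.s)) : Q H → Q H → Q H :=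
  Quotient.map₂ (sa := provSetoid H) (sb := provSetoid H) (sc := provSetoid H)
    (fun x y => Tm.app (Tm.app t x) y) fun _ _ h _ _ h' => app₂_congr t h h'

def eps : Q H := mk H epsT
def cat : Q H → Q H → Q H := app₂ (Tm.con Con.cat)
def tail : Q H → Q H := app (Tm.con Con.tail)
def trunc : Q H → Q H → Q H := app₂ (Tm.con Con.trunc)
def times : Q H → Q H → Q H := app₂ (Tm.con Con.times)
def snoc (q : Q H) (b : Bool) : Q H := cat q (mk H (bitT b))
def drop : Q H → Q H → Q H := app₂ dropC
def sub : Q H → Q H → Q H := app₂ subC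
def rec (x : Tm Γ Ty.s) (h₀ h₁ : Tm Γ (Ty.s ⇒' Ty.s ⇒' Ty.s)) (k : Tm Γ (Ty.s ⇒' Ty.s)) :
    Q H → Q H :=
  app (Tm.app (Tm.app (Tm.app (Tm.app (Tm.con Con.recn) x) h₀) h₁) k)

theorem cond_congr {x x' y y' z z' w w' : Tm Γ Ty.s}
    (hx : Prov H (Fm.eq x x')) (hy : Prov H (Fm.eq y y'))
    (hz : Prov H (Fm.eq z z')) (hw : Prov H (Fm.eq w w')) :
    Prov H (Fm.eq (condT x y z w) (condT x' y' z' w')) := by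
  refine Prov.trans (u := condT x' y z w) ?_ (Prov.trans (u := condT x' y' z w) ?_
    (app₂_congr _ hz hw))
  · simpa using hx.congr (condT (Tm.var Var.zero) (y.wk _) (z.wk _) (w.wk _))
  · simpa using hy.congr (condT (x'.wk _) (Tm.var Var.zero) (z.wk _) (w.wk _))

def cond (x y z w : Q H) : Q H :=
  Quotient.liftOn₂ (s₁ := provSetoid H) (s₂ := provSetoid H) x y
    (fun x y => Quotient.map₂ (sa := provSetoid H) (sb := provSetoid H) (sc := provSetoid H)
      (fun z w => condT x y z w)
      (fun _ _ hz _ _ hw => cond_congr (Prov.eqRefl _) (Prov.eqRefl _) hz hw) z w)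
    fun _ _ _ _ hx hy => by
      induction z using ind
      induction w using ind
      exact mk_eq.2 (cond_congr hx hy (Prov.eqRefl _) (Prov.eqRefl _))

section mk
variable (x y z w : Tm Γ Ty.s)
@[simp] theorem mk_eps : mk H epsT = eps := rfl
@[simp] theorem mk_cat : mk H (catT x y) = cat (mk H x) (mk H y) := rfl
@[simp] theorem mk_tail : mk H (tailT x) = tail (mk H x) := rfl
@[simp] theorem mk_trunc : mk H (truncT x y) = trunc (mk H x) (mk H y) := rfl
@[simp] theorem mk_times : mk H (timesT x y) = times (mk H x) (mk H y) := rfl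
@[simp] theorem mk_snoc (b : Bool) : mk H (snocT x b) = snoc (mk H x) b := rfl
@[simp] theorem mk_drop : mk H (dropT x y) = drop (mk H x) (mk H y) := rfl
@[simp] theorem mk_sub : mk H (SubT x y) = sub (mk H x) (mk H y) := rfl
@[simp] theorem mk_rec (h₀ h₁ : Tm Γ (Ty.s ⇒' Ty.s ⇒' Ty.s)) (k : Tm Γ (Ty.s ⇒' Ty.s)) :
    mk H (recT x h₀ h₁ k y) = rec x h₀ h₁ k (mk H y) := rfl
@[simp] theorem mk_cond :
    mk H (condT x y z w) = cond (mk H x) (mk H y) (mk H z) (mk H w) := rfl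
@[simp] theorem mk_zero : mk H zeroT = snoc eps false :=
  (mk_eq.2 (Prov.eqAx (EqAx.eps_cat zeroT))).symm
@[simp] theorem mk_one : mk H oneT = snoc eps true :=
  (mk_eq.2 (Prov.eqAx (EqAx.eps_cat oneT))).symm
end mk

@[simp] theorem eps_cat (x : Q H) : cat eps x = x := by
  induction x using ind with | _ x
  exact mk_eq.2 (Prov.eqAx (EqAx.eps_cat x))

@[simp] theorem cat_eps (x : Q H) : cat x eps = x := by
  induction x using ind with | _ x
  exact mk_eq.2 (Prov.eqAx (EqAx.cat_eps x))

@[simp] theorem cat_snoc (x y : Q H) (b : Bool) : cat x (snoc y b) = snoc (cat x y) b := by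
  induction x using ind with | _ x
  induction y using ind with | _ y
  exact mk_eq.2 (Prov.eqAx (EqAx.cat_snoc x y b))

@[simp] theorem tail_eps : tail (eps : Q H) = eps := mk_eq.2 (Prov.eqAx EqAx.tail_eps)

@[simp] theorem tail_snoc (x : Q H) (b : Bool) : tail (snoc x b) = x := by
  induction x using ind with | _ x
  exact mk_eq.2 (Prov.eqAx (EqAx.tail_snoc x b))

@[simp] theorem trunc_eps (x : Q H) : trunc x eps = eps := by
  induction x using ind with | _ x
  exact mk_eq.2 (Prov.eqAx (EqAx.trunc_eps x))

@[simp] theorem eps_trunc (x : Q H) : trunc eps x = eps := by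
  induction x using ind with | _ x
  exact mk_eq.2 (Prov.eqAx (EqAx.eps_trunc x))

@[simp] theorem trunc_snoc (x y : Q H) (b c : Bool) :
    trunc (snoc x b) (snoc y c) = snoc (trunc x y) b := by
  induction x using ind with | _ x
  induction y using ind with | _ y
  exact mk_eq.2 (Prov.eqAx (EqAx.trunc_snoc x y b c))

@[simp] theorem cond_eps (y z w : Q H) : cond eps y z w = y := by
  induction y using ind with | _ y
  induction z using ind with | _ z
  induction w using ind with | _ w
  exact mk_eq.2 (Prov.eqAx (EqAx.cond_eps y z w))

@[simp] theorem cond_zero (x y z w : Q H) : cond (snoc x false) y z w = z := by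
  induction x using ind with | _ x
  induction y using ind with | _ y
  induction z using ind with | _ z
  induction w using ind with | _ w
  exact mk_eq.2 (Prov.eqAx (EqAx.cond_zero x y z w))

@[simp] theorem cond_one (x y z w : Q H) : cond (snoc x true) y z w = w := by
  induction x using ind with | _ x
  induction y using ind with | _ y
  induction z using ind with | _ z
  induction w using ind with | _ w
  exact mk_eq.2 (Prov.eqAx (EqAx.cond_one x y z w))

@[simp] theorem times_eps (x : Q H) : times x eps = eps := by
  induction x using ind with | _ x
  exact mk_eq.2 (Prov.eqAx (EqAx.times_eps x))

@[simp] theorem times_snoc (x y : Q H) (b : Bool) : times x (snoc y b) = cat (times x y) x := by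
  induction x using ind with | _ x
  induction y using ind with | _ y
  exact mk_eq.2 (Prov.eqAx (EqAx.times_snoc x y b))

theorem rec_eps (x : Tm Γ Ty.s) (h₀ h₁ : Tm Γ (Ty.s ⇒' Ty.s ⇒' Ty.s)) (k : Tm Γ (Ty.s ⇒' Ty.s)) :
    rec x h₀ h₁ k eps = mk H x := mk_eq.2 (Prov.eqAx (EqAx.rec_eps x h₀ h₁ k))

theorem rec_snoc (x : Tm Γ Ty.s) (h₀ h₁ : Tm Γ (Ty.s ⇒' Ty.s ⇒' Ty.s)) (k : Tm Γ (Ty.s ⇒' Ty.s))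
    (y : Tm Γ Ty.s) (b : Bool) : rec x h₀ h₁ k (snoc (mk H y) b) =
      trunc (mk H (Tm.app (Tm.app (bif b then h₁ else h₀) y) (recT x h₀ h₁ k y)))
        (mk H (Tm.app k y)) := by
  cases b
  · exact mk_eq.2 (Prov.eqAx (EqAx.rec_zero x h₀ h₁ k y))
  · exact mk_eq.2 (Prov.eqAx (EqAx.rec_one x h₀ h₁ k y))

theorem mk_tmEq {t u : Tm Γ Ty.s} (h : TmEq t u) : mk H t = mk H u := mk_eq.2 h.prov

theorem mk_beta₂ (t : Tm (Ty.s :: Ty.s :: Γ) Ty.s) (u v : Tm Γ Ty.s) :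
    mk H (Tm.app (Tm.app (Tm.lam (Tm.lam t)) u) v) = mk H (t.subst (Sb.cons v (Sb.inst u))) :=
  mk_tmEq (TmEq.beta₂ t u v)

theorem mk_beta (t : Tm (Ty.s :: Γ) Ty.s) (u : Tm Γ Ty.s) :
    mk H (Tm.app (Tm.lam t) u) = mk H (t.subst (Sb.inst u)) := mk_tmEq (TmEq.beta t u)

/-- `Drop(x, -)` as an instance of recursion. -/
theorem drop_eq (x y : Tm Γ Ty.s) : mk H (dropT x y) =
    rec x (Tm.lam (Tm.lam (tailT (Tm.var Var.zero)))) (Tm.lam (Tm.lam (tailT (Tm.var Var.zero))))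
      (Tm.lam (x.wk _)) (mk H y) := by
  rw [← mk_rec]
  refine (mk_beta₂ _ _ _).trans ?_
  simp [Tm.wk, Tm.ren_eq_subst]

@[simp] theorem drop_eps (x : Q H) : drop x eps = x := by
  induction x using ind with | _ x
  exact (drop_eq x epsT).trans (rec_eps _ _ _ _)

-- The truncation to the length of `x` is left in place. Where its effect matters below, the
-- truncated string is either empty or a suffix of the bound.
@[simp] theorem drop_snoc (x y : Q H) (b : Bool) :
    drop x (snoc y b) = trunc (tail (drop x y)) x := by
  induction x using ind with | _ x
  induction y using ind with | _ y
  refine (drop_eq x (snocT y b)).trans ((rec_snoc _ _ _ _ _ _).trans ?_)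
  rw [Bool.cond_self, mk_beta₂, mk_beta, Tm.wk_inst]
  simp [← drop_eq]

@[simp] theorem sub_eps (x : Q H) : sub x eps = cond x (snoc eps true) (snoc eps false)
    (snoc eps false) := by
  induction x using ind with | _ x
  refine (mk_beta₂ _ _ _).trans ?_
  simp [rec_eps, EpsT]

theorem sub_eq (x y : Tm Γ Ty.s) : mk H (SubT x y) =
    rec (EpsT x)
      (Tm.lam (Tm.lam (BOrT (Tm.var Var.zero)
        (EqT ((x.wk _).wk _) (snocT (Tm.var (Var.succ Var.zero)) false)))))
      (Tm.lam (Tm.lam (BOrT (Tm.var Var.zero)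
        (EqT ((x.wk _).wk _) (snocT (Tm.var (Var.succ Var.zero)) true)))))
      (Tm.lam zeroT) (mk H y) := by
  rw [← mk_rec]
  refine (mk_beta₂ _ _ _).trans ?_
  simp [Tm.wk, Tm.ren_eq_subst]

/-- The last digit. -/
def last (x : Q H) : Q H := cond x eps (snoc eps false) (snoc eps true)

def bor (x y : Q H) : Q H := cond (last x) (last y) (last y) (snoc eps true)

@[simp] theorem mk_BT (x : Tm Γ Ty.s) : mk H (BT x) = last (mk H x) := by simp [BT, last]

@[simp] theorem mk_BOrT (x y : Tm Γ Ty.s) : mk H (BOrT x y) = bor (mk H x) (mk H y) := by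
  simp [BOrT, bor]

theorem sub_snoc (x y : Tm Γ Ty.s) (b : Bool) : sub (mk H x) (snoc (mk H y) b) =
    trunc (bor (sub (mk H x) (mk H y)) (mk H (EqT x (snocT y b)))) (snoc eps false) := by
  refine (sub_eq x (snocT y b)).trans ((rec_snoc _ _ _ _ _ _).trans ?_)
  cases b <;> simp only [Bool.cond_false, Bool.cond_true] <;> rw [mk_beta₂, mk_beta] <;>
    simp [← sub_eq]

theorem cases (x : Tm Γ Ty.s) {F : Fm Γ}
    (h₀ : ∀ H', H ⊆ H' → mk H' x = eps → Prov H' F)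
    (h₁ : ∀ H' (m : Tm Γ Ty.s) (b : Bool), H ⊆ H' → mk H' x = snoc (mk H' m) b → Prov H' F) :
    Prov H F := by
  have hs : ∀ G : Fm Γ, H ⊆ G :: H := fun G => List.subset_cons_self _ _
  refine Prov.orE (Prov.ax (Ax.cases x)) (h₀ _ (hs _) (mk_eq.2 Prov.hyp₀)) ?_
  refine Prov.orE Prov.hyp₀ (h₁ _ (tailT x) false ?_ (mk_eq.2 Prov.hyp₀))
    (h₁ _ (tailT x) true ?_ (mk_eq.2 Prov.hyp₀))
  all_goals exact fun G hG => List.mem_cons_of_mem _ (List.mem_cons_of_mem _ hG)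

theorem mk_mono {H' : List (Fm Γ)} (hs : H ⊆ H') {t u : Tm Γ Ty.s} (h : mk H t = mk H u) :
    mk H' t = mk H' u := mk_eq.2 ((mk_eq.1 h).mono hs)

theorem mk_cases {t u : Tm Γ Ty.s} (x : Tm Γ Ty.s)
    (h₀ : ∀ H', H ⊆ H' → mk H' x = eps → mk H' t = mk H' u)
    (h₁ : ∀ H' (m : Tm Γ Ty.s) (b : Bool), H ⊆ H' → mk H' x = snoc (mk H' m) b →
      mk H' t = mk H' u) : mk H t = mk H u :=
  mk_eq.2 (cases x (fun H' hs h => mk_eq.1 (h₀ H' hs h)) fun H' m b hs h =>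
    mk_eq.1 (h₁ H' m b hs h))

theorem of_zero_eq_one (h : snoc (eps : Q H) false = snoc eps true) (F : Fm Γ) : Prov H F :=
  Prov.botE (mk_eq.1 (by simpa using h))

theorem mk_pre (x y : Tm Γ Ty.s) : Prov H (Fm.pre x y) ↔ sub (mk H x) (mk H y) = snoc eps true := by
  rw [← eps_cat (snoc eps true), cat_snoc, cat_eps, ← mk_one, ← mk_sub, mk_eq]
  exact ⟨Prov.impE (Prov.andE₁ (Prov.ax (Ax.pre x y))), Prov.impE (Prov.andE₂ (Prov.ax (Ax.pre x y)))⟩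

/-- Induction on notation for equations. -/
theorem induction (L R : Tm (Ty.s :: Γ) Ty.s)
    (h₀ : mk H (L.subst (Sb.inst epsT)) = mk H (R.subst (Sb.inst epsT)))
    (h₁ : ∀ (H' : List (Fm (Ty.s :: Γ))) (b : Bool), H.map (Fm.wk Ty.s) ⊆ H' → mk H' L = mk H' R →
      mk H' (L.subst (Sb.cons (snocT (Tm.var Var.zero) b) (Ren.wk Ty.s).toSb)) =
        mk H' (R.subst (Sb.cons (snocT (Tm.var Var.zero) b) (Ren.wk Ty.s).toSb)))
    (y : Tm Γ Ty.s) : mk H (L.subst (Sb.inst y)) = mk H (R.subst (Sb.inst y)) := by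
  -- An equation is made an admissible induction formula by the vacuous quantifier `(∃ z ≼ ε)`. Its
  -- bound has no free variables, so `L` and `R` may contain variables of any type.
  have hle : ∀ {Δ : Ctx} (H : List (Fm Δ)), Prov H (Fm.le epsT epsT) := fun H => by
    rw [Fm.le, mk_pre]; simp
  have hI : ∀ {Δ : Ctx} {H : List (Fm Δ)} {t u : Tm Δ Ty.s}, Prov H (Fm.eq t u) →
      Prov H (Fm.exLe epsT (Fm.eq (t.wk Ty.s) (u.wk Ty.s))) := fun h => by
    refine Prov.exI epsT (Prov.andI (hle _) ?_)
    simpa [Fm.subst] using h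
  have hE : ∀ {Δ : Ctx} {H : List (Fm Δ)} {t u : Tm Δ Ty.s},
      Prov H (Fm.exLe epsT (Fm.eq (t.wk Ty.s) (u.wk Ty.s))) → Prov H (Fm.eq t u) := fun h => by
    refine Prov.exE h ?_
    rw [Fm.wk, Fm.ren_eq_atom]
    exact Prov.andE₂ Prov.hyp₀
  have hs : ∀ {Δ : Ctx} (σ : Sb (Ty.s :: Γ) Δ),
      (Fm.exLe epsT (Fm.eq (L.wk Ty.s) (R.wk Ty.s))).subst σ =
        Fm.exLe epsT (Fm.eq ((L.subst σ).wk Ty.s) ((R.subst σ).wk Ty.s)) := fun σ => by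
    rw [Fm.exLe_subst, Fm.subst, Tm.wk_lift, Tm.wk_lift]; rfl
  have hind := Prov.ax (H := H) (Ax.induction epsT (L.wk Ty.s) (R.wk Ty.s) trivial)
  have hstep : ∀ b, Prov H (Fm.all Ty.s (Fm.imp (Fm.exLe epsT (Fm.eq (L.wk Ty.s) (R.wk Ty.s)))
      ((Fm.exLe epsT (Fm.eq (L.wk Ty.s) (R.wk Ty.s))).succBit b))) := fun b => by
    refine Prov.allI (Prov.impI ?_)
    rw [Fm.succBit, hs]
    exact hI (mk_eq.1 (h₁ _ b (List.subset_cons_self _ _) (mk_eq.2 (hE Prov.hyp₀))))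
  have h := Prov.allE y (Prov.impE hind (Prov.andI ?_ (Prov.andI (hstep false) (hstep true))))
  · rw [Fm.inst, hs] at h
    exact mk_eq.2 (hE h)
  · rw [Fm.inst, hs]
    exact hI (mk_eq.1 h₀)

end Q

@[simp] theorem Tm.subst_toSb_wk {Γ : Ctx} {a b : Ty} (t : Tm Γ a) :
    t.subst (Ren.wk b).toSb = t.wk b := (Tm.ren_eq_subst _ _).symm

/-! ### String identities proved by induction on notation -/

namespace Q

variable {Γ : Ctx} {H : List (Fm Γ)}

@[simp] theorem cond_const (x y : Q H) : cond x y y y = y := by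
  induction x using ind with | _ x
  induction y using ind with | _ y
  refine mk_cases (t := condT x y y y) (u := y) x (fun H' _ h => ?_) fun H' m b _ h => ?_
  · simp [h]
  · cases b <;> simp [h]

theorem cat_assoc (x y z : Q H) : cat (cat x y) z = cat x (cat y z) := by
  induction x using ind with | _ x
  induction y using ind with | _ y
  induction z using ind with | _ z
  have := induction (H := H) (catT (catT (x.wk _) (y.wk _)) (Tm.var Var.zero))
    (catT (x.wk _) (catT (y.wk _) (Tm.var Var.zero))) (by simp)
    (fun H' b _ h => by simp at h ⊢; rw [h]) z
  simpa using this

/-- `1^x`. -/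
def pow (x : Q H) : Q H := times (snoc eps true) x

@[simp] theorem times_one (x : Q H) : times (snoc eps true) x = pow x := rfl

theorem one_cat_pow (x : Q H) : cat (snoc eps true) (pow x) = snoc (pow x) true := by
  induction x using ind with | _ x
  have := induction (H := H) (catT oneT (timesT oneT (Tm.var Var.zero)))
    (snocT (timesT oneT (Tm.var Var.zero)) true) (by simp)
    (fun H' b _ h => by simp at h ⊢; rw [h]) x
  simpa using this

theorem pow_cat_pow (x y : Q H) : cat (pow x) (pow y) = cat (pow y) (pow x) := by
  induction x using ind with | _ x
  induction y using ind with | _ y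
  have := induction (H := H) (catT (timesT oneT (x.wk _)) (timesT oneT (Tm.var Var.zero)))
    (catT (timesT oneT (Tm.var Var.zero)) (timesT oneT (x.wk _))) (by simp)
    (fun H' b _ h => by
      simp at h ⊢
      rw [h, ← cat_snoc, ← one_cat_pow, ← cat_assoc, cat_snoc, cat_eps]) y
  simpa using this

/-- `Trunc` consumes both arguments from the right, one digit at a time, so it returns `x` whenever
the second argument ends in a block of length `|x|`. In `trunc_cat_pow` that block is `1^x`. -/
theorem trunc_cat_self (x y : Q H) : trunc x (cat y x) = x := by
  induction x using ind with | _ x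
  induction y using ind with | _ y
  have := induction (H := H) (truncT (Tm.var Var.zero) (catT (y.wk _) (Tm.var Var.zero)))
    (Tm.var Var.zero) (by simp) (fun H' b _ h => by simp at h ⊢; rw [h]) x
  simpa using this

theorem trunc_cat_pow (x y : Q H) : trunc x (cat y (pow x)) = x := by
  induction x using ind with | _ x
  induction y using ind with | _ y
  have := induction (H := H)
    (truncT (Tm.var Var.zero) (catT (y.wk _) (timesT oneT (Tm.var Var.zero))))
    (Tm.var Var.zero) (by simp) (fun H' b _ h => by simp at h ⊢; rw [h]) x
  simpa using this

/-! ### Prefixes and lengths -/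

/-- The first conjunct of `Eq` tests whether `Drop(x, y)` is empty, and `BAnd` with first argument
`0` is `0`. This length test is all that is needed about `Eq`; the digitwise comparison `Match`
never has to be evaluated. -/
theorem EqT_of_drop {x y : Tm Γ Ty.s} (m : Tm Γ Ty.s) (b : Bool)
    (h : mk H (dropT x y) = mk H (snocT m b)) : mk H (EqT x y) = snoc eps false := by
  rw [mk_drop, mk_snoc] at h
  cases b <;> simp [EqT, BAndT, EpsT, BT, h]

/-- A prefix of `y` is no longer than `y`. The implication is packed into a conditional because only
equations can be proved by induction here. -/
theorem cond_sub_drop (x y : Q H) : cond (sub x y) eps eps (drop x y) = eps := by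
  induction x using ind with | _ x
  induction y using ind with | _ y
  have := induction (H := H)
    (condT (SubT (x.wk _) (Tm.var Var.zero)) epsT epsT (dropT (x.wk _) (Tm.var Var.zero)))
    epsT ?_ (fun H' b _ h => ?_) y
  · simpa using this
  · refine mk_cases x (fun H' _ h => ?_) fun H' m b _ h => ?_
    · simp [h]
    · cases b <;> simp [h]
  · refine mk_cases (dropT (x.wk Ty.s) (snocT (Tm.var Var.zero) b))
      (fun H₁ hs h₁ => ?_) fun H₁ m c hs h₁ => ?_
    · simp only [mk_drop, mk_snoc] at h₁
      simp [-drop_snoc, h₁]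
    · refine mk_cases (SubT (x.wk Ty.s) (Tm.var Var.zero))
        (fun H₂ hs₂ h₂ => ?_) fun H₂ p d hs₂ h₂ => ?_
      · have h₃ := EqT_of_drop m c (mk_mono hs₂ (u := snocT m c) h₁)
        rw [mk_sub] at h₂
        simp [sub_snoc, h₃, h₂, bor, last]
      · have h₃ := EqT_of_drop m c (mk_mono hs₂ (u := snocT m c) h₁)
        have h₄ := mk_mono (fun _ hG => hs₂ (hs hG)) h
        rw [mk_sub] at h₂
        cases d
        · simp [sub_snoc, h₃, h₂, bor, last]
        · simp [h₂] at h₄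
          simp [h₄]

/-- `λ y. a`, where `a` is `|y| - |x|` in unary notation if `Drop(x, -)` removes one digit at each
step until none is left. -/
def excessC {Γ : Ctx} (x : Tm Γ Ty.s) (y : Tm Γ Ty.s) : Tm Γ Ty.s :=
  recT epsT
    (Tm.lam (Tm.lam (condT (dropT ((x.wk _).wk _) (Tm.var (Var.succ Var.zero)))
      (snocT (Tm.var Var.zero) true) epsT epsT)))
    (Tm.lam (Tm.lam (condT (dropT ((x.wk _).wk _) (Tm.var (Var.succ Var.zero)))
      (snocT (Tm.var Var.zero) true) epsT epsT)))
    (Tm.lam (snocT (Tm.var Var.zero) true)) y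

theorem subst_excessC {Δ : Ctx} (σ : Sb Γ Δ) (x y : Tm Γ Ty.s) :
    (excessC x y).subst σ = excessC (x.subst σ) (y.subst σ) := by
  simp [excessC, Tm.wk_lift]
  rfl

theorem excess_eps (x : Tm Γ Ty.s) : mk H (excessC x epsT) = eps := rec_eps _ _ _ _

theorem excess_snoc_trunc (x y : Tm Γ Ty.s) (b : Bool) : mk H (excessC x (snocT y b)) =
    trunc (cond (drop (mk H x) (mk H y)) (snoc (mk H (excessC x y)) true) eps eps)
      (snoc (mk H y) true) := by
  refine (rec_snoc _ _ _ _ _ _).trans ?_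
  rw [Bool.cond_self, mk_beta₂, mk_beta]
  simp [excessC]

/-- The excess grows by at most one digit per step, so it is never longer than `y`. This makes the
truncation in its own recursion harmless and gives `excess_snoc`. -/
theorem trunc_excess (x y : Tm Γ Ty.s) :
    trunc (mk H (excessC x y)) (mk H y) = mk H (excessC x y) := by
  have := induction (H := H) (truncT (excessC (x.wk _) (Tm.var Var.zero)) (Tm.var Var.zero))
    (excessC (x.wk _) (Tm.var Var.zero)) (by simp [subst_excessC, excess_eps])
    (fun H' b _ h => ?_) y
  · simpa [subst_excessC] using this
  · simp only [mk_trunc] at h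
    simp only [subst_excessC, subst_truncT, mk_trunc, excess_snoc_trunc, mk_snoc, subst_varT,
      Sb.cons_zero, Tm.wk_cons, Tm.subst_toSb_wk]
    refine mk_cases (t := truncT (truncT (condT (dropT (x.wk _) (Tm.var Var.zero))
      (snocT (excessC (x.wk _) (Tm.var Var.zero)) true) epsT epsT) (snocT (Tm.var Var.zero) true))
      (snocT (Tm.var Var.zero) b)) (u := truncT (condT (dropT (x.wk _) (Tm.var Var.zero))
      (snocT (excessC (x.wk _) (Tm.var Var.zero)) true) epsT epsT) (snocT (Tm.var Var.zero) true))
      (dropT (x.wk Ty.s) (Tm.var Var.zero)) (fun H₁ hs h₁ => ?_) fun H₁ m c hs h₁ => ?_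
    · have h₂ := mk_mono (t := truncT (excessC (x.wk _) (Tm.var Var.zero)) (Tm.var Var.zero)) hs h
      simp only [mk_drop, mk_trunc] at h₁ h₂
      simp [h₁, h₂]
    · simp only [mk_drop] at h₁
      cases c <;> simp [h₁]

theorem excess_snoc (x y : Tm Γ Ty.s) (b : Bool) : mk H (excessC x (snocT y b)) =
    cond (drop (mk H x) (mk H y)) (snoc (mk H (excessC x y)) true) eps eps := by
  rw [excess_snoc_trunc]
  refine mk_cases (t := truncT (condT (dropT x y) (snocT (excessC x y) true) epsT epsT)
    (snocT y true)) (u := condT (dropT x y) (snocT (excessC x y) true) epsT epsT)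
    (dropT x y) (fun H₁ hs h₁ => ?_) fun H₁ m c hs h₁ => ?_
  · simp only [mk_drop] at h₁
    simp [h₁, trunc_excess]
  · simp only [mk_drop] at h₁
    cases c <;> simp [h₁]

/-- A conservation law: each step adds a `1` to `1^y` and takes a digit from `Drop(1^w, y)`, so
their concatenation stays `1^w`. Once nothing is left to take, the extra ones are recorded by the
excess. -/
theorem pow_cat_drop (w y : Tm Γ Ty.s) :
    cat (pow (mk H y)) (drop (pow (mk H w)) (mk H y)) =
      cond (drop (pow (mk H w)) (mk H y))
        (cat (mk H (excessC (timesT oneT w) y)) (pow (mk H w))) (pow (mk H w)) (pow (mk H w)) := by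
  have := induction (H := H)
    (catT (timesT oneT (Tm.var Var.zero)) (dropT (timesT oneT (w.wk _)) (Tm.var Var.zero)))
    (condT (dropT (timesT oneT (w.wk _)) (Tm.var Var.zero))
      (catT (excessC (timesT oneT (w.wk _)) (Tm.var Var.zero)) (timesT oneT (w.wk _)))
      (timesT oneT (w.wk _)) (timesT oneT (w.wk _)))
    (by simp [subst_excessC, excess_eps])
    (fun H' b _ h => ?_) y
  · simpa [subst_excessC] using this
  · simp only [mk_cat, mk_times, mk_one, times_one, mk_drop, mk_cond] at h
    refine mk_cases (dropT (timesT oneT (w.wk Ty.s)) (Tm.var Var.zero))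
      (fun H₁ hs h₁ => ?_) fun H₁ m c hs h₁ => ?_
    all_goals
      have h₂ := mk_mono (t := catT (timesT oneT (Tm.var Var.zero))
        (dropT (timesT oneT (w.wk _)) (Tm.var Var.zero)))
        (u := condT (dropT (timesT oneT (w.wk _)) (Tm.var Var.zero))
          (catT (excessC (timesT oneT (w.wk _)) (Tm.var Var.zero)) (timesT oneT (w.wk _)))
          (timesT oneT (w.wk _)) (timesT oneT (w.wk _))) hs (by simpa using h)
      have hp := one_cat_pow (mk H₁ (w.wk Ty.s))
      have hv := one_cat_pow (mk H₁ (Tm.var Var.zero : Tm (Ty.s :: Γ) Ty.s))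
      simp only [mk_cat, mk_times, mk_one, times_one, mk_drop, mk_cond] at h₁ h₂
      simp [subst_excessC, excess_snoc, h₁]
      simp [h₁] at h₂
    · rw [h₂, ← cat_snoc, ← hp, ← cat_assoc, cat_snoc, cat_eps]
    -- The induction hypothesis reads `1^w = 1^y m c`. Since `1·1^w = 1^w·1`, deleting the last
    -- digit of `1·1^y m c` gives `1^w` again; the value of the digit `c` is not needed.
    · have hW : cat (snoc (pow (mk H₁ (Tm.var Var.zero))) true) (mk H₁ m) =
          pow (mk H₁ (w.wk Ty.s)) := by
        rw [← hv, cat_assoc]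
        have := congrArg tail hp
        rw [tail_snoc] at this
        refine Eq.trans ?_ this
        cases c <;> simp at h₂ <;> rw [← h₂] <;> simp
      -- By the preceding equation `m` is a suffix of `1^w`, so truncating it to that length changes
      -- nothing.
      have ht : trunc (mk H₁ m) (pow (mk H₁ (w.wk Ty.s))) = mk H₁ m := by
        rw [← hW, trunc_cat_self]
      cases c <;> simp [ht, hW]

/-- A long enough bound for strings of length at most `|x|` or at most `|y|`. -/
def bound (x y : Q H) : Q H := cat (pow (pow x)) (pow (pow y))

/-- `w ≼ t` makes `1^w` a prefix of `1^t`, so `Drop(1^w, 1^t) = ε`, and the conservation law at `y =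
1^t` gives the equation. The second exponential arises because `1^t` itself plays the role of `y`.
-/
theorem pow_pow_eq {w t : Tm Γ Ty.s} (h : Prov H (Fm.le w t)) :
    pow (pow (mk H t)) =
      cat (mk H (excessC (timesT oneT w) (timesT oneT t))) (pow (mk H w)) := by
  rw [Fm.le, mk_pre] at h
  simp only [mk_times, mk_one, times_one] at h
  have hd := cond_sub_drop (pow (mk H w)) (pow (mk H t))
  rw [h, cond_one] at hd
  have := pow_cat_drop w (timesT oneT t) (H := H)
  simp only [mk_times, mk_one, times_one] at this
  rwa [hd, cond_eps, cat_eps] at this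

/-- Powers of `1` commute, so the factor `1^w` hidden in the left half can be moved to the right
end, where `Trunc` starts reading. -/
theorem trunc_bound_left {w t : Tm Γ Ty.s} (h : Prov H (Fm.le w t)) (y : Q H) :
    trunc (mk H w) (bound (mk H t) y) = mk H w := by
  rw [bound, pow_pow_eq h, cat_assoc, pow_cat_pow, ← cat_assoc, trunc_cat_pow]

theorem trunc_bound_right {w t : Tm Γ Ty.s} (h : Prov H (Fm.le w t)) (x : Q H) :
    trunc (mk H w) (bound x (mk H t)) = mk H w := by
  rw [bound, pow_pow_eq h, ← cat_assoc, trunc_cat_pow]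

/-! ### Coding `x = 1 ∧ u = v` by one equation -/

/-- `0` if `x = 0` and `1` otherwise. -/
def testT (x : Tm Γ Ty.s) : Tm Γ Ty.s := condT x oneT (condT (tailT x) zeroT oneT oneT) oneT

/-- The left side of the equation that codes `x = 1 ∧ u = v`. -/
def codeL (x u : Tm Γ Ty.s) : Tm Γ Ty.s := condT x zeroT zeroT (condT (tailT x) u zeroT zeroT)

def codeR (x v : Tm Γ Ty.s) : Tm Γ Ty.s := condT x oneT oneT (condT (tailT x) v oneT oneT)

/-- For `x = 1` the two sides are `u` and `v`; for every other `x` they are `0` and `1`, and `0 = 1`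
implies everything. The case axiom, applied to `x` and then to its tail, makes the distinction. -/
theorem mk_code (x u v : Tm Γ Ty.s) : mk H (codeL x u) = mk H (codeR x v) ↔
    mk H x = mk H oneT ∧ mk H u = mk H v := by
  constructor
  · intro h
    have key : Prov H (Fm.and (Fm.eq x oneT) (Fm.eq u v)) := by
      refine cases x (fun H₁ hs h₁ => ?_) fun H₁ m b hs h₁ => ?_
      · exact of_zero_eq_one (by simpa [codeL, codeR, h₁] using mk_mono hs h) _
      cases b
      · exact of_zero_eq_one (by simpa [codeL, codeR, h₁] using mk_mono hs h) _
      refine cases m (fun H₂ hs₂ h₂ => ?_) fun H₂ p c hs₂ h₂ => ?_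
      · have h₃ := mk_mono (u := snocT m true) hs₂ h₁
        have h₄ := mk_mono hs₂ (mk_mono hs h)
        rw [mk_snoc, h₂] at h₃
        exact Prov.andI (mk_eq.1 (by simp [h₃]))
          (mk_eq.1 (by simpa [codeL, codeR, h₃] using h₄))
      · have h₃ := mk_mono (u := snocT m true) hs₂ h₁
        have h₄ := mk_mono hs₂ (mk_mono hs h)
        rw [mk_snoc, h₂] at h₃
        exact of_zero_eq_one (by cases c <;> simpa [codeL, codeR, h₃] using h₄) _
    exact ⟨mk_eq.2 (Prov.andE₁ key), mk_eq.2 (Prov.andE₂ key)⟩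
  · rintro ⟨h₁, h₂⟩
    simp only [mk_one] at h₁
    simp [codeL, codeR, h₁, h₂]

theorem mk_testT_zero {x : Tm Γ Ty.s} (h : Prov H (Fm.eq x zeroT)) :
    mk H (testT x) = mk H zeroT := by
  have h := mk_eq.2 h
  simp only [mk_zero] at h
  simp [testT, h]

/-- A realizer of a disjunction may be any string different from `0`. The case axiom determines its
shape, and the single shape excluded by the hypothesis is an empty string followed by `0`. -/
theorem mk_testT_one {x : Tm Γ Ty.s} (h : Prov H (Fm.neg (Fm.eq x zeroT))) :
    mk H (testT x) = mk H oneT := by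
  refine mk_cases x (fun H₁ hs h₁ => ?_) fun H₁ m b hs h₁ => ?_
  · simp [testT, h₁]
  cases b
  · refine mk_cases m (fun H₂ hs₂ h₂ => ?_) fun H₂ p c hs₂ h₂ => ?_
    · have h₃ := mk_mono (u := snocT m false) hs₂ h₁
      rw [mk_snoc, h₂] at h₃
      refine mk_eq.2 (Prov.botE (Prov.impE ((h.mono hs).mono hs₂) (mk_eq.1 ?_)))
      simp [h₃]
    · have h₃ := mk_mono (u := snocT m false) hs₂ h₁
      rw [mk_snoc, h₂] at h₃
      cases c <;> simp [testT, h₃]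
  · simp [testT, h₁]

end Q

/-! ### Soundness of realizability -/

namespace Prov

theorem imp_mono {Γ : Ctx} {H : List (Fm Γ)} {F F' G G' : Fm Γ} (hF : ∀ H, Prov H F' → Prov H F)
    (hG : ∀ H, Prov H G → Prov H G') (h : Prov H (Fm.imp F G)) : Prov H (Fm.imp F' G') :=
  impI (hG _ (impE (h.cons _) (hF _ hyp₀)))

theorem or_mono {Γ : Ctx} {H : List (Fm Γ)} {F F' G G' : Fm Γ} (hF : ∀ H, Prov H F → Prov H F')
    (hG : ∀ H, Prov H G → Prov H G') (h : Prov H (Fm.or F G)) : Prov H (Fm.or F' G') :=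
  orE h (orI₁ (hF _ hyp₀)) (orI₂ (hG _ hyp₀))

theorem and_mono {Γ : Ctx} {H : List (Fm Γ)} {F F' G G' : Fm Γ} (hF : ∀ H, Prov H F → Prov H F')
    (hG : ∀ H, Prov H G → Prov H G') (h : Prov H (Fm.and F G)) : Prov H (Fm.and F' G') :=
  andI (hF _ (andE₁ h)) (hG _ (andE₂ h))

theorem _root_.IPOR.Fm.lift_wk_inst_zero {Γ : Ctx} {a : Ty} (F : Fm (a :: Γ)) :
    (F.subst ((Ren.wk a).toSb.lift a)).inst (Tm.var Var.zero) = F := by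
  rw [Fm.inst, Fm.subst_subst, Sb.lift_comp_inst]
  conv_rhs => rw [← F.subst_id]
  congr 1
  exact Sb.ext_cons rfl fun _ _ => rfl

theorem all_open {Γ : Ctx} {H : List (Fm Γ)} {a : Ty} {F : Fm (a :: Γ)} (h : Prov H (Fm.all a F)) :
    Prov (H.map (Fm.wk a)) F := by
  have := allE (F := F.subst ((Ren.wk a).toSb.lift a)) (Tm.var Var.zero) (h.wk a)
  rwa [Fm.lift_wk_inst_zero] at this

theorem all_mono {Γ : Ctx} {H : List (Fm Γ)} {a : Ty} {F G : Fm (a :: Γ)}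
    (hF : ∀ H, Prov H F → Prov H G) (h : Prov H (Fm.all a F)) : Prov H (Fm.all a G) :=
  allI (hF _ h.all_open)

theorem ex_mono {Γ : Ctx} {H : List (Fm Γ)} {a : Ty} {F G : Fm (a :: Γ)}
    (hF : ∀ H, Prov H F → Prov H G) (h : Prov H (Fm.ex a F)) : Prov H (Fm.ex a G) := by
  refine exE h (exI (F := G.subst ((Ren.wk a).toSb.lift a)) (Tm.var Var.zero) ?_)
  rw [Fm.lift_wk_inst_zero]
  exact hF _ hyp₀

theorem alls_mono {Γ : Ctx} {H : List (Fm Γ)} (l : List Ty) {F G : Fm (ext l Γ)}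
    (hF : ∀ H, Prov H F → Prov H G) (h : Prov H (Fm.alls l F)) : Prov H (Fm.alls l G) := by
  induction l generalizing Γ with
  | nil => exact hF _ h
  | cons a l ih => exact all_mono (fun H h => ih hF h) h

end Prov

theorem Fm.inst_lift {Γ Δ : Ctx} {a : Ty} (F : Fm (a :: Γ)) (σ : Sb Γ Δ) (u : Tm Δ a) :
    (F.subst (σ.lift a)).inst u = F.subst (Sb.cons u σ) := by
  rw [Fm.inst, Fm.subst_subst, Sb.lift_comp_inst]

theorem Prov.of_realize {Γ Δ : Ctx} {H : List (Fm Δ)} (F : Fm Γ) {σ : Sb Γ Δ} {r : Tms Δ F.rtys}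
    (h : Prov H (F.realize σ r)) : Prov H (F.subst σ) := by
  induction F generalizing Δ with
  | eq t u => exact h
  | pre t u => exact h
  | flip t => exact h
  | and G H ihG ihH => exact Prov.and_mono (fun _ => ihG) (fun _ => ihH) h
  | or G H ihG ihH =>
    exact Prov.or_mono (fun _ h => ihG (Prov.andE₂ h)) (fun _ h => ihH (Prov.andE₂ h)) h
  | imp G H ihG ihH => exact Prov.andE₂ h
  | all a G ih => exact Prov.all_mono (fun _ => ih) h
  | ex a G ih =>
    refine Prov.exI r.head ?_
    rw [Fm.inst_lift]
    exact ih h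

/-! ### Realizability and provable equality of terms -/

theorem Prov.pre_congr {Γ : Ctx} {H : List (Fm Γ)} {t t' u u' : Tm Γ Ty.s}
    (ht : Prov H (Fm.eq t t')) (hu : Prov H (Fm.eq u u')) (h : Prov H (Fm.pre t u)) :
    Prov H (Fm.pre t' u') := by
  rw [Q.mk_pre] at h ⊢
  rwa [← Q.mk_eq.2 ht, ← Q.mk_eq.2 hu]

theorem Prov.flip_congr {Γ : Ctx} {H : List (Fm Γ)} {t t' : Tm Γ Ty.s}
    (ht : Prov H (Fm.eq t t')) (h : Prov H (Fm.flip t)) : Prov H (Fm.flip t') :=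
  eqSubst (Fm.flip (Tm.var Var.zero)) ht h

/-- Componentwise provable equality of substitutions. -/
def Sb.Eqv {Γ Δ : Ctx} (σ τ : Sb Γ Δ) : Prop := ∀ a x, TmEq (σ a x) (τ a x)

namespace Sb.Eqv

variable {Γ Δ : Ctx} {σ τ : Sb Γ Δ}

theorem symm (h : Eqv σ τ) : Eqv τ σ := fun a x => (h a x).symm

theorem lift (h : Eqv σ τ) (b : Ty) : Eqv (σ.lift b) (τ.lift b)
  | _, Var.zero => TmEq.refl _
  | _, Var.succ x => (h _ x).wk b

theorem cons (h : Eqv σ τ) {b : Ty} {t u : Tm Δ b} (h' : TmEq t u) :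
    Eqv (Sb.cons t σ) (Sb.cons u τ)
  | _, Var.zero => h'
  | _, Var.succ x => h _ x

theorem ren (h : Eqv σ τ) {Θ : Ctx} (ρ : Ren Δ Θ) :
    Eqv (fun _ x => (σ _ x).ren ρ) (fun _ x => (τ _ x).ren ρ) := fun a x => by
  simp only [Tm.ren_eq_subst]
  exact (h a x).subst _

end Sb.Eqv

theorem Fm.subst_congr {Γ Δ : Ctx} (F : Fm Γ) {σ τ : Sb Γ Δ} (h : Sb.Eqv σ τ) {H : List (Fm Δ)}
    (hF : Prov H (F.subst σ)) : Prov H (F.subst τ) := by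
  induction F generalizing Δ with
  | eq t u =>
    exact ((TmEq.subst_congr t h).symm.prov.trans hF).trans (TmEq.subst_congr u h).prov
  | pre t u => exact Prov.pre_congr (TmEq.subst_congr t h).prov (TmEq.subst_congr u h).prov hF
  | flip t => exact Prov.flip_congr (TmEq.subst_congr t h).prov hF
  | and G H ihG ihH => exact Prov.and_mono (fun _ => ihG h) (fun _ => ihH h) hF
  | or G H ihG ihH => exact Prov.or_mono (fun _ => ihG h) (fun _ => ihH h) hF
  | imp G H ihG ihH => exact Prov.imp_mono (fun _ => ihG h.symm) (fun _ => ihH h) hF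
  | all a G ih => exact Prov.all_mono (fun _ => ih (h.lift a)) hF
  | ex a G ih => exact Prov.ex_mono (fun _ => ih (h.lift a)) hF

theorem Tms.Eq.ren {Γ Δ : Ctx} (ρ : Ren Γ Δ) {l : List Ty} {t u : Tms Γ l} (h : Tms.Eq l t u) :
    Tms.Eq l (Tms.ren ρ l t) (Tms.ren ρ l u) := by
  rw [Tms.ren_eq, Tms.ren_eq]
  exact h.subst _

theorem Tms.Eq.wk {Γ : Ctx} (b : Ty) {l : List Ty} {t u : Tms Γ l} (h : Tms.Eq l t u) :
    Tms.Eq l (Tms.wk b l t) (Tms.wk b l u) := by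
  rw [Tms.wk_eq, Tms.wk_eq]
  exact h.subst _

/-- Realizers built by abstraction reduce to the intended terms only up to β and η. The substitution
has to vary too, because a realizer of an existential formula enters it as the witness. -/
theorem Fm.realize_congr {Γ Δ : Ctx} (F : Fm Γ) {σ τ : Sb Γ Δ} (h : Sb.Eqv σ τ) {K : List (Fm Δ)}
    {r r' : Tms Δ F.rtys} (hr : Tms.Eq _ r r') (hF : Prov K (F.realize σ r)) :
    Prov K (F.realize τ r') := by
  induction F generalizing Δ with
  | eq t u => exact Fm.subst_congr (Fm.eq t u) h hF
  | pre t u => exact Fm.subst_congr (Fm.pre t u) h hF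
  | flip t => exact Fm.subst_congr (Fm.flip t) h hF
  | and G H ihG ihH =>
    exact Prov.and_mono (fun _ => ihG h hr.left) (fun _ => ihH h hr.right) hF
  | or G H ihG ihH =>
    have h₀ : ∀ {K}, Prov K (Fm.eq r.head zeroT) → Prov K (Fm.eq r'.head zeroT) :=
      fun h => hr.1.symm.prov.trans h
    have h₀' : ∀ {K}, Prov K (Fm.eq r'.head zeroT) → Prov K (Fm.eq r.head zeroT) :=
      fun h => hr.1.prov.trans h
    exact Prov.or_mono (fun _ => Prov.and_mono (fun _ => h₀) (fun _ => ihG h hr.2.left))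
      (fun _ => Prov.and_mono (fun _ => Prov.imp_mono (fun _ => h₀') (fun _ h => h))
        (fun _ => ihH h hr.2.right)) hF
  | imp G H ihG ihH =>
    refine Prov.and_mono (fun _ => Prov.alls_mono _ fun _ =>
      Prov.imp_mono (fun _ => ihG (h.symm.ren _) (Tms.Eq.refl _ _))
      (fun _ => ihH (h.ren _) (Tms.Eq.apps (hr.ren _) _)))
      (fun _ => Prov.imp_mono (fun _ => Fm.subst_congr G h.symm) (fun _ => Fm.subst_congr H h)) hF
  | all a G ih =>
    exact Prov.all_mono (fun _ => ih (h.lift a) (Tms.Eq.apps (Tms.Eq.wk a hr) _)) hF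
  | ex a G ih => exact ih (h.cons hr.1) hr.2 hF

/-! ### Introduction and elimination of realizers -/

section Realizers

variable {Γ Δ : Ctx} {K : List (Fm Δ)} {σ : Sb Γ Δ}

theorem Fm.realize_congr' (F : Fm Γ) {r r' : Tms Δ F.rtys} (hr : Tms.Eq _ r r')
    (hF : Prov K (F.realize σ r)) : Prov K (F.realize σ r') :=
  F.realize_congr (fun _ _ => TmEq.refl _) hr hF

theorem Sb.ren_eq_comp {Θ : Ctx} (ρ : Ren Δ Θ) : (fun _ x => (σ _ x).ren ρ) = σ.comp ρ.toSb :=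
  Sb.ext_apply fun _ _ => Tm.ren_eq_subst _ _

theorem Fm.realize_impE {G H : Fm Γ} {y : Tms Δ (Fm.imp G H).rtys} {x : Tms Δ G.rtys}
    (h : Prov K ((Fm.imp G H).realize σ y)) (hx : Prov K (G.realize σ x)) :
    Prov K (H.realize σ (Tms.apps G.rtys H.rtys y x)) := by
  have h₁ := Prov.allsE _ (Prov.andE₁ h) x
  have hσ : Sb.comp (fun _ y => (σ _ y).ren (Ren.wks G.rtys)) (Sb.conss G.rtys x (Sb.id Δ)) = σ := by
    rw [Sb.ren_eq_comp, Sb.comp_assoc, Sb.wks_conss, Sb.comp_id]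
  have hy : ∀ y : Tms Δ (H.rtys.map (arrs G.rtys)),
      (Tms.apps G.rtys H.rtys (Tms.ren (Ren.wks G.rtys) _ y) (Tms.vars G.rtys)).subst
        (Sb.conss G.rtys x (Sb.id Δ)) = Tms.apps G.rtys H.rtys y x := fun y => by
    rw [Tms.apps_subst, Tms.vars_conss, Tms.ren_eq, Tms.subst_subst, Sb.wks_conss, Tms.subst_id]
  have h₂ : Prov K (Fm.imp (G.realize σ x) (H.realize σ (Tms.apps G.rtys H.rtys y x))) := by
    refine Eq.mp (congrArg (Prov K) (congrArg₂ Fm.imp ?_ ?_)) h₁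
    · rw [Fm.realize_subst, hσ, Tms.vars_conss]
    · rw [Fm.realize_subst, hσ]
      exact congrArg _ (hy y)
  exact Prov.impE h₂ hx

theorem Fm.realize_impI {G H : Fm Γ} (r : Tms (ext G.rtys Δ) H.rtys)
    (h : Prov (G.realize (σ.comp (Ren.wks G.rtys).toSb) (Tms.vars G.rtys) ::
      K.map (Fm.ren (Ren.wks G.rtys))) (H.realize (σ.comp (Ren.wks G.rtys).toSb) r))
    (h' : Prov K (Fm.imp (G.subst σ) (H.subst σ))) :
    Prov K ((Fm.imp G H).realize σ (Tms.lams G.rtys H.rtys r)) := by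
  refine Prov.andI (Prov.allsI _ (Prov.impI ?_)) h'
  rw [Sb.ren_eq_comp]
  refine H.realize_congr' (Tms.Eq.symm ?_) h
  rw [Tms.ren_eq]
  refine (Tms.apps_lams _ _ _ _ _).trans ?_
  rw [Sb.conss_vars, Tms.subst_id]
  exact Tms.Eq.refl _ _

theorem Fm.realize_allE {a : Ty} {G : Fm (a :: Γ)} {x : Tms Δ (Fm.all a G).rtys}
    (h : Prov K ((Fm.all a G).realize σ x)) (u : Tm Δ a) :
    Prov K (G.realize (Sb.cons u σ) (Tms.apps [a] G.rtys x (u, ()))) := by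
  have h₁ := Prov.allE u h
  rw [Fm.inst, Fm.realize_subst, Sb.lift_comp_inst] at h₁
  have hx : ∀ x : Tms Δ (G.rtys.map (arrs [a])),
      (Tms.apps [a] _ (Tms.wk a _ x) (Tm.var Var.zero, ())).subst (Sb.inst u) =
        Tms.apps [a] _ x (u, ()) := fun x => by
    refine (Tms.apps_subst _ _ _ _ _).trans (congrArg (Tms.apps [a] _ · (u, ())) ?_)
    rw [Tms.wk_eq, Tms.subst_subst]
    exact Tms.subst_id _ x
  exact Eq.mp (congrArg (fun y => Prov K (G.realize _ y)) (hx x)) h₁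

theorem Fm.realize_allI {a : Ty} {G : Fm (a :: Γ)} (r : Tms (a :: Δ) G.rtys)
    (h : Prov (K.map (Fm.wk a)) (G.realize (σ.lift a) r)) :
    Prov K ((Fm.all a G).realize σ (Tms.lams [a] G.rtys r)) := by
  refine Prov.allI (G.realize_congr' (Tms.Eq.symm ?_) h)
  rw [Tms.wk_eq]
  refine (Tms.apps_lams [a] _ _ _ _).trans ?_
  have : Sb.conss [a] (Tm.var Var.zero, ()) (Ren.wk a).toSb = Sb.id (a :: Δ) :=
    Sb.ext_cons rfl fun _ _ => rfl
  rw [this]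
  exact Eq.mp (congrArg (Tms.Eq _ · r) (Tms.subst_id _ r).symm) (Tms.Eq.refl _ _)

end Realizers

/-! ### Terms of arbitrary types -/

/-- A term of each type. -/
def Tm.default {Γ : Ctx} : (a : Ty) → Tm Γ a
  | Ty.s => epsT
  | Ty.arr _ b => Tm.lam (Tm.default b)

def Tms.default {Γ : Ctx} : (l : List Ty) → Tms Γ l
  | [] => ()
  | a :: l => (Tm.default a, Tms.default l)

/-- Definition by cases at all types: `t` if `d = 0` and `u` if `d = 1`. -/
def Tm.ite : {Γ : Ctx} → (a : Ty) → Tm Γ Ty.s → Tm Γ a → Tm Γ a → Tm Γ a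
  | _, Ty.s, d, t, u => condT d epsT t u
  | _, Ty.arr a b, d, t, u => Tm.lam (Tm.ite b (d.wk a) (Tm.app (t.wk a) (Tm.var Var.zero))
      (Tm.app (u.wk a) (Tm.var Var.zero)))

theorem Tm.ite_subst {Γ Δ : Ctx} (a : Ty) (d : Tm Γ Ty.s) (t u : Tm Γ a) (σ : Sb Γ Δ) :
    (Tm.ite a d t u).subst σ = Tm.ite a (d.subst σ) (t.subst σ) (u.subst σ) := by
  induction a generalizing Γ Δ with
  | s => rfl
  | arr a b iha ihb => simp [ite, ihb, Tm.wk_lift]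

/-- At an arrow type the case distinction is made pointwise under an abstraction, and (η) recovers
the chosen function. -/
theorem Tm.ite_bit {Γ : Ctx} (a : Ty) (b : Bool) (t u : Tm Γ a) :
    TmEq (Tm.ite a (bitT b) t u) (bif b then u else t) := by
  induction a generalizing Γ with
  | s =>
    refine TmEq.base (Q.mk_eq.1 ?_)
    cases b <;> simp [ite, bitT]
  | arr a c iha ihc =>
    have hb : (bitT b : Tm Γ Ty.s).wk a = bitT b := by cases b <;> rfl
    refine TmEq.trans (TmEq.lam ?_) (TmEq.eta _)
    rw [hb]
    refine (ihc _ _).trans ?_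
    cases b <;> exact TmEq.refl _

def Tms.ite {Γ : Ctx} (d : Tm Γ Ty.s) : (l : List Ty) → Tms Γ l → Tms Γ l → Tms Γ l
  | [], _, _ => ()
  | a :: l, t, u => (Tm.ite a d t.head u.head, Tms.ite d l t.rest u.rest)

theorem Tms.ite_subst {Γ Δ : Ctx} (d : Tm Γ Ty.s) (l : List Ty) (t u : Tms Γ l) (σ : Sb Γ Δ) :
    (Tms.ite d l t u).subst σ = Tms.ite (d.subst σ) l (t.subst σ) (u.subst σ) := by
  induction l with
  | nil => rfl
  | cons a l ih => exact Prod.ext (Tm.ite_subst _ _ _ _ _) (ih _ _)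

theorem Tms.ite_bit {Γ : Ctx} (b : Bool) (l : List Ty) (t u : Tms Γ l) :
    Tms.Eq l (Tms.ite (bitT b) l t u) (bif b then u else t) := by
  induction l with
  | nil => trivial
  | cons a l ih =>
    refine ⟨(Tm.ite_bit a b t.head u.head).trans (TmEq.of_eq ?_), ?_⟩
    · cases b <;> rfl
    · refine (ih t.rest u.rest).trans ?_
      cases b <;> exact Tms.Eq.refl _ _

/-- Replacement of provably equal terms of type `s` in realizers. -/
theorem Fm.realize_replace {Γ Δ : Ctx} (F : Fm Γ) {σ : Sb Γ Δ} {K : List (Fm Δ)} {d e : Tm Δ Ty.s}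
    (h : Prov K (Fm.eq d e)) {r r' : Tms Δ F.rtys} (hr : Prov K (F.realize σ (Tms.ite d _ r r'))) :
    Prov K (F.realize σ (Tms.ite e _ r r')) := by
  -- The equation `d = e` may depend on hypotheses, so it cannot be used below abstractions, where
  -- `Tm.ite` places `d`. The formula is therefore written with a variable in place of `d`, and
  -- replacement is applied to the formula as a whole.
  have key : ∀ u : Tm Δ Ty.s, (F.realize (σ.wk Ty.s)
      (Tms.ite (Tm.var Var.zero) _ (Tms.wk _ _ r) (Tms.wk _ _ r'))).inst u =
      F.realize σ (Tms.ite u _ r r') := fun u => by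
    rw [Fm.inst, Fm.realize_subst, Tms.ite_subst, Tms.wk_eq, Tms.wk_eq, Tms.subst_subst,
      Tms.subst_subst, Sb.wk_eq_comp, Sb.comp_assoc]
    exact congrArg₂ (fun τ r => F.realize τ r) (Sb.comp_id σ)
      (congrArg₂ (Tms.ite u _) (Tms.subst_id _ _) (Tms.subst_id _ _))
  rw [← key] at hr ⊢
  exact Prov.eqSubst _ h hr


/-! ### Realizability of derivations -/

/-- Under each substitution and in each set of hypotheses, realizers of the formulas in `H` give a
realizer of `F`. -/
def Realizable {Γ : Ctx} (H : List (Fm Γ)) (F : Fm Γ) : Prop :=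
  ∀ (Δ : Ctx) (σ : Sb Γ Δ) (K : List (Fm Δ)),
    (∀ G ∈ H, ∃ r, Prov K (G.realize σ r)) → ∃ r, Prov K (F.realize σ r)

/-- Asking only for the existence of a realizer hides the casts between the types for `Fσ` and for
`F`. -/
theorem Fm.exists_realize_subst {Γ Δ Θ : Ctx} {F : Fm Γ} {σ : Sb Γ Δ} {τ : Sb Δ Θ}
    {K : List (Fm Θ)} : (∃ r, Prov K ((F.subst σ).realize τ r)) ↔
      ∃ r, Prov K (F.realize (σ.comp τ) r) := by
  constructor
  · rintro ⟨r, h⟩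
    exact ⟨_, F.realize_of_subst σ τ r ▸ h⟩
  · rintro ⟨r, h⟩
    refine ⟨r.cast (F.rtys_subst σ).symm, ?_⟩
    rwa [realize_of_subst, Tms.cast_cast]

theorem Fm.exists_realize_inst {Γ Δ : Ctx} {a : Ty} {F : Fm (a :: Γ)} {u : Tm Γ a} {σ : Sb Γ Δ}
    {K : List (Fm Δ)} : (∃ r, Prov K ((F.inst u).realize σ r)) ↔
      ∃ r, Prov K (F.realize (Sb.cons (u.subst σ) σ) r) := by
  rw [inst, exists_realize_subst, Sb.inst_comp]

theorem Fm.exists_realize_wk {Γ Δ : Ctx} {a : Ty} {F : Fm Γ} {u : Tm Δ a} {σ : Sb Γ Δ}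
    {K : List (Fm Δ)} : (∃ r, Prov K ((F.wk a).realize (Sb.cons u σ) r)) ↔
      ∃ r, Prov K (F.realize σ r) := by
  rw [wk_eq, exists_realize_subst]; rfl

namespace Realizable

variable {Γ : Ctx} {H : List (Fm Γ)}

theorem hyps_ren {Δ Θ : Ctx} {σ : Sb Γ Δ} {K : List (Fm Δ)}
    (h : ∀ G ∈ H, ∃ r, Prov K (G.realize σ r)) (ρ : Ren Δ Θ) :
    ∀ G ∈ H, ∃ r, Prov (K.map (Fm.ren ρ)) (G.realize (σ.comp ρ.toSb) r) := fun G hG => by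
  obtain ⟨r, hr⟩ := h G hG
  have := hr.ren ρ
  rw [Fm.ren_eq, Fm.realize_subst] at this
  exact ⟨_, this⟩

theorem hyps_cons {Δ : Ctx} {σ : Sb Γ Δ} {K : List (Fm Δ)} {F : Fm Γ} {G : Fm Δ}
    {r : Tms Δ F.rtys} (h : ∀ G ∈ H, ∃ r, Prov K (G.realize σ r))
    (hF : Prov (G :: K) (F.realize σ r)) :
    ∀ G' ∈ F :: H, ∃ r, Prov (G :: K) (G'.realize σ r) := fun G' hG => by
  rcases List.mem_cons.1 hG with rfl | hG
  · exact ⟨r, hF⟩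
  · obtain ⟨r, hr⟩ := h G' hG
    exact ⟨r, hr.cons _⟩

theorem hyps_wk {Δ : Ctx} {σ : Sb Γ Δ} {K : List (Fm Δ)} {a : Ty} (u : Tm Δ a)
    (h : ∀ G ∈ H, ∃ r, Prov K (G.realize σ r)) :
    ∀ G ∈ H.map (Fm.wk a), ∃ r, Prov K (G.realize (Sb.cons u σ) r) := fun G hG => by
  obtain ⟨G', hG', rfl⟩ := List.mem_map.1 hG
  exact Fm.exists_realize_wk.2 (h G' hG')

/-- Derivable formulas hold under realized hypotheses. -/
theorem prov_subst {F : Fm Γ} (hF : Prov H F) {Δ : Ctx} {σ : Sb Γ Δ} {K : List (Fm Δ)}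
    (h : ∀ G ∈ H, ∃ r, Prov K (G.realize σ r)) : Prov K (F.subst σ) := by
  refine (hF.subst σ).cuts fun G hG => ?_
  obtain ⟨G', hG', rfl⟩ := List.mem_map.1 hG
  obtain ⟨r, hr⟩ := h G' hG'
  exact hr.of_realize

theorem eq {t u : Tm Γ Ty.s} (h : Prov H (Fm.eq t u)) : Realizable H (Fm.eq t u) :=
  fun _ _ _ hH => ⟨(), prov_subst h hH⟩

theorem pre {t u : Tm Γ Ty.s} (h : Prov H (Fm.pre t u)) : Realizable H (Fm.pre t u) :=
  fun _ _ _ hH => ⟨(), prov_subst h hH⟩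

theorem flip {t : Tm Γ Ty.s} (h : Prov H (Fm.flip t)) : Realizable H (Fm.flip t) :=
  fun _ _ _ hH => ⟨(), prov_subst h hH⟩

theorem and {F G : Fm Γ} (hF : Realizable H F) (hG : Realizable H G) :
    Realizable H (Fm.and F G) := fun Δ σ K hH => by
  obtain ⟨r, hr⟩ := hF Δ σ K hH
  obtain ⟨r', hr'⟩ := hG Δ σ K hH
  refine ⟨Tms.append _ _ r r', Prov.andI ?_ ?_⟩
  · rwa [Tms.left_append]
  · rwa [Tms.right_append]

theorem neg_of_one {Δ : Ctx} {K : List (Fm Δ)} {z : Tm Δ Ty.s} (h : Prov K (Fm.eq z oneT)) :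
    Prov K (Fm.neg (Fm.eq z zeroT)) :=
  Prov.impI (Prov.hyp₀.symm.trans (h.cons _))

theorem exists_or_left {F G : Fm Γ} {Δ : Ctx} {σ : Sb Γ Δ} {K : List (Fm Δ)} (z : Tm Δ Ty.s)
    (hz : Prov K (Fm.eq z zeroT)) (r : Tms Δ F.rtys) (r' : Tms Δ G.rtys)
    (h : Prov K (F.realize σ r)) :
    Prov K ((Fm.or F G).realize σ (z, Tms.append _ _ r r')) := by
  refine Prov.orI₁ (Prov.andI hz ?_)
  exact (Tms.left_append F.rtys G.rtys r r').symm ▸ h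

theorem exists_or_right {F G : Fm Γ} {Δ : Ctx} {σ : Sb Γ Δ} {K : List (Fm Δ)} (z : Tm Δ Ty.s)
    (hz : Prov K (Fm.eq z oneT)) (r : Tms Δ F.rtys) (r' : Tms Δ G.rtys)
    (h : Prov K (G.realize σ r')) :
    Prov K ((Fm.or F G).realize σ (z, Tms.append _ _ r r')) := by
  refine Prov.orI₂ (Prov.andI (neg_of_one hz) ?_)
  exact (Tms.right_append F.rtys G.rtys r r').symm ▸ h

theorem orE {F G C : Fm Γ} (h : Realizable H (Fm.or F G)) (hF : Realizable (F :: H) C)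
    (hG : Realizable (G :: H) C) : Realizable H C := fun Δ σ K hH => by
  obtain ⟨r, hr⟩ := h Δ σ K hH
  obtain ⟨r₁, h₁⟩ := hF Δ σ _ (hyps_cons hH (Prov.andE₂ Prov.hyp₀))
  obtain ⟨r₂, h₂⟩ := hG Δ σ _ (hyps_cons hH (Prov.andE₂ Prov.hyp₀))
  -- In the second case only `z ≠ 0` is known of the head `z`, so it is first normalized to `0` or
  -- `1` before it selects a realizer.
  refine ⟨Tms.ite (Q.testT r.head) _ r₁ r₂, Prov.orE hr ?_ ?_⟩
  · exact C.realize_replace (Q.mk_eq.1 (Q.mk_testT_zero (Prov.andE₁ Prov.hyp₀)).symm)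
      (C.realize_congr' (Tms.ite_bit false _ r₁ r₂).symm h₁)
  · exact C.realize_replace (Q.mk_eq.1 (Q.mk_testT_one (Prov.andE₁ Prov.hyp₀)).symm)
      (C.realize_congr' (Tms.ite_bit true _ r₁ r₂).symm h₂)

/-- The realizer of `G` is obtained with fresh variables as realizer of `F` and then abstracted. The
derivability of `F → G` is needed separately for the second conjunct of the implication clause. -/
theorem impI {F G : Fm Γ} (h : Realizable (F :: H) G) (h' : Prov H (Fm.imp F G)) :
    Realizable H (Fm.imp F G) := fun Δ σ K hH => by
  obtain ⟨r, hr⟩ := h _ _ _ (hyps_cons (hyps_ren hH (Ren.wks F.rtys)) (F := F) Prov.hyp₀)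
  exact ⟨_, Fm.realize_impI r hr (prov_subst h' hH)⟩

theorem iff {F G : Fm Γ} (h : Realizable [F] G) (h' : Realizable [G] F)
    (hp : Prov [] (Fm.iff F G)) : Realizable [] (Fm.iff F G) :=
  and (impI h (Prov.andE₁ hp)) (impI h' (Prov.andE₂ hp))

/-- Decision of a disjunction by the last digit of a string. -/
theorem exists_or_cases {F₀ F₁ F₂ : Fm Γ} {Δ : Ctx} {σ : Sb Γ Δ} {K : List (Fm Δ)} (x : Tm Δ Ty.s)
    (h₀ : ∃ r, Prov (Fm.eq x epsT :: K) (F₀.realize σ r))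
    (h₁ : ∃ r, Prov (Fm.eq x (snocT (tailT x) false) :: K) (F₁.realize σ r))
    (h₂ : ∃ r, Prov (Fm.eq x (snocT (tailT x) true) :: K) (F₂.realize σ r)) :
    ∃ r, Prov K ((Fm.or F₀ (Fm.or F₁ F₂)).realize σ r) := by
  obtain ⟨r₀, h₀⟩ := h₀
  obtain ⟨r₁, h₁⟩ := h₁
  obtain ⟨r₂, h₂⟩ := h₂
  have hc : ∀ {K : List (Fm Δ)} {b : Bool} (u v w : Tm Δ Ty.s),
      Prov (Fm.eq x (snocT (tailT x) b) :: K) (Fm.eq (condT x u v w) (bif b then w else v)) := by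
    intro K b u v w
    have h := Q.mk_eq.2 (Prov.hyp₀ (F := Fm.eq x (snocT (tailT x) b)) (H := K))
    refine Q.mk_eq.1 ?_
    rw [Q.mk_snoc] at h
    rw [Q.mk_cond, h]
    cases b <;> simp
  -- The first selector is `0` exactly in the case `x = ε`. The second separates the two last
  -- digits; its value at `ε` is arbitrary.
  refine ⟨(condT x zeroT oneT oneT, Tms.append _ _ r₀
    (condT x zeroT zeroT oneT, Tms.append _ _ r₁ r₂)), Prov.orE (Prov.ax (Ax.cases x)) ?_
    (Prov.orE Prov.hyp₀ ?_ ?_)⟩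
  · refine exists_or_left _ (Q.mk_eq.1 ?_) r₀ _ h₀
    have h := Q.mk_eq.2 (Prov.hyp₀ (F := Fm.eq x epsT) (H := K))
    rw [Q.mk_eps] at h
    simp [h]
  · exact exists_or_right (G := Fm.or F₁ F₂) _ (hc _ _ _) r₀
      (condT x zeroT zeroT oneT, Tms.append _ _ r₁ r₂)
      (exists_or_left _ (hc _ _ _) r₁ r₂ (h₁.mono (by simp)))
  · exact exists_or_right (G := Fm.or F₁ F₂) _ (hc _ _ _) r₀
      (condT x zeroT zeroT oneT, Tms.append _ _ r₁ r₂)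
      (exists_or_right _ (hc _ _ _) r₁ r₂ (h₂.mono (by simp)))

/-! ### Realizability of the induction axioms -/

theorem _root_.IPOR.Fm.realize_succBit {Δ : Ctx} (F : Fm (Ty.s :: Γ)) (b : Bool) (σ : Sb Γ Δ)
    (n : Tm Δ Ty.s) (y : Tms Δ (F.succBit b).rtys) :
    (F.succBit b).realize (Sb.cons n σ) y =
      F.realize (Sb.cons (snocT n b) σ) (y.cast (F.rtys_subst _)) := by
  refine (Fm.realize_of_subst _ _ _ _).trans ?_
  rw [Sb.comp_cons, subst_snocT]
  rfl

section Induction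

variable (t : Tm (Ty.s :: Γ) Ty.s) (u v : Tm (Ty.s :: Ty.s :: Γ) Ty.s)

theorem realize_exLe {Δ : Ctx} (τ : Sb (Ty.s :: Γ) Δ) (r : Tm Δ Ty.s) :
    (Fm.exLe t (Fm.eq u v)).realize τ (r, ()) = Fm.and (Fm.le r (t.subst τ))
      (Fm.eq (u.subst (Sb.cons r τ)) (v.subst (Sb.cons r τ))) := by
  rw [← Tm.wk_cons t r τ]
  rfl

/-- The two sides of the equation that codes `r ® F` for `F = (∃ z ≼ t) u = v`. -/
def realL {Δ : Ctx} (τ : Sb (Ty.s :: Γ) Δ) (r : Tm Δ Ty.s) : Tm Δ Ty.s :=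
  Q.codeL (SubT (timesT oneT r) (timesT oneT (t.subst τ))) (u.subst (Sb.cons r τ))

def realR {Δ : Ctx} (τ : Sb (Ty.s :: Γ) Δ) (r : Tm Δ Ty.s) : Tm Δ Ty.s :=
  Q.codeR (SubT (timesT oneT r) (timesT oneT (t.subst τ))) (v.subst (Sb.cons r τ))

theorem realL_subst {Δ Θ : Ctx} (τ : Sb (Ty.s :: Γ) Δ) (r : Tm Δ Ty.s) (υ : Sb Δ Θ) :
    (realL t u τ r).subst υ = realL t u (τ.comp υ) (r.subst υ) := by
  simp [realL, Q.codeL, Tm.subst_subst, Sb.comp_cons]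

theorem realR_subst {Δ Θ : Ctx} (τ : Sb (Ty.s :: Γ) Δ) (r : Tm Δ Ty.s) (υ : Sb Δ Θ) :
    (realR t v τ r).subst υ = realR t v (τ.comp υ) (r.subst υ) := by
  simp [realR, Q.codeR, Tm.subst_subst, Sb.comp_cons]

theorem realize_iff_code {Δ : Ctx} {K : List (Fm Δ)} (τ : Sb (Ty.s :: Γ) Δ) (r : Tm Δ Ty.s) :
    Prov K ((Fm.exLe t (Fm.eq u v)).realize τ (r, ())) ↔
      Q.mk K (realL t u τ r) = Q.mk K (realR t v τ r) := by
  rw [realize_exLe, realL, realR, Q.mk_code, Q.mk_eq (t := u.subst _), Q.mk_sub, Q.mk_one,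
    ← Q.mk_pre]
  exact ⟨fun h => ⟨Prov.andE₁ h, Prov.andE₂ h⟩, fun h => Prov.andI h.1 h.2⟩

theorem realize_exLe_congr {Δ : Ctx} {K : List (Fm Δ)} {τ : Sb (Ty.s :: Γ) Δ} {r r' : Tm Δ Ty.s}
    (h : Prov K (Fm.eq r r')) (hr : Prov K ((Fm.exLe t (Fm.eq u v)).realize τ (r, ()))) :
    Prov K ((Fm.exLe t (Fm.eq u v)).realize τ (r', ())) := by
  have key : ∀ z : Tm Δ Ty.s, ((Fm.exLe t (Fm.eq u v)).realize (τ.wk Ty.s)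
      (Tm.var Var.zero, ())).inst z = (Fm.exLe t (Fm.eq u v)).realize τ (z, ()) := fun z => by
    refine Eq.trans (Fm.realize_subst (Fm.exLe t (Fm.eq u v)) (τ.wk _) (Sb.inst z) _) ?_
    refine congrArg (fun τ => Fm.realize (Fm.exLe t (Fm.eq u v)) τ (z, ())) ?_
    rw [Sb.wk_eq_comp, Sb.comp_assoc]
    exact Sb.comp_id τ
  rw [← key] at hr ⊢
  exact Prov.eqSubst _ h hr

theorem realize_step {Δ : Ctx} {K : List (Fm Δ)} {σ : Sb Γ Δ} {b : Bool}
    {h : Tm Δ (Ty.s ⇒' Ty.s ⇒' Ty.s)}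
    (hh : Prov K ((Fm.all Ty.s (Fm.imp (Fm.exLe t (Fm.eq u v))
      ((Fm.exLe t (Fm.eq u v)).succBit b))).realize σ (h, ())))
    {n z : Tm Δ Ty.s}
    (hz : Prov K ((Fm.exLe t (Fm.eq u v)).realize (Sb.cons n σ) (z, ()))) :
    Prov K ((Fm.exLe t (Fm.eq u v)).realize (Sb.cons (snocT n b) σ)
      (Tm.app (Tm.app h n) z, ())) := by
  have h₁ := Fm.realize_impE (G := Fm.exLe t (Fm.eq u v)) (H := (Fm.exLe t (Fm.eq u v)).succBit b)
    (x := (z, ())) (Fm.realize_allE hh n) hz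
  exact Eq.mp (congrArg (Prov K) (Fm.realize_succBit (Fm.exLe t (Fm.eq u v)) b σ n _)) h₁

def boundT {Δ : Ctx} (x y : Tm Δ Ty.s) : Tm Δ Ty.s :=
  catT (timesT oneT (timesT oneT x)) (timesT oneT (timesT oneT y))

theorem mk_boundT {Δ : Ctx} {K : List (Fm Δ)} (x y : Tm Δ Ty.s) :
    Q.mk K (boundT x y) = Q.bound (Q.mk K x) (Q.mk K y) := by
  simp [boundT, Q.bound]

/-- The length bound of the recursion that realizes an induction axiom. -/
def boundBody {Δ : Ctx} (σ : Sb Γ Δ) : Tm (Ty.s :: Δ) Ty.s :=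
  boundT (t.subst (Sb.cons (snocT (Tm.var Var.zero) false) (σ.wk Ty.s)))
    (t.subst (Sb.cons (snocT (Tm.var Var.zero) true) (σ.wk Ty.s)))

theorem mk_app_lam_wk {Δ : Ctx} {K : List (Fm (Ty.s :: Δ))} (f : Tm (Ty.s :: Δ) Ty.s) :
    Q.mk K (Tm.app ((Tm.lam f).wk Ty.s) (Tm.var Var.zero)) = Q.mk K f := by
  rw [← Tm.subst_toSb_wk, subst_lam, Q.mk_beta, Tm.subst_subst, Sb.lift_comp_inst]
  have : Sb.cons (Tm.var Var.zero) (Ren.wk Ty.s).toSb = Sb.id (Ty.s :: Δ) :=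
    Sb.ext_cons rfl fun _ _ => rfl
  rw [this, Tm.subst_id]

/-- `Rec` iterates `h₀` and `h₁` up to truncation, and each intermediate value realizes an instance
of the formula, hence is bounded by `t`. The bound passed to `Rec` covers both possible next digits,
so the truncation is the identity. -/
theorem realize_rec {Δ : Ctx} {K : List (Fm Δ)} {σ : Sb Γ Δ} {a : Tm Δ Ty.s}
    {h : Bool → Tm Δ (Ty.s ⇒' Ty.s ⇒' Ty.s)}
    (ha : Prov K ((Fm.exLe t (Fm.eq u v)).realize (Sb.cons epsT σ) (a, ())))
    (hh : ∀ b, Prov K ((Fm.all Ty.s (Fm.imp (Fm.exLe t (Fm.eq u v))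
      ((Fm.exLe t (Fm.eq u v)).succBit b))).realize σ (h b, ())))
    (n : Tm Δ Ty.s) :
    Prov K ((Fm.exLe t (Fm.eq u v)).realize (Sb.cons n σ)
      (recT a (h false) (h true) (Tm.lam (boundBody t σ)) n, ())) := by
  let r : Tm (Ty.s :: Δ) Ty.s := recT (a.wk _) ((h false).wk _) ((h true).wk _)
    ((Tm.lam (boundBody t σ)).wk _) (Tm.var Var.zero)
  have hr : ∀ {Θ : Ctx} (n : Tm Θ Ty.s) (υ : Sb Δ Θ), r.subst (Sb.cons n υ) =
      recT (a.subst υ) ((h false).subst υ) ((h true).subst υ)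
        ((Tm.lam (boundBody t σ)).subst υ) n := fun n υ => by
    simp only [r, subst_recT, Tm.wk_cons, subst_varT, Sb.cons_zero]
  have hn : ∀ n : Tm Δ Ty.s, r.subst (Sb.inst n) =
      recT a (h false) (h true) (Tm.lam (boundBody t σ)) n := fun n => by
    refine (hr n (Sb.id Δ)).trans ?_
    simp only [Tm.subst_id]
  -- Being a realizer at `n` is coded as an equation in `n`, so induction for equations applies
  -- although the step functions may contain variables of higher type.
  have := Q.induction (H := K) (realL t u (σ.lift _) r) (realR t v (σ.lift _) r) ?_
    (fun K' b hK h' => ?_) n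
  · rw [realL_subst, realR_subst, Sb.lift_comp_inst, hn] at this
    exact (realize_iff_code t u v _ _).2 this
  · rw [realL_subst, realR_subst, Sb.lift_comp_inst, hn, ← realize_iff_code]
    exact realize_exLe_congr t u v (Prov.eqAx (EqAx.rec_eps _ _ _ _)).symm ha
  · rw [← realize_iff_code] at h'
    rw [realL_subst, realR_subst, Sb.lift_comp_cons, ← Sb.wk_eq_comp, hr, ← realize_iff_code]
    simp only [Tm.subst_toSb_wk]
    have hb : Prov K' ((Fm.all Ty.s (Fm.imp (Fm.exLe t (Fm.eq u v))
      ((Fm.exLe t (Fm.eq u v)).succBit b))).realize (σ.wk Ty.s) ((h b).wk Ty.s, ())) := by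
      exact Prov.mono (Eq.mp (congrArg (Prov _) (Fm.realize_wk _ _ _ _)) ((hh b).wk Ty.s)) hK
    have h₁ := realize_step t u v hb h'
    refine realize_exLe_congr t u v (Q.mk_eq.1 ?_) h₁
    rw [realize_exLe] at h₁
    have hle := Prov.andE₁ h₁
    -- The left half of the bound serves the digit `0`, the right half the digit `1`.
    rw [Q.mk_rec, Q.mk_snoc, Q.rec_snoc, mk_app_lam_wk, boundBody, mk_boundT]
    cases b
    · exact (Q.trunc_bound_left hle _).symm
    · exact (Q.trunc_bound_right hle _).symm

theorem induction (ht : t.FirstOrder) : Realizable [] (Fm.induction (Fm.exLe t (Fm.eq u v))) := by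
  refine impI (fun Δ σ K hH => ?_) (Prov.ax (Ax.induction t u v ht))
  obtain ⟨r, hr⟩ := hH _ List.mem_cons_self
  have hr' := Eq.mp (congrArg (Prov _) (Fm.realize_wk _ _ Ty.s r)) (hr.wk Ty.s)
  have h₀ := Fm.exists_realize_inst.1 ⟨_, Prov.andE₁ hr'⟩
  -- Both conjuncts of the induction formula are atoms, so its realizer consists of the witness
  -- alone.
  obtain ⟨⟨a, ⟨⟩⟩, ha⟩ := h₀
  have h₁ := Prov.andE₁ (Prov.andE₂ hr')
  have h₂ := Prov.andE₂ (Prov.andE₂ hr')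
  exact ⟨_, Fm.realize_allI _ (realize_rec t u v (σ := σ.wk Ty.s) ha
    (h := fun b => bif b then (Tms.wk Ty.s _ r).rest.rest.head else (Tms.wk Ty.s _ r).rest.head)
    (Bool.rec h₁ h₂) (Tm.var Var.zero))⟩

end Induction

end Realizable


/-! ### Realizability of the remaining axioms, the quantifier rules and replacement -/

namespace Realizable

variable {Γ : Ctx} {H : List (Fm Γ)}

theorem of_nil {F : Fm Γ} (h : Realizable [] F) : Realizable H F :=
  fun Δ σ K _ => h Δ σ K fun _ hG => absurd hG List.not_mem_nil

theorem hyp {F : Fm Γ} (h : F ∈ H) : Realizable H F := fun _ _ _ hH => hH F h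

theorem cond_iff (x y z w w' : Tm Γ Ty.s) :
    Realizable [] (Fm.iff (Fm.eq (condT x y z w) w')
        (Fm.or (Fm.and (Fm.eq x epsT) (Fm.eq w' y))
          (Fm.or (Fm.and (Fm.eq x (snocT (tailT x) false)) (Fm.eq w' z))
            (Fm.and (Fm.eq x (snocT (tailT x) true)) (Fm.eq w' w))))) := by
  have hp := Prov.ax (H := []) (Ax.cond x y z w w')
  refine iff (fun Δ σ K hH => ?_) (eq (Prov.impE (Prov.andE₂ hp).of_nil Prov.hyp₀)) hp
  have hw : ∀ {d : Tm Δ Ty.s} {v : Q (Fm.eq (x.subst σ) d :: K)}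
      (_ : Q.cond (Q.mk _ d) (Q.mk _ (y.subst σ)) (Q.mk _ (z.subst σ)) (Q.mk _ (w.subst σ)) = v),
      Q.mk _ (w'.subst σ) = v := fun {d v} h => by
    obtain ⟨_, h'⟩ := hH _ List.mem_cons_self
    have h₁ := Q.mk_eq.2 (h'.cons (Fm.eq (x.subst σ) d))
    rw [← h₁, ← h, ← Q.mk_eq.2 (Prov.hyp₀ (F := Fm.eq (x.subst σ) d) (H := K))]
    rfl
  refine exists_or_cases (x.subst σ) ⟨(), Prov.andI Prov.hyp₀ (Q.mk_eq.1 (hw ?_))⟩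
    ⟨(), Prov.andI Prov.hyp₀ (Q.mk_eq.1 (hw ?_))⟩
    ⟨(), Prov.andI Prov.hyp₀ (Q.mk_eq.1 (hw ?_))⟩
  · simp
  · simp
  · simp

theorem of_ax {F : Fm Γ} (h : Ax F) : Realizable [] F := by
  have hp := Prov.ax (H := []) h
  cases h with
  | pre x y =>
    exact iff (eq (Prov.impE (Prov.andE₁ hp).of_nil Prov.hyp₀))
      (pre (Prov.impE (Prov.andE₂ hp).of_nil Prov.hyp₀)) hp
  | cases x =>
    exact fun Δ σ K _ => exists_or_cases (x.subst σ) ⟨(), Prov.hyp₀⟩ ⟨(), Prov.hyp₀⟩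
      ⟨(), Prov.hyp₀⟩
  | zero_one x => exact impI (eq (Prov.impE hp.of_nil Prov.hyp₀)) hp
  | cond x y z w w' => exact cond_iff x y z w w'
  | flip x =>
    exact iff (eq (Prov.impE (Prov.andE₁ hp).of_nil Prov.hyp₀))
      (flip (Prov.impE (Prov.andE₂ hp).of_nil Prov.hyp₀)) hp
  | induction t u v ht => exact induction t u v ht

theorem allI {a : Ty} {F : Fm (a :: Γ)} (h : Realizable (H.map (Fm.wk a)) F) :
    Realizable H (Fm.all a F) := fun Δ σ K hH => by
  obtain ⟨r, hr⟩ := h _ (σ.lift a) (K.map (Fm.wk a)) (hyps_wk _ (σ.wk_eq_comp a ▸ hyps_ren hH (Ren.wk a)))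
  exact ⟨_, Fm.realize_allI r hr⟩

/-- No fresh variable is needed: the head of the realizer of `(∃y)F` is substituted for `y`, which
is why `Realizable` ranges over all substitutions. -/
theorem exE {a : Ty} {F : Fm (a :: Γ)} {G : Fm Γ} (h : Realizable H (Fm.ex a F))
    (h' : Realizable (F :: H.map (Fm.wk a)) (G.wk a)) : Realizable H G := fun Δ σ K hH => by
  obtain ⟨r, hr⟩ := h Δ σ K hH
  exact Fm.exists_realize_wk.1
    (h' Δ (Sb.cons r.head σ) K (List.forall_mem_cons.2 ⟨⟨_, hr⟩, hyps_wk _ hH⟩))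

/-- The types of realizers do not depend on the terms in the formula, so the same realizer works and
only the formula `r ® F` is rewritten. -/
theorem eqSubst {t u : Tm Γ Ty.s} (F : Fm (Ty.s :: Γ)) (h : Prov H (Fm.eq t u))
    (h' : Realizable H (F.inst t)) : Realizable H (F.inst u) := fun Δ σ K hH => by
  obtain ⟨r, hr⟩ := Fm.exists_realize_inst.1 (h' Δ σ K hH)
  refine Fm.exists_realize_inst.2 ⟨r, ?_⟩
  have key : ∀ z : Tm Δ Ty.s, (F.realize (σ.lift Ty.s) (Tms.wk _ _ r)).inst z =
      F.realize (Sb.cons z σ) r := fun z => by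
    rw [Fm.inst, Fm.realize_subst, Sb.lift_comp_inst, Tms.wk_eq, Tms.subst_subst]
    exact congrArg (F.realize _) (Tms.subst_id _ r)
  rw [← key] at hr ⊢
  exact Prov.eqSubst _ (prov_subst h hH) hr

end Realizable

/-- Completeness: derivable formulas are realizable. -/
theorem Prov.realizable {Γ : Ctx} {H : List (Fm Γ)} {F : Fm Γ} (h : Prov H F) :
    Realizable H F := by
  induction h with
  | hyp h => exact Realizable.hyp h
  | andI _ _ ih₁ ih₂ => exact ih₁.and ih₂
  | andE₁ _ ih =>
    intro Δ σ K hH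
    obtain ⟨r, hr⟩ := ih Δ σ K hH
    exact ⟨_, Prov.andE₁ hr⟩
  | andE₂ _ ih =>
    intro Δ σ K hH
    obtain ⟨r, hr⟩ := ih Δ σ K hH
    exact ⟨_, Prov.andE₂ hr⟩
  | orI₁ _ ih =>
    intro Δ σ K hH
    obtain ⟨r, hr⟩ := ih Δ σ K hH
    -- The disjunct that is not selected still occupies its part of the sequence, which is filled
    -- with default terms.
    exact ⟨_, Realizable.exists_or_left zeroT (Prov.eqRefl _) r (Tms.default _) hr⟩
  | orI₂ _ ih =>
    intro Δ σ K hH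
    obtain ⟨r, hr⟩ := ih Δ σ K hH
    exact ⟨_, Realizable.exists_or_right oneT (Prov.eqRefl _) (Tms.default _) r hr⟩
  | orE _ _ _ ih ih₁ ih₂ => exact ih.orE ih₁ ih₂
  | impI h ih => exact Realizable.impI ih (Prov.impI h)
  | impE _ _ ih ih' =>
    intro Δ σ K hH
    obtain ⟨r, hr⟩ := ih Δ σ K hH
    obtain ⟨r', hr'⟩ := ih' Δ σ K hH
    exact ⟨_, Fm.realize_impE hr hr'⟩
  | botE h => exact fun Δ σ K hH => ⟨Tms.default _, Prov.botE (Realizable.prov_subst h hH)⟩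
  | allI _ ih => exact ih.allI
  | allE t _ ih =>
    intro Δ σ K hH
    obtain ⟨r, hr⟩ := ih Δ σ K hH
    exact Fm.exists_realize_inst.2 ⟨_, Fm.realize_allE hr (t.subst σ)⟩
  | exI t _ ih =>
    intro Δ σ K hH
    obtain ⟨r, hr⟩ := Fm.exists_realize_inst.1 (ih Δ σ K hH)
    exact ⟨(t.subst σ, r), hr⟩
  | exE _ _ ih ih' => exact ih.exE ih'
  | eqRefl t => exact Realizable.eq (Prov.eqRefl t)
  | eqSubst F h _ _ ih' => exact Realizable.eqSubst F h ih'
  | eqContext C h => exact Realizable.eq (Prov.eqContext C h)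
  | eqAx h => exact Realizable.eq (Prov.eqAx h)
  | ax h => exact (Realizable.of_ax h).of_nil

/-! ### The three claims -/

theorem Provable.exists_realizedBy {Γ : Ctx} {F : Fm Γ} (h : Provable F) :
    ∃ t : Tms Γ F.rtys, Provable (F.realizedBy t) :=
  Prov.realizable h Γ (Sb.id Γ) [] fun _ hG => absurd hG List.not_mem_nil

theorem Provable.of_realizedBy {Γ : Ctx} {F : Fm Γ} {t : Tms Γ F.rtys}
    (h : Provable (F.realizedBy t)) : Provable F :=
  F.subst_id ▸ Prov.of_realize F h

theorem Provable.exists_witness {F : Fm [Ty.s, Ty.s]} (h : Provable (Fm.all Ty.s (Fm.ex Ty.s F))) :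
    ∃ t : Tm [] (Ty.s ⇒' Ty.s),
      Provable (Fm.all Ty.s (F.inst (Tm.app (t.wk Ty.s) (Tm.var Var.zero)))) := by
  obtain ⟨r, hr⟩ := h.exists_realizedBy
  refine ⟨r.head, Prov.all_mono (fun H h => ?_) hr⟩
  -- Realizability of `(∃y)F` is that of `F` with the head as witness, so soundness for `F` under
  -- this substitution removes the other components.
  have := Prov.of_realize F h
  rw [Sb.lift_id] at this
  exact this

end IPOR

theorem mainTheorem6 :
    (∀ (Γ : IPOR.Ctx) (F : IPOR.Fm Γ) (t : IPOR.Tms Γ F.rtys),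
      IPOR.Provable (F.realizedBy t) → IPOR.Provable F) ∧
    (∀ (Γ : IPOR.Ctx) (F : IPOR.Fm Γ),
      IPOR.Provable F → ∃ t : IPOR.Tms Γ F.rtys, IPOR.Provable (F.realizedBy t)) ∧
    -- in `F(x, y)` the innermost variable is `y`
    (∀ F : IPOR.Fm [IPOR.Ty.s, IPOR.Ty.s], IPOR.SigmaB1 F →
      IPOR.Provable (IPOR.Fm.all IPOR.Ty.s (IPOR.Fm.ex IPOR.Ty.s F)) →
      ∃ t : IPOR.Tm [] (IPOR.Ty.arr IPOR.Ty.s IPOR.Ty.s),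
        IPOR.Provable (IPOR.Fm.all IPOR.Ty.s
          (F.inst (IPOR.Tm.app (t.wk IPOR.Ty.s) (IPOR.Tm.var IPOR.Var.zero))))) :=
  ⟨fun _ _ _ h => h.of_realizedBy, fun _ _ h => h.exists_realizedBy, fun _ _ h => h.exists_witness⟩
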